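/- **Model.** Let $G$ be a finite simple graph and let $\pi$ be a vertex coloring. The *partial quotient graph* $P(G,\pi)$ is the directed labeled graph whose vertices are all sets $c$ of colors of $\pi$, labeled by $|\pi^{-1}(c)|$, with an edge from $c_1$ to $c_2$ iff all vertices in $\pi^{-1}(c_1)$ have the same number of neighbors in $\pi^{-1}(c_2)$, the edge being labeled by this number. *Refining $X$ with respect to $C$*, for sets of colors $C,X$, gives the coloring in which two vertices have the same color iff they had the same color before and, if they lie in $\pi^{-1}(X)$, have the same number of neighbors in $\pi^{-1}(C)$; new colors are named canonically, by the old color and the neighbor count. The *cost* of this refinement is the number of edges connecting $\pi^{-1}(X)$ with $\pi^{-1}(C)$. A *strategy* $W$ is a function that maps each finite sequence of partial quotient graphs to a pair $(C,X)$ of sets of colors. It is executed on $G$ by starting with the monochromatic coloring and, as long as the coloring is not equitable, refining $X$ with respect to $C$, where $(C,X)$ is the value of $W$ on the sequence of the partial quotient graphs of all colorings so far. $\mathrm{cost}(W,G)$ is the total cost of all these refinements ($\infty$ if no equitable coloring is ever reached). $W$ is *valid* if it reaches an equitable coloring on every finite graph, and $\mathrm{opt}(G)$ is the minimum of $\mathrm{cost}(W',G)$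 over all valid strategies $W'$. $|G|$ denotes the number of vertices plus the number of edges. **Concealer graphs.** A *unidirectional gadget* has in-vertices $b_0,b_1$, inner vertices $\beta_0,\dots,\beta_3$ and $c_0,\dots,c_3$, out-vertices $a_0,a_1$, and edges $\beta_0c_0,\beta_0c_2,\beta_1c_1,\beta_1c_3,\beta_2c_1,\beta_2c_2,\beta_3c_0,\beta_3c_3$, $c_0a_0,c_1a_0,c_2a_1,c_3a_1$, and $b_0\beta_0,b_0\beta_2,b_1\beta_1,b_1\beta_3$; in a *dead end* the last four edges are replaced by $b_0\beta_0,b_0\beta_1,b_1\beta_2,b_1\beta_3$. A *concealer gadget of level $l\ge 1$* has in-vertices $b_0,\dots,b_{2^l-1}$ and two out-vertices $a_0,a_1$; it consists of $2^{l-1}$ gadgets, the $p$-th one with in-vertices $b_{2p},b_{2p+1}$, exactly one of which (the correct one) is a unidirectional gadget while all others are dead ends, and $a_j$ is adjacent to the $j$-th out-vertex of each of them. For $k\in\mathbb N$, a graph in $\mathcal G_k$ has vertices $x_i,\ x_i^j,\ y_i^j,\ y_i$ ($0\le i<2^k$, $0\le j<k$), three vertices $v_1,v_2,v_3$, and one concealer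 gadget of each level $l\in\{1,\dots,k-1\}$. The edges outside the gadgets are $x_ix_i^j$, $x_i^jy_i^{j'}$, $y_i^jy_i$; the edge $v_1v_2$; $v_2x_i$ for $i<2^{k-1}$ and $v_3x_i$ for $i\ge 2^{k-1}$; and, with the $q$-th binary block of level $l$ being $\{q2^{k-l},\dots,(q+1)2^{k-l}-1\}$, for each gadget of level $l$, its $q$-th in-vertex is adjacent to all $y_i$ with $i$ in the $q$-th block of level $l$, and its out-vertex $a_0$ (resp. $a_1$) is adjacent to all $x_i$ with $i$ in a block of level $l+1$ with even (resp. odd) number. The class $\mathcal G_k$ consists of these graphs for all choices of the correct gadgets. **Theorem.** For every strategy $W$ there is a family of concealer graphs $G_k\in\mathcal G_k$ ($k\in\mathbb N$) such that, as $k\to\infty$, $$\mathrm{cost}(W,G_k)\in\Omega\bigl(\mathrm{opt}(G_k)\cdot\log \mathrm{opt}(G_k)\bigr),\qquad \mathrm{opt}(G_k)\in\Theta(|G_k|).$$ -/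

import Mathlib

open Filter Asymptotics

noncomputable section

/-! ### Colorings and refinement steps -/

/-- A color records, for every refinement step performed so far, the neighbor count of the
vertices of that color in that step (`none` if the color did not take part in the step).
This is a canonical naming of the classes: it is determined by the sequence of observed
neighbor counts and does not depend on the names of the vertices. -/
abbrev Color : Type := List (Option ℕ)

/-- A coloring of the vertex set `V`. -/
abbrev Coloring (V : Type) : Type := V → Color

/-- The monochromatic coloring, with which every execution starts. -/
def monochromatic (V : Type) : Coloring V := fun _ => []

/-- `degIn G A v` is the number of neighbors of `v` in the set `A`. -/
def degIn {V : Type} (G : SimpleGraph V) (A : Set V) (v : V) : ℕ :=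
  {u | u ∈ A ∧ G.Adj v u}.ncard

open Classical in
/-- Refining (the union of the classes with color in) `X` with respect to `C`: two vertices have
the same color afterwards iff they had the same color before and, in case they belong to `X`,
they have the same number of neighbors in `C`. -/
def refine {V : Type} (G : SimpleGraph V) (π : Coloring V) (C X : Set Color) : Coloring V :=
  fun v => π v ++ [if π v ∈ X then some (degIn G (π ⁻¹' C) v) else none]

/-- The cost of refining `X` with respect to `C`: the number of edges connecting `X` with `C`. -/
def refineCost {V : Type} (G : SimpleGraph V) (π : Coloring V) (C X : Set Color) : ℕ :=
  {e | e ∈ G.edgeSet ∧ ∃ u v, π u ∈ X ∧ π v ∈ C ∧ e = s(u, v)}.ncard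

/-- A coloring is equitable if vertices of the same color have the same number of neighbors in
every color class. -/
def Equitable {V : Type} (G : SimpleGraph V) (π : Coloring V) : Prop :=
  ∀ v w, π v = π w → ∀ c : Color, degIn G (π ⁻¹' {c}) v = degIn G (π ⁻¹' {c}) w

/-! ### Partial quotient graphs -/

/-- Directed graphs with vertex and edge labels whose vertices are sets of colors. The labels of
non-vertices and of non-edges are irrelevant (they are set to `0` below). -/
structure QuotientGraph : Type where
  verts : Set (Set Color)
  Adj : Set Color → Set Color → Prop
  vertLabel : Set Color → ℕ
  edgeLabel : Set Color → Set Color → ℕ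

/-- The edges of the partial quotient graph: `c₂` does not split `c₁`. -/
def quotientAdj {V : Type} (G : SimpleGraph V) (π : Coloring V) (c₁ c₂ : Set Color) : Prop :=
  c₁ ⊆ Set.range π ∧ c₂ ⊆ Set.range π ∧
    ∀ v ∈ π ⁻¹' c₁, ∀ w ∈ π ⁻¹' c₁, degIn G (π ⁻¹' c₂) v = degIn G (π ⁻¹' c₂) w

open Classical in
/-- The partial quotient graph `P(G, π)`. Its vertices are all sets of colors of `π`, labeled by
the number of vertices of these colors. There is an edge from `c₁` to `c₂` if all vertices with
color in `c₁` have the same number of neighbors with color in `c₂`; it is labeled with this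
number (`0` if `c₁ = ∅`). -/
def partialQuotient {V : Type} (G : SimpleGraph V) (π : Coloring V) : QuotientGraph where
  verts := 𝒫 (Set.range π)
  Adj := quotientAdj G π
  vertLabel c := if c ⊆ Set.range π then (π ⁻¹' c).ncard else 0
  edgeLabel c₁ c₂ :=
    if h : quotientAdj G π c₁ c₂ ∧ (π ⁻¹' c₁).Nonempty then degIn G (π ⁻¹' c₂) h.2.some else 0

/-! ### The online model -/

/-- A strategy of the online model maps the sequence of the partial quotient graphs observed so
far to a pair `(C, X)` of sets of colors, upon which `X` is refined with respect to `C`.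
(Colors that do not occur in the current coloring have no effect on the refinement.) -/
abbrev Strategy : Type := List QuotientGraph → Set Color × Set Color

namespace Strategy

/-- The execution of the strategy `W` on `G`, without the termination test: the list of the
observed partial quotient graphs and the current coloring after a number of steps. -/
def run {V : Type} (W : Strategy) (G : SimpleGraph V) : ℕ → List QuotientGraph × Coloring V
  | 0 => ([partialQuotient G (monochromatic V)], monochromatic V)
  | n + 1 =>
    let S := (W.run G n).1
    let π := (W.run G n).2
    let π' := refine G π (W S).1 (W S).2
    (S ++ [partialQuotient G π'], π')

/-- The cost of the refinement in step `n + 1` of the execution of `W` on `G`. -/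
def stepCost {V : Type} (W : Strategy) (G : SimpleGraph V) (n : ℕ) : ℕ :=
  refineCost G (W.run G n).2 (W (W.run G n).1).1 (W (W.run G n).1).2

/-- The execution of `W` on `G` reaches an equitable coloring. -/
def Terminates {V : Type} (W : Strategy) (G : SimpleGraph V) : Prop :=
  ∃ n, Equitable G (W.run G n).2

open Classical in
/-- `cost(W, G)`: the total cost of all refinements that are performed until the coloring is
equitable for the first time (infinite if this never happens). -/
def cost {V : Type} (W : Strategy) (G : SimpleGraph V) : ℕ∞ :=
  if h : W.Terminates G then ((∑ n ∈ Finset.range (Nat.find h), W.stepCost G n : ℕ) : ℕ∞) else ⊤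

/-- A strategy is valid if it terminates on all finite graphs. -/
def Valid (W : Strategy) : Prop :=
  ∀ (V : Type) [Finite V] (G : SimpleGraph V), W.Terminates G

end Strategy

/-- `IsOpt G n`: the minimal cost of a (valid) strategy on `G` is `n`. -/
def IsOpt {V : Type} (G : SimpleGraph V) (n : ℕ) : Prop :=
  IsLeast {m : ℕ∞ | ∃ W : Strategy, W.Valid ∧ m = W.cost G} (n : ℕ∞)

/-- The size of a finite graph: the number of vertices plus the number of edges. -/
def graphSize {V : Type} (G : SimpleGraph V) : ℕ := Nat.card V + G.edgeSet.ncard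

/-! ### Concealer graphs -/

/-- The vertices of the concealer graphs with parameter `k`. The concealer gadget of level
`l + 1` is indexed by `l : Fin (k - 1)`, i.e. the levels are `1, …, k - 1`. It has `2 ^ (l + 1)`
in-vertices, `2 ^ l` unidirectional gadgets (the gadget number `p` belongs to the pair of the
in-vertices number `2 * p` and `2 * p + 1`) and two out-vertices. -/
inductive ConcealerVertex (k : ℕ) : Type
  /-- the vertices of the starting gadget -/
  | start (i : Fin 3)
  /-- the layer `X` -/
  | x (i : Fin (2 ^ k))
  /-- the layer `𝒳` -/
  | xx (i : Fin (2 ^ k)) (j : Fin k)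
  /-- the layer `𝒴` -/
  | yy (i : Fin (2 ^ k)) (j : Fin k)
  /-- the layer `Y` -/
  | y (i : Fin (2 ^ k))
  /-- the in-vertices of a concealer gadget -/
  | gIn (l : Fin (k - 1)) (q : Fin (2 ^ (l.val + 1)))
  /-- the four inner vertices of a unidirectional gadget that are adjacent to its in-vertices -/
  | innerB (l : Fin (k - 1)) (p : Fin (2 ^ l.val)) (j : Fin 4)
  /-- the four inner vertices of a unidirectional gadget that are adjacent to its out-vertices -/
  | innerC (l : Fin (k - 1)) (p : Fin (2 ^ l.val)) (j : Fin 4)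
  /-- the two out-vertices of a unidirectional gadget -/
  | uOut (l : Fin (k - 1)) (p : Fin (2 ^ l.val)) (j : Fin 2)
  /-- the two out-vertices of a concealer gadget -/
  | gOut (l : Fin (k - 1)) (j : Fin 2)
  deriving DecidableEq, Fintype

/-- The positions of the correct pairs of all the concealer gadgets. -/
abbrev CorrectPairs (k : ℕ) : Type := (l : Fin (k - 1)) → Fin (2 ^ l.val)

/-- The edges of the core (a gadget of Cai, Fürer and Immerman) of a unidirectional gadget. -/
def cfiEdges : Finset (Fin 4 × Fin 4) :=
  {(0, 0), (0, 2), (1, 1), (1, 3), (2, 1), (2, 2), (3, 0), (3, 3)}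

/-- The edges of the concealer graph with parameter `k` and correct pairs `s`, each in one
direction. For `l ≤ k` the index `i < 2 ^ k` lies in the binary block of level `l` with number
`i / 2 ^ (k - l)`. -/
inductive ConcealerEdge {k : ℕ} (s : CorrectPairs k) :
    ConcealerVertex k → ConcealerVertex k → Prop
  | start : ConcealerEdge s (.start 0) (.start 1)
  /-- the second start vertex is joined to the first half of `X` … -/
  | startLeft (i : Fin (2 ^ k)) (h : i.val / 2 ^ (k - 1) = 0) : ConcealerEdge s (.start 1) (.x i)
  /-- … and the third one to the second half -/
  | startRight (i : Fin (2 ^ k)) (h : i.val / 2 ^ (k - 1) = 1) : ConcealerEdge s (.start 2) (.x i)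
  | x_xx (i : Fin (2 ^ k)) (j : Fin k) : ConcealerEdge s (.x i) (.xx i j)
  | xx_yy (i : Fin (2 ^ k)) (j j' : Fin k) : ConcealerEdge s (.xx i j) (.yy i j')
  | yy_y (i : Fin (2 ^ k)) (j : Fin k) : ConcealerEdge s (.yy i j) (.y i)
  /-- the block of level `l + 1` of `Y` with number `q` is joined to the in-vertex number `q` of
  the gadget of level `l + 1` -/
  | y_gIn (i : Fin (2 ^ k)) (l : Fin (k - 1)) (q : Fin (2 ^ (l.val + 1)))
      (h : i.val / 2 ^ (k - (l.val + 1)) = q.val) : ConcealerEdge s (.y i) (.gIn l q)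
  /-- in the correct unidirectional gadget, the in-vertices number `0` and `1` of the pair are
  joined to the inner vertices `{0, 2}` and `{1, 3}`, respectively -/
  | gIn_correct (l : Fin (k - 1)) (q : Fin (2 ^ (l.val + 1))) (p : Fin (2 ^ l.val)) (j : Fin 4)
      (hp : p = s l) (h : q.val = 2 * p.val + j.val % 2) :
      ConcealerEdge s (.gIn l q) (.innerB l p j)
  /-- in a dead end, the in-vertices number `0` and `1` of the pair are joined to the inner
  vertices `{0, 1}` and `{2, 3}`, respectively -/
  | gIn_deadEnd (l : Fin (k - 1)) (q : Fin (2 ^ (l.val + 1))) (p : Fin (2 ^ l.val)) (j : Fin 4)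
      (hp : p ≠ s l) (h : q.val = 2 * p.val + j.val / 2) :
      ConcealerEdge s (.gIn l q) (.innerB l p j)
  | innerB_innerC (l : Fin (k - 1)) (p : Fin (2 ^ l.val)) (j j' : Fin 4)
      (h : (j, j') ∈ cfiEdges) : ConcealerEdge s (.innerB l p j) (.innerC l p j')
  | innerC_uOut (l : Fin (k - 1)) (p : Fin (2 ^ l.val)) (j : Fin 4) (j' : Fin 2)
      (h : j.val / 2 = j'.val) : ConcealerEdge s (.innerC l p j) (.uOut l p j')
  | uOut_gOut (l : Fin (k - 1)) (p : Fin (2 ^ l.val)) (j : Fin 2) :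
      ConcealerEdge s (.uOut l p j) (.gOut l j)
  /-- the out-vertices number `0` and `1` of the gadget of level `l + 1` are joined to all blocks
  of level `l + 2` of `X` with even and odd number, respectively -/
  | gOut_x (l : Fin (k - 1)) (j : Fin 2) (i : Fin (2 ^ k))
      (h : i.val / 2 ^ (k - (l.val + 2)) % 2 = j.val) : ConcealerEdge s (.gOut l j) (.x i)

/-- The concealer graph with parameter `k` and correct pairs `s`; the class `𝒢_k` consists of
these graphs for all choices of `s`. -/
def concealerGraph {k : ℕ} (s : CorrectPairs k) : SimpleGraph (ConcealerVertex k) :=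
  SimpleGraph.fromRel (ConcealerEdge s)

end

/-!
Lower bound for an arbitrary strategy. Suppose that a strategy has split `X` into the binary blocks
of level `m + 1` and knows the correct pairs of the levels up to `m`. To pass the gadget of level
`m + 1` it has to tell apart the two blocks of the correct pair within `Y`, but it does not know
which one of the `2 ^ m` pairs is correct. The partition `key m D s` describes what it can know at
most, if `D` is the set of the pairs that it has touched, that is, has propagated towards `Y`. As
long as the correct pair is not in `D`, this partition neither depends on the position of the
correct pair (`key_congr`) nor fails to be equitable anywhere except between the two inner layers,
which consist of the vertices `xx i j` and `yy i j` (`degIn_eq_of_key`); here the point is that a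
unidirectional gadget and a dead end look the same unless their in-vertices are distinguished.
Hence the partial quotient graphs are the same for all remaining positions, and a coloring coarser
than `key m D s` remains so after a refinement step, with the newly touched pairs added to `D`.
Touching a pair costs `k * k * 2 ^ (k - (m + 1))` (`touched_le_edgesBetween`). An adversary makes
one of the pairs that are touched last the correct one (`Confined.step`), so that each of the
`k - 1` levels costs `k * k * 2 ^ (k - 1)`; together this is `exists_le_cost`. Since the first
level has a single pair, its cost has to be paid on every concealer graph (`le_cost_of_terminates`),
which gives the lower bound for `opt`.

Upper bound for the optimum. A strategy that is made for a given graph has to propagate only one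
block of the correct pair at every level, which costs `O (k * k * 2 ^ (k - m))` plus a constant
number of edges per vertex (`exists_level_step`). The first terms form a geometric series, and the
second ones contribute `k` times the number `O (k * 2 ^ k)` of the vertices. Together with a
constant number of full rounds of color refinement, at the beginning for distinguishing the types
of the vertices and at the end for distinguishing the remaining vertices, this yields a coloring at
least as fine as the equitable partition `key (k - 1) (Finset.range (2 ^ (k - 1))) s`
(`exists_reach_stable`); all colorings that can be reached are coarser than that partition, so that
the coloring is equitable (`equitable_of_finer`). The total cost is `O (k * k * 2 ^ k)`, which is
also the order of the size of the graph, and `k` is of the order of the logarithm of this number.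
-/

noncomputable section

/-! ### Saturated sets and refinement steps -/

/-- A set of vertices is saturated for a labelling `ρ` if it is a union of classes of `ρ`. -/
def Saturated {V α : Type} (ρ : V → α) (A : Set V) : Prop :=
  ∀ v w, ρ v = ρ w → v ∈ A → w ∈ A

namespace Saturated

variable {V α β : Type} {ρ : V → α} {A B : Set V}

lemma mem_iff (h : Saturated ρ A) {v w : V} (hvw : ρ v = ρ w) : v ∈ A ↔ w ∈ A :=
  ⟨h v w hvw, h w v hvw.symm⟩

lemma preimage (ρ : V → α) (C : Set α) : Saturated ρ (ρ ⁻¹' C) := fun v w h hv => by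
  simpa [Set.mem_preimage, ← h] using hv

lemma exists_preimage (h : Saturated ρ A) : ∃ C : Set α, ρ ⁻¹' C = A := by
  refine ⟨ρ '' A, Set.Subset.antisymm ?_ (Set.subset_preimage_image ρ A)⟩
  rintro v ⟨w, hw, hwv⟩
  exact h w v hwv hw

lemma mono {σ : V → β} (h : Saturated ρ A) (hσ : ρ.FactorsThrough σ) : Saturated σ A :=
  fun v w hvw => h v w (hσ hvw)

lemma univ : Saturated ρ Set.univ := fun _ _ _ _ => trivial

lemma inter (hA : Saturated ρ A) (hB : Saturated ρ B) : Saturated ρ (A ∩ B) :=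
  fun v w h hv => ⟨hA v w h hv.1, hB v w h hv.2⟩

lemma diff (hA : Saturated ρ A) (hB : Saturated ρ B) : Saturated ρ (A \ B) :=
  fun v w h hv => ⟨hA v w h hv.1, fun hw => hv.2 (hB w v h.symm hw)⟩

lemma iUnion {ι : Type} {A : ι → Set V} (hA : ∀ i, Saturated ρ (A i)) :
    Saturated ρ (⋃ i, A i) := by
  intro v w h hv
  obtain ⟨i, hi⟩ := Set.mem_iUnion.1 hv
  exact Set.mem_iUnion.2 ⟨i, hA i v w h hi⟩

end Saturated

section Generic

variable {V : Type}

lemma refine_eq_iff (G : SimpleGraph V) (π : Coloring V) (C X : Set Color) (v w : V) :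
    refine G π C X v = refine G π C X w ↔
      π v = π w ∧ (π v ∈ X → degIn G (π ⁻¹' C) v = degIn G (π ⁻¹' C) w) := by
  classical
  constructor
  · intro h
    obtain ⟨h1, h2⟩ := List.append_inj' h rfl
    refine ⟨h1, fun hv => ?_⟩
    have hw : π w ∈ X := h1 ▸ hv
    simpa [hv, hw] using h2
  · rintro ⟨h1, h2⟩
    by_cases hv : π v ∈ X
    · have hw : π w ∈ X := h1 ▸ hv
      simp [refine, hw, h1, h2 hv]
    · have hw : π w ∉ X := h1 ▸ hv
      simp [refine, hw, h1]

lemma factorsThrough_refine (G : SimpleGraph V) (π : Coloring V) (C X : Set Color) :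
    π.FactorsThrough (refine G π C X) :=
  fun v w h => ((refine_eq_iff G π C X v w).1 h).1

/-- The number of edges between `A` and `B`. -/
def edgesBetween (G : SimpleGraph V) (A B : Set V) : ℕ :=
  {e | e ∈ G.edgeSet ∧ ∃ u v, u ∈ A ∧ v ∈ B ∧ e = s(u, v)}.ncard

lemma refineCost_eq (G : SimpleGraph V) (π : Coloring V) (C X : Set Color) :
    refineCost G π C X = edgesBetween G (π ⁻¹' X) (π ⁻¹' C) := rfl

/-- The ordered pairs of adjacent vertices in `A × B`. -/
def dartsBetween (G : SimpleGraph V) (A B : Set V) : Set (V × V) :=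
  {e | e.1 ∈ A ∧ e.2 ∈ B ∧ G.Adj e.1 e.2}

lemma edgesBetween_le_darts [Finite V] (G : SimpleGraph V) (A B : Set V) :
    edgesBetween G A B ≤ (dartsBetween G A B).ncard := by
  refine le_trans (Set.ncard_le_ncard (t := (fun e : V × V => s(e.1, e.2)) '' dartsBetween G A B)
    ?_ (Set.toFinite _)) (Set.ncard_image_le (Set.toFinite _))
  rintro e ⟨he, u, v, hu, hv, rfl⟩
  exact ⟨(u, v), ⟨hu, hv, he⟩, rfl⟩

lemma edgesBetween_le_mul [Finite V] (G : SimpleGraph V) (A B : Set V) :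
    edgesBetween G A B ≤ A.ncard * B.ncard := by
  refine (edgesBetween_le_darts G A B).trans ?_
  rw [← Set.ncard_prod]
  exact Set.ncard_le_ncard (fun e he => ⟨he.1, he.2.1⟩) (Set.toFinite _)

/-! ### Colorings that can be reached at a given cost -/

/-- `Reach G c π`: some sequence of refinement steps of total cost at most `c` leads from the
monochromatic coloring to `π`. -/
inductive Reach (G : SimpleGraph V) : ℕ → Coloring V → Prop
  | init : Reach G 0 (monochromatic V)
  | step {c : ℕ} {π : Coloring V} (C X : Set Color) (c' : ℕ) (h : Reach G c π)
      (hc : c + refineCost G π C X ≤ c') : Reach G c' (refine G π C X)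

lemma Reach.mono {G : SimpleGraph V} {c c' : ℕ} {π : Coloring V} (h : Reach G c π)
    (hc : c ≤ c') : ∃ π', Reach G c' π' ∧ π.FactorsThrough π' := by
  refine ⟨_, Reach.step ∅ ∅ c' h ?_, factorsThrough_refine _ _ _ _⟩
  simpa [refineCost] using hc

/-- Refining `A` with respect to `B` makes the sets of the vertices of `A` with a given number of
neighbors in `B` saturated. -/
lemma Reach.split {G : SimpleGraph V} {c : ℕ} {π : Coloring V} (h : Reach G c π) {A B : Set V}
    (hA : Saturated π A) (hB : Saturated π B) {c' : ℕ} (hc : c + edgesBetween G A B ≤ c') :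
    ∃ π', Reach G c' π' ∧ π.FactorsThrough π' ∧
      ∀ v w, π' v = π' w → v ∈ A → degIn G B v = degIn G B w := by
  obtain ⟨X, rfl⟩ := hA.exists_preimage
  obtain ⟨C, rfl⟩ := hB.exists_preimage
  exact ⟨_, Reach.step C X _ h hc, factorsThrough_refine _ _ _ _,
    fun v w hvw hv => ((refine_eq_iff G π C X v w).1 hvw).2 hv⟩

/-- An equitable coloring is finer than every coloring that can be reached. -/
lemma Reach.factorsThrough {α : Type} {G : SimpleGraph V} {c : ℕ} {π : Coloring V}
    (h : Reach G c π) {ρ : V → α}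
    (hρ : ∀ v w, ρ v = ρ w → ∀ A, Saturated ρ A → degIn G A v = degIn G A w) :
    π.FactorsThrough ρ := by
  induction h with
  | init => intro v w _; rfl
  | step C X c' h hc ih =>
    intro v w hvw
    rw [refine_eq_iff]
    exact ⟨ih hvw, fun _ => hρ v w hvw _ ((Saturated.preimage _ C).mono ih)⟩

lemma degIn_eq_card [Fintype V] (G : SimpleGraph V) (A : Set V) (v : V)
    [DecidablePred fun u => u ∈ A ∧ G.Adj v u] :
    degIn G A v = (Finset.univ.filter fun u => u ∈ A ∧ G.Adj v u).card := by
  rw [degIn, Set.ncard_eq_toFinset_card']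
  congr 1
  ext u
  simp

open Classical in
/-- The number of neighbors in a saturated set is determined by the numbers of neighbors in the
classes. -/
lemma degIn_eq_of_classes [Finite V] {α : Type} (G : SimpleGraph V) (ρ : V → α) {v w : V}
    (h : ∀ a, degIn G (ρ ⁻¹' {a}) v = degIn G (ρ ⁻¹' {a}) w) {A : Set V} (hA : Saturated ρ A) :
    degIn G A v = degIn G A w := by
  have := Fintype.ofFinite V
  have key : ∀ v, degIn G A v =
      ∑ a ∈ (Finset.univ.filter (· ∈ A)).image ρ, degIn G (ρ ⁻¹' {a}) v := by
    intro v
    rw [degIn_eq_card, Finset.card_eq_sum_card_fiberwise (f := ρ)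
      (t := (Finset.univ.filter (· ∈ A)).image ρ)]
    · refine Finset.sum_congr rfl fun a ha => ?_
      rw [degIn_eq_card]
      congr 1
      ext u
      simp only [Finset.mem_image, Finset.mem_filter, Finset.mem_univ, true_and] at ha
      obtain ⟨u', hu', rfl⟩ := ha
      simp only [Finset.mem_filter, Finset.mem_univ, true_and, Set.mem_preimage,
        Set.mem_singleton_iff]
      constructor
      · rintro ⟨⟨_, h1⟩, h2⟩; exact ⟨h2, h1⟩
      · rintro ⟨h2, h1⟩; exact ⟨⟨hA u' u h2.symm hu', h1⟩, h2⟩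
    · intro u hu
      simp only [Finset.coe_filter, Finset.mem_univ, true_and, Set.mem_ofPred_eq] at hu
      simp only [Finset.coe_image, Finset.coe_filter, Finset.mem_univ, true_and]
      exact ⟨u, hu.1, rfl⟩
  rw [key, key]
  exact Finset.sum_congr rfl fun a _ => h a

lemma Equitable.degIn_eq [Finite V] {G : SimpleGraph V} {π : Coloring V} (h : Equitable G π)
    {v w : V} (hvw : π v = π w) {A : Set V} (hA : Saturated π A) :
    degIn G A v = degIn G A w :=
  degIn_eq_of_classes G π (h v w hvw) hA

open Classical in
/-- A full round of color refinement, in which all vertices are refined with respect to every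
color class, costs at most twice the number of edges. -/
lemma Reach.round [Finite V] {G : SimpleGraph V} {c : ℕ} {π : Coloring V} (h : Reach G c π)
    {c' : ℕ} (hc : c + (dartsBetween G Set.univ Set.univ).ncard ≤ c') :
    ∃ π', Reach G c' π' ∧ π.FactorsThrough π' ∧
      ∀ v w, π' v = π' w → ∀ A, Saturated π A → degIn G A v = degIn G A w := by
  have := Fintype.ofFinite V
  have key : ∀ F : Finset Color, ∃ π',
      Reach G (c + ∑ a ∈ F, (dartsBetween G Set.univ (π ⁻¹' {a})).ncard) π' ∧
      π.FactorsThrough π' ∧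
      ∀ v w, π' v = π' w → ∀ a ∈ F, degIn G (π ⁻¹' {a}) v = degIn G (π ⁻¹' {a}) w := by
    intro F
    induction F using Finset.induction_on with
    | empty => exact ⟨π, by simpa using h, fun _ _ h => h, by simp⟩
    | insert a F ha ih =>
      obtain ⟨π₁, h1, h2, h3⟩ := ih
      obtain ⟨π₂, h4, h5, h6⟩ := h1.split Saturated.univ
        ((Saturated.preimage π {a}).mono h2) (Nat.add_le_add_left (edgesBetween_le_darts _ _ _) _)
      refine ⟨π₂, ?_, fun v w hvw => h2 (h5 hvw), ?_⟩
      · rwa [Finset.sum_insert ha, add_comm (Set.ncard _), ← add_assoc]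
      · intro v w hvw b hb
        rcases Finset.mem_insert.1 hb with rfl | hb
        · exact h6 v w hvw trivial
        · exact h3 v w (h5 hvw) b hb
  obtain ⟨π', h1, h2, h3⟩ := key (Finset.univ.image π)
  have hsum : ∑ a ∈ Finset.univ.image π, (dartsBetween G Set.univ (π ⁻¹' {a})).ncard =
      (dartsBetween G Set.univ Set.univ).ncard := by
    rw [Set.ncard_eq_toFinset_card', Finset.card_eq_sum_card_fiberwise (f := fun e => π e.2)
      (t := Finset.univ.image π)]
    · refine Finset.sum_congr rfl fun a _ => ?_
      rw [Set.ncard_eq_toFinset_card']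
      congr 1
      ext e
      rw [Set.mem_toFinset, Finset.mem_filter, Set.mem_toFinset]
      simp [dartsBetween, and_comm]
    · intro e _
      simp
  rw [hsum] at h1
  obtain ⟨π'', h4, h5⟩ := h1.mono hc
  refine ⟨π'', h4, fun v w hvw => h2 (h5 hvw), fun v w hvw A hA => ?_⟩
  refine degIn_eq_of_classes G π (fun a => ?_) hA
  by_cases ha : a ∈ Finset.univ.image π
  · exact h3 v w (h5 hvw) a ha
  · have : π ⁻¹' {a} = ∅ := by
      ext u
      simp only [Finset.mem_image, Finset.mem_univ, true_and, not_exists] at ha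
      simpa using ha u
    simp [this, degIn]

/-! ### Executions of strategies -/

namespace Strategy

lemma length_run (W : Strategy) (G : SimpleGraph V) (n : ℕ) : (W.run G n).1.length = n + 1 := by
  induction n with
  | zero => rfl
  | succ n ih => simp [run, ih]

lemma getLast?_run (W : Strategy) (G : SimpleGraph V) (n : ℕ) :
    (W.run G n).1.getLast? = some (partialQuotient G (W.run G n).2) := by
  cases n with
  | zero => rfl
  | succ n => simp [run]

lemma cost_le (W : Strategy) (G : SimpleGraph V) {n : ℕ} (h : Equitable G (W.run G n).2) :
    W.cost G ≤ (∑ t ∈ Finset.range n, W.stepCost G t : ℕ) := by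
  classical
  have ht : W.Terminates G := ⟨n, h⟩
  rw [cost, dif_pos ht]
  refine Nat.cast_le.2 (Finset.sum_le_sum_of_subset ?_)
  exact Finset.range_mono (Nat.find_min' ht h)

lemma le_cost (W : Strategy) (G : SimpleGraph V) {n : ℕ}
    (h : ∀ t < n, ¬ Equitable G (W.run G t).2) :
    (∑ t ∈ Finset.range n, W.stepCost G t : ℕ) ≤ W.cost G := by
  classical
  rw [cost]
  split_ifs with ht
  · refine Nat.cast_le.2 (Finset.sum_le_sum_of_subset ?_)
    exact Finset.range_mono ((Nat.le_find_iff ht n).2 h)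
  · exact le_top

open Classical in
/-- The strategy that starts with the refinement steps in the list `L`. After these it refines a
color class with respect to another one that splits it, if there is such a pair. -/
def ofList (L : List (Set Color × Set Color)) : Strategy := fun S =>
  if h : S.length - 1 < L.length then L[S.length - 1] else
    if h : ∃ (P : Set Color × Set Color) (Q : QuotientGraph), S.getLast? = some Q ∧
      ∃ a b : Color, P = ({b}, {a}) ∧ {a} ∈ Q.verts ∧ {b} ∈ Q.verts ∧ ¬ Q.Adj {a} {b}
    then h.choose
    else (∅, ∅)

lemma ofList_valid (L : List (Set Color × Set Color)) : (ofList L).Valid := by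
  intro V _ G
  by_contra hT
  have hne : ∀ n, ¬ Equitable G ((ofList L).run G n).2 := fun n hn => hT ⟨n, hn⟩
  have grow : ∀ n, L.length ≤ n → (Set.range ((ofList L).run G n).2).ncard <
      (Set.range ((ofList L).run G (n + 1)).2).ncard := by
    intro n hn
    set π := ((ofList L).run G n).2 with hπ
    set S := ((ofList L).run G n).1
    have hlast : S.getLast? = some (partialQuotient G π) := getLast?_run _ _ _
    have hlen : S.length = n + 1 := length_run _ _ _
    have hex : ∃ (P : Set Color × Set Color) (Q : QuotientGraph), S.getLast? = some Q ∧
        ∃ a b : Color, P = ({b}, {a}) ∧ {a} ∈ Q.verts ∧ {b} ∈ Q.verts ∧ ¬ Q.Adj {a} {b} := by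
      have := hne n
      simp only [Equitable, not_forall] at this
      obtain ⟨v, w, hvw, c, hc⟩ := this
      have hcr : c ∈ Set.range π := by
        by_contra hcr
        have : π ⁻¹' {c} = ∅ := by
          ext u
          simp only [Set.mem_preimage, Set.mem_singleton_iff, Set.mem_empty_iff_false, iff_false]
          exact fun h => hcr ⟨u, h⟩
        exact hc (by simp [← hπ, this, degIn])
      refine ⟨_, _, hlast, π v, c, rfl, by simp [partialQuotient],
        by simpa [partialQuotient] using hcr, ?_⟩
      intro hadj
      exact hc (hadj.2.2 v rfl w hvw.symm)
    obtain ⟨C, X, a, b, hW, rfl, rfl, ha, hb, hab⟩ : ∃ C X a b, ofList L S = (C, X) ∧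
        C = {b} ∧ X = {a} ∧ a ∈ Set.range π ∧ b ∈ Set.range π ∧ ¬ quotientAdj G π {a} {b} := by
      obtain ⟨Q, hQ, a, b, hP, ha, hb, hab⟩ := hex.choose_spec
      obtain rfl : Q = partialQuotient G π := Option.some_injective _ (hQ.symm.trans hlast)
      refine ⟨_, _, a, b, ?_, rfl, rfl, by simpa [partialQuotient] using ha,
        by simpa [partialQuotient] using hb, hab⟩
      rw [ofList, dif_neg (by omega), dif_pos hex, hP]
    have hrun : ((ofList L).run G (n + 1)).2 = refine G π {b} {a} := by
      change refine G π (ofList L S).1 (ofList L S).2 = _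
      rw [hW]
    rw [hrun]
    have hfac := factorsThrough_refine G π {b} {a}
    -- the old color is a function of the new one, and this function is not injective
    have hmap : ∃ f : Color → Color, ∀ v, f (refine G π {b} {a} v) = π v :=
      ⟨fun c => c.dropLast, fun v => by simp [refine]⟩
    obtain ⟨f, hf⟩ := hmap
    have himg : f '' Set.range (refine G π {b} {a}) = Set.range π := by
      rw [← Set.range_comp]
      exact congrArg Set.range (funext hf)
    refine lt_of_le_of_ne (himg ▸ Set.ncard_image_le (Set.toFinite _)) fun heq => hab ?_
    refine ⟨by simpa using ha, by simpa using hb, fun v hv w hw => ?_⟩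
    have hinj := (Set.ncard_image_iff (Set.toFinite _)).1 (himg.symm ▸ heq)
    have := hinj ⟨v, rfl⟩ ⟨w, rfl⟩ (by rw [hf, hf]; exact hv.trans hw.symm)
    exact ((refine_eq_iff G π _ _ v w).1 this).2 hv
  have big : ∀ j, j ≤ (Set.range ((ofList L).run G (L.length + j)).2).ncard := by
    intro j
    induction j with
    | zero => exact Nat.zero_le _
    | succ j ih => exact lt_of_le_of_lt ih (grow (L.length + j) (Nat.le_add_right _ _))
  have h1 := big (Nat.card V + 1)
  have h2 : (Set.range ((ofList L).run G (L.length + (Nat.card V + 1))).2).ncard ≤ Nat.card V := by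
    rw [← Set.image_univ, ← Set.ncard_univ]
    exact Set.ncard_image_le (Set.toFinite _)
  omega

end Strategy

/-- A coloring that can be reached at cost `c` is reached by the strategy that executes the
corresponding sequence of refinement steps. -/
lemma Reach.exists_list {G : SimpleGraph V} {c : ℕ} {π : Coloring V} (h : Reach G c π) :
    ∃ L : List (Set Color × Set Color), ∀ W : Strategy,
      (∀ n (hn : n < L.length) (S : List QuotientGraph), S.length = n + 1 → W S = L[n]) →
      (W.run G L.length).2 = π ∧ ∑ t ∈ Finset.range L.length, W.stepCost G t ≤ c := by
  induction h with
  | init => exact ⟨[], fun W _ => ⟨rfl, by simp⟩⟩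
  | @step c π C X c' h hc ih =>
    obtain ⟨L, hL⟩ := ih
    refine ⟨L ++ [(C, X)], fun W hW => ?_⟩
    obtain ⟨h1, h2⟩ := hL W fun n hn S hS => by
      rw [hW n (by simp; omega) S hS, List.getElem_append_left hn]
    have h3 : W (W.run G L.length).1 = (C, X) := by
      rw [hW L.length (by simp) _ (W.length_run G _)]
      simp
    have h4 : (L ++ [(C, X)]).length = L.length + 1 := by simp
    rw [h4, Finset.sum_range_succ]
    constructor
    · change refine G (W.run G L.length).2 (W (W.run G L.length).1).1 (W (W.run G L.length).1).2 = _
      rw [h3, h1]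
    · rw [Strategy.stepCost, h3, h1]
      exact (Nat.add_le_add_right h2 _).trans hc

lemma exists_isOpt [Finite V] (G : SimpleGraph V) : ∃ n, IsOpt G n := by
  have hne : {m : ℕ∞ | ∃ W : Strategy, W.Valid ∧ m = W.cost G}.Nonempty :=
    ⟨_, _, Strategy.ofList_valid [], rfl⟩
  have hmem := csInf_mem hne
  obtain ⟨W, hW, hc⟩ := hmem
  obtain ⟨n, hn⟩ := hW V G
  have hlt : W.cost G ≠ ⊤ := ne_top_of_le_ne_top (ENat.natCast_ne_top _) (W.cost_le G hn)
  obtain ⟨N, hN⟩ := ENat.ne_top_iff_exists.1 hlt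
  exact ⟨N, ⟨W, hW, hN⟩, fun m hm => hN ▸ hc ▸ sInf_le hm⟩

lemma IsOpt.le_of_reach {G : SimpleGraph V} {n : ℕ} (h : IsOpt G n) {c : ℕ} {π : Coloring V}
    (hr : Reach G c π) (he : Equitable G π) : n ≤ c := by
  obtain ⟨L, hL⟩ := hr.exists_list
  obtain ⟨h1, h2⟩ := hL (Strategy.ofList L) fun n hn S hS => by
    have hn' : S.length - 1 < L.length := by omega
    rw [Strategy.ofList, dif_pos hn']
    simp [hS]
  have h3 := h.2 ⟨_, Strategy.ofList_valid L, rfl⟩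
  have h4 := (Strategy.ofList L).cost_le G (h1.symm ▸ he)
  exact Nat.cast_le.1 ((h3.trans h4).trans (Nat.cast_le.2 h2))

/-- The partial quotient graph depends on the graph only via the numbers of neighbors of the
vertices in the unions of color classes. -/
lemma partialQuotient_congr {G G' : SimpleGraph V} {π : Coloring V}
    (h : ∀ A, Saturated π A → ∀ v, degIn G A v = degIn G' A v) :
    partialQuotient G π = partialQuotient G' π := by
  have hd : ∀ c, degIn G (π ⁻¹' c) = degIn G' (π ⁻¹' c) :=
    fun c => funext (h _ (Saturated.preimage π c))
  have hadj : quotientAdj G π = quotientAdj G' π := by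
    funext c₁ c₂
    simp only [quotientAdj, hd]
  rw [partialQuotient, partialQuotient, QuotientGraph.mk.injEq]
  refine ⟨rfl, hadj, rfl, ?_⟩
  funext c₁ c₂
  by_cases h₁ : quotientAdj G π c₁ c₂ ∧ (π ⁻¹' c₁).Nonempty
  · have h₂ : quotientAdj G' π c₁ c₂ ∧ (π ⁻¹' c₁).Nonempty := hadj ▸ h₁
    rw [dif_pos h₁, dif_pos h₂, hd]
  · have h₂ : ¬ (quotientAdj G' π c₁ c₂ ∧ (π ⁻¹' c₁).Nonempty) := hadj ▸ h₁
    rw [dif_neg h₁, dif_neg h₂]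

lemma refine_congr {G G' : SimpleGraph V} {π : Coloring V}
    (h : ∀ A, Saturated π A → ∀ v, degIn G A v = degIn G' A v) (C X : Set Color) :
    refine G π C X = refine G' π C X := by
  funext v
  simp only [refine, h _ (Saturated.preimage π C)]

end Generic

/-! ### Neighborhoods in concealer graphs -/

section Neighborhoods

open ConcealerVertex

variable {k : ℕ} (s : CorrectPairs k)

lemma ConcealerEdge.ne {s : CorrectPairs k} {u v : ConcealerVertex k} (h : ConcealerEdge s u v) :
    u ≠ v := by
  cases h <;> simp

lemma concealer_adj_iff {u v : ConcealerVertex k} :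
    (concealerGraph s).Adj u v ↔ ConcealerEdge s u v ∨ ConcealerEdge s v u := by
  rw [concealerGraph, SimpleGraph.fromRel_adj, and_iff_right_iff_imp]
  rintro (h | h)
  · exact h.ne
  · exact h.ne.symm

/-- The number of the in-vertex that is adjacent to the inner vertex number `j` of the gadget
number `p`. -/
def inNumber (l : Fin (k - 1)) (p : Fin (2 ^ l.val)) (j : Fin 4) : ℕ :=
  2 * p.val + if p = s l then j.val % 2 else j.val / 2

lemma inNumber_div (l : Fin (k - 1)) (p : Fin (2 ^ l.val)) (j : Fin 4) :
    inNumber s l p j / 2 = p.val := by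
  have := j.isLt
  unfold inNumber
  split_ifs <;> omega

lemma inNumber_lt (l : Fin (k - 1)) (p : Fin (2 ^ l.val)) (j : Fin 4) :
    inNumber s l p j < 2 ^ (l.val + 1) := by
  have h1 := inNumber_div s l p j
  have h2 := p.isLt
  rw [pow_succ]
  omega

lemma edge_gIn_innerB {l l' : Fin (k - 1)} {q : Fin (2 ^ (l.val + 1))} {p : Fin (2 ^ l'.val)}
    {j : Fin 4} : ConcealerEdge s (gIn l q) (innerB l' p j) ↔
      l = l' ∧ q.val = inNumber s l' p j := by
  constructor
  · intro h
    cases h with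
    | gIn_correct _ _ _ _ hp h => exact ⟨rfl, by rw [inNumber, if_pos hp, h]⟩
    | gIn_deadEnd _ _ _ _ hp h => exact ⟨rfl, by rw [inNumber, if_neg hp, h]⟩
  · rintro ⟨rfl, h⟩
    by_cases hp : p = s l
    · exact .gIn_correct _ _ _ _ hp (by rw [h, inNumber, if_pos hp])
    · exact .gIn_deadEnd _ _ _ _ hp (by rw [h, inNumber, if_neg hp])

lemma adj_start {a : Fin 3} {u : ConcealerVertex k} :
    (concealerGraph s).Adj (start a) u ↔
      (a = 0 ∧ u = start 1) ∨ (a = 1 ∧ u = start 0) ∨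
      (a = 1 ∧ ∃ i : Fin (2 ^ k), u = x i ∧ i.val / 2 ^ (k - 1) = 0) ∨
      (a = 2 ∧ ∃ i : Fin (2 ^ k), u = x i ∧ i.val / 2 ^ (k - 1) = 1) := by
  rw [concealer_adj_iff]
  constructor
  · rintro (h | h)
    · cases h with
      | start => exact .inl ⟨rfl, rfl⟩
      | startLeft i h => exact .inr (.inr (.inl ⟨rfl, i, rfl, h⟩))
      | startRight i h => exact .inr (.inr (.inr ⟨rfl, i, rfl, h⟩))
    · cases h
      exact .inr (.inl ⟨rfl, rfl⟩)
  · rintro (⟨rfl, rfl⟩ | ⟨rfl, rfl⟩ | ⟨rfl, i, rfl, h⟩ | ⟨rfl, i, rfl, h⟩)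
    · exact .inl .start
    · exact .inr .start
    · exact .inl (.startLeft i h)
    · exact .inl (.startRight i h)

lemma adj_x {i : Fin (2 ^ k)} {u : ConcealerVertex k} :
    (concealerGraph s).Adj (x i) u ↔
      (u = start 1 ∧ i.val / 2 ^ (k - 1) = 0) ∨ (u = start 2 ∧ i.val / 2 ^ (k - 1) = 1) ∨
      (∃ j, u = xx i j) ∨
      (∃ l : Fin (k - 1), ∃ j : Fin 2,
        u = gOut l j ∧ i.val / 2 ^ (k - (l.val + 2)) % 2 = j.val) := by
  rw [concealer_adj_iff]
  constructor
  · rintro (h | h)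
    · cases h
      exact .inr (.inr (.inl ⟨_, rfl⟩))
    · cases h with
      | startLeft i h => exact .inl ⟨rfl, h⟩
      | startRight i h => exact .inr (.inl ⟨rfl, h⟩)
      | gOut_x l j i h => exact .inr (.inr (.inr ⟨l, j, rfl, h⟩))
  · rintro (⟨rfl, h⟩ | ⟨rfl, h⟩ | ⟨j, rfl⟩ | ⟨l, j, rfl, h⟩)
    · exact .inr (.startLeft i h)
    · exact .inr (.startRight i h)
    · exact .inl (.x_xx i j)
    · exact .inr (.gOut_x l j i h)

lemma adj_xx {i : Fin (2 ^ k)} {j : Fin k} {u : ConcealerVertex k} :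
    (concealerGraph s).Adj (xx i j) u ↔ u = x i ∨ ∃ j', u = yy i j' := by
  rw [concealer_adj_iff]
  constructor
  · rintro (h | h) <;> cases h <;> simp
  · rintro (rfl | ⟨j', rfl⟩)
    · exact .inr (.x_xx i j)
    · exact .inl (.xx_yy i j j')

lemma adj_yy {i : Fin (2 ^ k)} {j : Fin k} {u : ConcealerVertex k} :
    (concealerGraph s).Adj (yy i j) u ↔ u = y i ∨ ∃ j', u = xx i j' := by
  rw [concealer_adj_iff]
  constructor
  · rintro (h | h) <;> cases h <;> simp
  · rintro (rfl | ⟨j', rfl⟩)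
    · exact .inl (.yy_y i j)
    · exact .inr (.xx_yy i j' j)

lemma adj_y {i : Fin (2 ^ k)} {u : ConcealerVertex k} :
    (concealerGraph s).Adj (y i) u ↔ (∃ j, u = yy i j) ∨
      ∃ l : Fin (k - 1), ∃ q : Fin (2 ^ (l.val + 1)), u = gIn l q ∧
        i.val / 2 ^ (k - (l.val + 1)) = q.val := by
  rw [concealer_adj_iff]
  constructor
  · rintro (h | h)
    · cases h with
      | y_gIn i l q h => exact .inr ⟨l, q, rfl, h⟩
    · cases h
      exact .inl ⟨_, rfl⟩
  · rintro (⟨j, rfl⟩ | ⟨l, q, rfl, h⟩)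
    · exact .inr (.yy_y i j)
    · exact .inl (.y_gIn i l q h)

lemma adj_gIn {l : Fin (k - 1)} {q : Fin (2 ^ (l.val + 1))} {u : ConcealerVertex k} :
    (concealerGraph s).Adj (gIn l q) u ↔
      (∃ i : Fin (2 ^ k), u = y i ∧ i.val / 2 ^ (k - (l.val + 1)) = q.val) ∨
      ∃ p j, u = innerB l p j ∧ inNumber s l p j = q.val := by
  rw [concealer_adj_iff]
  constructor
  · rintro (h | h)
    · cases u with
      | innerB l' p j =>
        obtain ⟨rfl, h⟩ := (edge_gIn_innerB s).1 h
        exact .inr ⟨p, j, rfl, h.symm⟩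
      | _ => cases h
    · cases h
      exact .inl ⟨_, rfl, by assumption⟩
  · rintro (⟨i, rfl, h⟩ | ⟨p, j, rfl, h⟩)
    · exact .inr (.y_gIn i l q h)
    · exact .inl ((edge_gIn_innerB s).2 ⟨rfl, h.symm⟩)

lemma adj_innerB {l : Fin (k - 1)} {p : Fin (2 ^ l.val)} {j : Fin 4} {u : ConcealerVertex k} :
    (concealerGraph s).Adj (innerB l p j) u ↔
      u = gIn l ⟨inNumber s l p j, inNumber_lt s l p j⟩ ∨
      ∃ t, u = innerC l p t ∧ (j, t) ∈ cfiEdges := by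
  rw [concealer_adj_iff]
  constructor
  · rintro (h | h)
    · cases h
      exact .inr ⟨_, rfl, by assumption⟩
    · cases u with
      | gIn l' q =>
        obtain ⟨rfl, h⟩ := (edge_gIn_innerB s).1 h
        left
        congr
        exact Fin.ext h
      | _ => cases h
  · rintro (rfl | ⟨t, rfl, h⟩)
    · exact .inr ((edge_gIn_innerB s).2 ⟨rfl, rfl⟩)
    · exact .inl (.innerB_innerC l p j t h)

lemma adj_innerC {l : Fin (k - 1)} {p : Fin (2 ^ l.val)} {t : Fin 4} {u : ConcealerVertex k} :
    (concealerGraph s).Adj (innerC l p t) u ↔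
      (∃ j, u = innerB l p j ∧ (j, t) ∈ cfiEdges) ∨
      ∃ j : Fin 2, u = uOut l p j ∧ t.val / 2 = j.val := by
  rw [concealer_adj_iff]
  constructor
  · rintro (h | h) <;> cases h <;> simp [*]
  · rintro (⟨j, rfl, h⟩ | ⟨j, rfl, h⟩)
    · exact .inr (.innerB_innerC l p j t h)
    · exact .inl (.innerC_uOut l p t j h)

lemma adj_uOut {l : Fin (k - 1)} {p : Fin (2 ^ l.val)} {j : Fin 2} {u : ConcealerVertex k} :
    (concealerGraph s).Adj (uOut l p j) u ↔
      (∃ t : Fin 4, u = innerC l p t ∧ t.val / 2 = j.val) ∨ u = gOut l j := by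
  rw [concealer_adj_iff]
  constructor
  · rintro (h | h) <;> cases h <;> simp [*]
  · rintro (⟨t, rfl, h⟩ | rfl)
    · exact .inr (.innerC_uOut l p t j h)
    · exact .inl (.uOut_gOut l p j)

lemma adj_gOut {l : Fin (k - 1)} {j : Fin 2} {u : ConcealerVertex k} :
    (concealerGraph s).Adj (gOut l j) u ↔
      (∃ p, u = uOut l p j) ∨
      ∃ i : Fin (2 ^ k), u = x i ∧ i.val / 2 ^ (k - (l.val + 2)) % 2 = j.val := by
  rw [concealer_adj_iff]
  constructor
  · rintro (h | h) <;> cases h <;> simp [*]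
  · rintro (⟨p, rfl⟩ | ⟨i, rfl, h⟩)
    · exact .inr (.uOut_gOut l p j)
    · exact .inl (.gOut_x l j i h)

end Neighborhoods

/-! ### The knowledge partitions -/

section Keys

open ConcealerVertex

variable {k : ℕ}

/-- The class of the block number `b`, if the two blocks of a pair are distinguished exactly for
the pairs in `D`. -/
def blockKey (D : Finset ℕ) (b : ℕ) : ℕ := 2 * (b / 2) + if b / 2 ∈ D then b % 2 else 0

/-- The class of the index `i` in the layer `Y`. -/
def yKey (k m : ℕ) (D : Finset ℕ) (i : ℕ) : ℕ := blockKey D (i / 2 ^ (k - (m + 1)))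

/-- The class of the in-vertex number `q` of the gadget with index `l`. -/
def gInKey (m : ℕ) (D : Finset ℕ) (l q : ℕ) : ℕ :=
  if l < m then q else blockKey D (q / 2 ^ (l - m))

/-- The partition of the vertices that describes the knowledge of a strategy when `X` is split into
the blocks of level `m + 1` and `Y` is split into the blocks of level `m`, and further into those
of level `m + 1` exactly within the pairs in `D`. The gadgets with index below `m` (that is, of
level at most `m`) have been passed, and within the others nothing has been split that is not
split by the partition of `Y`. The first component of a label is the type of the vertex. -/
def key (m : ℕ) (D : Finset ℕ) (s : CorrectPairs k) : ConcealerVertex k → ℕ × ℕ × ℕ × ℕ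
  | start a => (0, a, 0, 0)
  | x i => (1, i / 2 ^ (k - (m + 1)), 0, 0)
  | xx i _ => (2, i / 2 ^ (k - (m + 1)), 0, 0)
  | yy i _ => (3, yKey k m D i, 0, 0)
  | y i => (4, yKey k m D i, 0, 0)
  | gIn l q => (5, l, gInKey m D l q, 0)
  | innerB l p j => (6, l, gInKey m D l (inNumber s l p j), 0)
  | innerC l p t => (7, l, gInKey m D l (2 * p),
      if l < m then if t.val < 2 then 0 else if p = s l then t.val else 2 else 0)
  | uOut l p j => (8, l, gInKey m D l (2 * p), if l < m then j else 0)
  | gOut l j => (9, l, if l < m then j else 0, 0)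

/-- Two choices of correct pairs that cannot be told apart with the knowledge described by
`key m D`. -/
def Indistinct (m : ℕ) (D : Finset ℕ) (s s' : CorrectPairs k) : Prop :=
  (∀ l : Fin (k - 1), l.val < m → s l = s' l) ∧
    ∀ l : Fin (k - 1), l.val = m → (s l).val ∉ D ∧ (s' l).val ∉ D

lemma Indistinct.symm {m : ℕ} {D : Finset ℕ} {s s' : CorrectPairs k} (h : Indistinct m D s s') :
    Indistinct m D s' s :=
  ⟨fun l hl => (h.1 l hl).symm, fun l hl => (h.2 l hl).symm⟩

lemma Nat.div_two_pow_of_le {i a b : ℕ} (h : a ≤ b) : i / 2 ^ b = i / 2 ^ a / 2 ^ (b - a) := by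
  rw [Nat.div_div_eq_div_mul, ← pow_add, Nat.add_sub_cancel' h]

lemma blockKey_div_two {D : Finset ℕ} {b b' : ℕ} (h : blockKey D b = blockKey D b') :
    b / 2 = b' / 2 := by
  unfold blockKey at h
  split_ifs at h <;> omega

lemma blockKey_eq {D : Finset ℕ} {b b' : ℕ} (h : b / 2 = b' / 2) (hD : b / 2 ∉ D) :
    blockKey D b = blockKey D b' := by
  rw [blockKey, blockKey, if_neg hD, if_neg (h ▸ hD), h]

/-- Beyond the current gadget the class of an in-vertex is determined by its pair. -/
lemma gInKey_eq_of_lt {m : ℕ} {D : Finset ℕ} {l q q' : ℕ} (hl : m < l) (h : q / 2 = q' / 2) :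
    gInKey m D l q = gInKey m D l q' := by
  rw [gInKey, gInKey, if_neg (by omega), if_neg (by omega)]
  have h1 : 1 ≤ l - m := by omega
  have h2 := Nat.div_two_pow_of_le (i := q) h1
  have h3 := Nat.div_two_pow_of_le (i := q') h1
  rw [pow_one] at h2 h3
  rw [h2, h3, h]

lemma gInKey_self {m : ℕ} {D : Finset ℕ} {q : ℕ} : gInKey m D m q = blockKey D q := by
  simp [gInKey]

lemma gInKey_even {m : ℕ} {D : Finset ℕ} {l q q' : ℕ} (h : gInKey m D l q = gInKey m D l q') :
    gInKey m D l (2 * (q / 2)) = gInKey m D l (2 * (q' / 2)) := by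
  rcases lt_trichotomy l m with hl | rfl | hl
  · rw [gInKey, gInKey, if_pos hl, if_pos hl] at h
    rw [h]
  · rw [gInKey_self, gInKey_self] at h
    rw [blockKey_div_two h]
  · rw [gInKey_eq_of_lt hl (q := 2 * (q / 2)) (q' := q) (by omega), h,
      gInKey_eq_of_lt hl (q := 2 * (q' / 2)) (q' := q') (by omega)]

lemma gInKey_eq_yKey {m : ℕ} {D : Finset ℕ} {l i : ℕ} (hlk : l + 1 ≤ k) (hl : m ≤ l) :
    gInKey m D l (i / 2 ^ (k - (l + 1))) = yKey k m D i := by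
  rw [gInKey, if_neg (by omega), yKey,
    Nat.div_two_pow_of_le (a := k - (l + 1)) (b := k - (m + 1)) (by omega)]
  congr 3
  omega

lemma gInKey_congr_yKey {m : ℕ} {D : Finset ℕ} {l i i' : ℕ} (hlk : l + 1 ≤ k)
    (hm : m + 1 ≤ k) (h : yKey k m D i = yKey k m D i') :
    gInKey m D l (i / 2 ^ (k - (l + 1))) = gInKey m D l (i' / 2 ^ (k - (l + 1))) := by
  by_cases hl : l < m
  · rw [gInKey, gInKey, if_pos hl, if_pos hl,
      Nat.div_two_pow_of_le (a := k - (m + 1) + 1) (b := k - (l + 1)) (by omega),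
      Nat.div_two_pow_of_le (i := i') (a := k - (m + 1) + 1) (b := k - (l + 1)) (by omega)]
    have := blockKey_div_two h
    rw [Nat.div_div_eq_div_mul, Nat.div_div_eq_div_mul, ← pow_succ] at this
    rw [this]
  · rw [gInKey_eq_yKey hlk (by omega), gInKey_eq_yKey hlk (by omega), h]

/-- The class of an inner vertex does not reveal the position of an unknown correct pair: in an
untouched pair both in-vertices belong to one class, and a touched pair is a dead end. -/
lemma gInKey_inNumber_congr {m : ℕ} {D : Finset ℕ} {s s' : CorrectPairs k}
    (h : Indistinct m D s s') (l : Fin (k - 1)) (p : Fin (2 ^ l.val)) (j : Fin 4) :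
    gInKey m D l (inNumber s l p j) = gInKey m D l (inNumber s' l p j) := by
  rcases lt_trichotomy l.val m with hl | hl | hl
  · rw [inNumber, inNumber, h.1 l hl]
  · obtain ⟨h1, h2⟩ := h.2 l hl
    by_cases hp : p.val ∈ D
    · have h3 : p ≠ s l := fun e => h1 (e ▸ hp)
      have h4 : p ≠ s' l := fun e => h2 (e ▸ hp)
      rw [inNumber, inNumber, if_neg h3, if_neg h4]
    · rw [← hl, gInKey_self, gInKey_self]
      refine blockKey_eq (by rw [inNumber_div, inNumber_div]) ?_
      rwa [inNumber_div]
  · exact gInKey_eq_of_lt hl (by rw [inNumber_div, inNumber_div])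

lemma key_congr {m : ℕ} {D : Finset ℕ} {s s' : CorrectPairs k} (h : Indistinct m D s s') :
    key m D s = key m D s' := by
  funext v
  cases v with
  | innerB l p j => simp only [key, gInKey_inNumber_congr h]
  | innerC l p t =>
    by_cases hl : l.val < m
    · simp only [key, h.1 l hl]
    · simp only [key, if_neg hl]
  | _ => rfl

end Keys

/-! ### The knowledge partitions are equitable up to the untouched pairs -/

section Compatible

open ConcealerVertex

variable {k : ℕ}

/-- Numbers of neighbors in classes are compared by injections that keep the labels. By symmetry
this yields equalities. -/
lemma degIn_le_of_map {V : Type} [Finite V] {G G' : SimpleGraph V} {C : Set V} {v w : V}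
    (f : V → V) (hf : ∀ u, G.Adj v u → G'.Adj w (f u) ∧ (u ∈ C → f u ∈ C))
    (hinj : ∀ u u', G.Adj v u → G.Adj v u' → f u = f u' → u = u') :
    degIn G C v ≤ degIn G' C w := by
  refine Set.ncard_le_ncard_of_injOn f ?_ ?_ (Set.toFinite _)
  · rintro u ⟨hu, hvu⟩
    exact ⟨(hf u hvu).2 hu, (hf u hvu).1⟩
  · rintro u ⟨_, hu⟩ u' ⟨_, hu'⟩ h
    exact hinj u u' hu hu' h

variable {m : ℕ} {D : Finset ℕ} {s s' : CorrectPairs k} {C : Set (ConcealerVertex k)}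

lemma degIn_le_of_key_map (hI : Indistinct m D s s') (hC : Saturated (key m D s) C)
    {v w : ConcealerVertex k} (f : ConcealerVertex k → ConcealerVertex k)
    (hf : ∀ u, (concealerGraph s).Adj v u →
      (concealerGraph s').Adj w (f u) ∧ key m D s u = key m D s' (f u))
    (hinj : ∀ u u', (concealerGraph s).Adj v u → (concealerGraph s).Adj v u' → f u = f u' →
      u = u') :
    degIn (concealerGraph s) C v ≤ degIn (concealerGraph s') C w := by
  refine degIn_le_of_map f (fun u hu => ⟨(hf u hu).1, hC _ _ ?_⟩) hinj
  rw [(hf u hu).2, key_congr hI]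

lemma degIn_le_start (hI : Indistinct m D s s') (hC : Saturated (key m D s) C) (a : Fin 3) :
    degIn (concealerGraph s) C (start a) ≤ degIn (concealerGraph s') C (start a) := by
  refine degIn_le_of_key_map hI hC id (fun u hu => ⟨?_, ?_⟩) (fun _ _ _ _ h => h)
  · exact (adj_start s').2 ((adj_start s).1 hu)
  · rw [id, key_congr hI]

lemma degIn_le_x (hm : m + 1 ≤ k) (hI : Indistinct m D s s') (hC : Saturated (key m D s) C)
    {i i' : Fin (2 ^ k)} (h : i.val / 2 ^ (k - (m + 1)) = i'.val / 2 ^ (k - (m + 1))) :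
    degIn (concealerGraph s) C (x i) ≤ degIn (concealerGraph s') C (x i') := by
  have hhalf : i.val / 2 ^ (k - 1) = i'.val / 2 ^ (k - 1) := by
    rw [Nat.div_two_pow_of_le (a := k - (m + 1)) (b := k - 1) (by omega), h,
      ← Nat.div_two_pow_of_le (by omega)]
  refine degIn_le_of_key_map hI hC (fun u => match u with
    | xx _ j => xx i' j
    | gOut l _ => gOut l ⟨i'.val / 2 ^ (k - (l.val + 2)) % 2, Nat.mod_lt _ two_pos⟩
    | u => u) (fun u hu => ?_) (fun u u' hu hu' => ?_)
  · rw [adj_x] at hu ⊢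
    rcases hu with ⟨rfl, hu⟩ | ⟨rfl, hu⟩ | ⟨j, rfl⟩ | ⟨l, j, rfl, hj⟩
    · exact ⟨.inl ⟨rfl, hhalf ▸ hu⟩, rfl⟩
    · exact ⟨.inr (.inl ⟨rfl, hhalf ▸ hu⟩), rfl⟩
    · exact ⟨.inr (.inr (.inl ⟨j, rfl⟩)), by simp only [key, h]⟩
    · refine ⟨.inr (.inr (.inr ⟨l, _, rfl, rfl⟩)), ?_⟩
      simp only [key]
      split_ifs with hl
      · rw [← hj, Nat.div_two_pow_of_le (a := k - (m + 1)) (b := k - (l.val + 2)) (by omega), h,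
          ← Nat.div_two_pow_of_le (by omega)]
      · rfl
  · rw [adj_x] at hu hu'
    rcases hu with ⟨rfl, hu⟩ | ⟨rfl, hu⟩ | ⟨j, rfl⟩ | ⟨l, j, rfl, hj⟩ <;>
      rcases hu' with ⟨rfl, hu'⟩ | ⟨rfl, hu'⟩ | ⟨j', rfl⟩ | ⟨l', j', rfl, hj'⟩ <;> simp
    rintro rfl _
    exact ⟨rfl, Fin.ext (by omega)⟩

lemma yKey_congr {i i' : ℕ} (h : i / 2 ^ (k - (m + 1)) = i' / 2 ^ (k - (m + 1))) :
    yKey k m D i = yKey k m D i' := by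
  rw [yKey, h, yKey]

lemma degIn_le_xx (hI : Indistinct m D s s') (hC : Saturated (key m D s) C)
    {i i' : Fin (2 ^ k)} (h : i.val / 2 ^ (k - (m + 1)) = i'.val / 2 ^ (k - (m + 1)))
    (j j' : Fin k) :
    degIn (concealerGraph s) C (xx i j) ≤ degIn (concealerGraph s') C (xx i' j') := by
  refine degIn_le_of_key_map hI hC (fun u => match u with
    | x _ => x i'
    | yy _ t => yy i' t
    | u => u) (fun u hu => ?_) (fun u u' hu hu' => ?_)
  · rw [adj_xx] at hu ⊢
    rcases hu with rfl | ⟨t, rfl⟩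
    · exact ⟨.inl rfl, by simp only [key, h]⟩
    · exact ⟨.inr ⟨t, rfl⟩, by simp only [key, yKey_congr h]⟩
  · rw [adj_xx] at hu hu'
    rcases hu with rfl | ⟨t, rfl⟩ <;> rcases hu' with rfl | ⟨t', rfl⟩ <;> simp

lemma degIn_le_yy (hC : Saturated (key m D s) C)
    {i i' : Fin (2 ^ k)} (h : yKey k m D i = yKey k m D i') (j j' : Fin k)
    (hxx : ∀ t, xx i t ∈ C → xx i' t ∈ C) :
    degIn (concealerGraph s) C (yy i j) ≤ degIn (concealerGraph s') C (yy i' j') := by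
  refine degIn_le_of_map (fun u => match u with
    | y _ => y i'
    | xx _ t => xx i' t
    | u => u) (fun u hu => ?_) (fun u u' hu hu' => ?_)
  · rw [adj_yy] at hu ⊢
    rcases hu with rfl | ⟨t, rfl⟩
    · exact ⟨.inl rfl, hC _ _ (by simp only [key, h])⟩
    · exact ⟨.inr ⟨t, rfl⟩, hxx t⟩
  · rw [adj_yy] at hu hu'
    rcases hu with rfl | ⟨t, rfl⟩ <;> rcases hu' with rfl | ⟨t', rfl⟩ <;> simp

lemma Nat.div_two_pow_lt {i e k : ℕ} (hi : i < 2 ^ k) (he : e ≤ k) : i / 2 ^ (k - e) < 2 ^ e := by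
  rw [Nat.div_lt_iff_lt_mul (by positivity), ← pow_add]
  rwa [Nat.add_sub_cancel' he]

lemma degIn_le_y (hm : m + 1 ≤ k) (hI : Indistinct m D s s') (hC : Saturated (key m D s) C)
    {i i' : Fin (2 ^ k)} (h : yKey k m D i = yKey k m D i') :
    degIn (concealerGraph s) C (y i) ≤ degIn (concealerGraph s') C (y i') := by
  refine degIn_le_of_key_map hI hC (fun u => match u with
    | yy _ t => yy i' t
    | gIn l _ => gIn l ⟨i'.val / 2 ^ (k - (l.val + 1)), Nat.div_two_pow_lt i'.isLt (by omega)⟩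
    | u => u) (fun u hu => ?_) (fun u u' hu hu' => ?_)
  · rw [adj_y] at hu ⊢
    rcases hu with ⟨t, rfl⟩ | ⟨l, q, rfl, hq⟩
    · exact ⟨.inl ⟨t, rfl⟩, by simp only [key, h]⟩
    · refine ⟨.inr ⟨l, _, rfl, rfl⟩, ?_⟩
      simp only [key, ← hq, gInKey_congr_yKey (l := l.val) (by omega) hm h]
  · rw [adj_y] at hu hu'
    rcases hu with ⟨t, rfl⟩ | ⟨l, q, rfl, hq⟩ <;> rcases hu' with ⟨t', rfl⟩ | ⟨l', q', rfl, hq'⟩ <;>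
      simp
    rintro rfl _
    exact ⟨rfl, heq_of_eq (Fin.ext (hq.symm.trans hq'))⟩

lemma Nat.block_translate_div {i q b : ℕ} (hb : 0 < b) : (i % b + q * b) / b = q := by
  rw [Nat.add_mul_div_right _ _ hb, Nat.div_eq_of_lt (Nat.mod_lt _ hb), zero_add]

lemma Nat.block_translate_lt {i q b c : ℕ} (hb : 0 < b) (hq : q < c) : i % b + q * b < c * b := by
  have h1 := Nat.mod_lt i hb
  have h2 : (q + 1) * b ≤ c * b := Nat.mul_le_mul_right b hq
  linarith [h2, add_mul q 1 b]

/-- For each of the two neighbors among the inner vertices, `inPartner` is the number of this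
neighbor for the in-vertex with the parity `r`, in a correct pair or a dead end. -/
def inPartner (correct : Prop) [Decidable correct] (r : Fin 2) (c : Fin 2) : Fin 4 :=
  if correct then ⟨2 * c + r, by omega⟩ else ⟨2 * r + c, by omega⟩

lemma degIn_le_gIn (hI : Indistinct m D s s') (hC : Saturated (key m D s) C)
    {l : Fin (k - 1)} {q q' : Fin (2 ^ (l.val + 1))}
    (h : gInKey m D l q = gInKey m D l q') :
    degIn (concealerGraph s) C (gIn l q) ≤ degIn (concealerGraph s') C (gIn l q') := by
  have hpos : 0 < 2 ^ (k - (l.val + 1)) := by positivity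
  have hk : 2 ^ (l.val + 1) * 2 ^ (k - (l.val + 1)) = 2 ^ k := by
    rw [← pow_add, Nat.add_sub_cancel' (by omega)]
  have hq2 : q'.val / 2 < 2 ^ l.val := by
    have h1 := q'.isLt
    have h2 := pow_succ 2 l.val
    omega
  refine degIn_le_of_key_map hI hC (fun u => match u with
    | y i => y ⟨i.val % 2 ^ (k - (l.val + 1)) + q'.val * 2 ^ (k - (l.val + 1)),
        (Nat.block_translate_lt hpos q'.isLt).trans_eq hk⟩
    | innerB l₁ p j => innerB l ⟨q'.val / 2, hq2⟩
        (inPartner (⟨q'.val / 2, hq2⟩ = s' l) ⟨q'.val % 2, Nat.mod_lt _ two_pos⟩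
          (if p = s l₁ then ⟨j.val / 2, by omega⟩ else ⟨j.val % 2, by omega⟩))
    | u => u) (fun u hu => ?_) (fun u u' hu hu' => ?_)
  · rw [adj_gIn] at hu ⊢
    rcases hu with ⟨i, rfl, hi⟩ | ⟨p, j, rfl, hj⟩
    · refine ⟨.inl ⟨_, rfl, Nat.block_translate_div hpos⟩, ?_⟩
      simp only [key, Prod.mk.injEq, true_and, and_true]
      by_cases hl : l.val < m
      · rw [gInKey, gInKey, if_pos hl, if_pos hl] at h
        rw [← h, ← hi, Nat.mod_add_div']
      · rw [← gInKey_eq_yKey (l := l.val) (by omega) (by omega),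
          ← gInKey_eq_yKey (l := l.val) (by omega) (by omega), Nat.block_translate_div hpos, hi, h]
    · have hval : inNumber s' l ⟨q'.val / 2, hq2⟩
          (inPartner (⟨q'.val / 2, hq2⟩ = s' l) ⟨q'.val % 2, Nat.mod_lt _ two_pos⟩
          (if p = s l then ⟨j.val / 2, by omega⟩ else ⟨j.val % 2, by omega⟩)) = q'.val := by
        generalize hc : (if p = s l then ⟨j.val / 2, by omega⟩ else ⟨j.val % 2, by omega⟩ : Fin 2)
          = c
        have := c.isLt
        unfold inNumber inPartner
        split_ifs
        · change 2 * (q'.val / 2) + (2 * c.val + q'.val % 2) % 2 = q'.val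
          omega
        · change 2 * (q'.val / 2) + (2 * (q'.val % 2) + c.val) / 2 = q'.val
          omega
      refine ⟨.inr ⟨_, _, rfl, hval⟩, ?_⟩
      simp only [key, hj, hval, h]
  · rw [adj_gIn] at hu hu'
    rcases hu with ⟨i, rfl, hi⟩ | ⟨p, j, rfl, hj⟩ <;>
      rcases hu' with ⟨i', rfl, hi'⟩ | ⟨p', j', rfl, hj'⟩
    · simp only [y.injEq, Fin.mk.injEq, Nat.add_right_cancel_iff]
      intro hii
      refine Fin.ext ?_
      rw [← Nat.mod_add_div' i.val (2 ^ (k - (l.val + 1))),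
        ← Nat.mod_add_div' i'.val (2 ^ (k - (l.val + 1))), hii, hi, hi']
    · simp
    · simp
    · intro hjj
      have hpp : p = p' := Fin.ext (by
        rw [← inNumber_div s l p j, ← inNumber_div s l p' j', hj, hj'])
      subst hpp
      have h1 := hj.trans hj'.symm
      have h2 := j.isLt
      have h3 := j'.isLt
      simp only [innerB.injEq, heq_eq_eq, true_and] at hjj ⊢
      refine Fin.ext ?_
      unfold inPartner at hjj
      unfold inNumber at h1
      split_ifs at hjj h1 <;> simp only [Fin.mk.injEq] at hjj <;> omega

/-- The neighbor of `β_j` in the half number `c` of the second layer of a gadget. -/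
def upPartner (j : Fin 4) (c : Fin 2) : Fin 4 :=
  match j, c with
  | 0, 0 => 0 | 0, 1 => 2 | 1, 0 => 1 | 1, 1 => 3 | 2, 0 => 1 | 2, 1 => 2 | 3, 0 => 0 | 3, 1 => 3

/-- The neighbor of `c_t` in the half number `c` of the first layer of a gadget. -/
def downPartner (t : Fin 4) (c : Fin 2) : Fin 4 :=
  match t, c with
  | 0, 0 => 0 | 0, 1 => 3 | 1, 0 => 1 | 1, 1 => 2 | 2, 0 => 0 | 2, 1 => 2 | 3, 0 => 1 | 3, 1 => 3

/-- The half of the layer of a gadget that contains the vertex number `j`. -/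
def half (j : Fin 4) : Fin 2 := ⟨j.val / 2, by omega⟩

lemma upPartner_spec : ∀ j c, (j, upPartner j c) ∈ cfiEdges ∧ half (upPartner j c) = c := by
  decide

lemma upPartner_eq : ∀ j t, (j, t) ∈ cfiEdges → upPartner j (half t) = t := by decide

lemma downPartner_spec : ∀ t c, (downPartner t c, t) ∈ cfiEdges ∧ half (downPartner t c) = c := by
  decide

lemma downPartner_eq : ∀ j t, (j, t) ∈ cfiEdges → downPartner t (half j) = j := by decide

lemma degIn_le_innerB (hI : Indistinct m D s s') (hC : Saturated (key m D s) C)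
    {l : Fin (k - 1)} {p p' : Fin (2 ^ l.val)} {j j' : Fin 4}
    (h : gInKey m D l (inNumber s l p j) = gInKey m D l (inNumber s' l p' j')) :
    degIn (concealerGraph s) C (innerB l p j) ≤ degIn (concealerGraph s') C (innerB l p' j') := by
  have heven := gInKey_even h
  rw [inNumber_div, inNumber_div] at heven
  refine degIn_le_of_key_map hI hC (fun u => match u with
    | gIn _ _ => gIn l ⟨inNumber s' l p' j', inNumber_lt s' l p' j'⟩
    | innerC _ _ t => innerC l p' (upPartner j' (half t))
    | u => u) (fun u hu => ?_) (fun u u' hu hu' => ?_)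
  · rw [adj_innerB] at hu ⊢
    rcases hu with rfl | ⟨t, rfl, ht⟩
    · exact ⟨.inl rfl, by simp only [key, h]⟩
    · refine ⟨.inr ⟨_, rfl, (upPartner_spec _ _).1⟩, ?_⟩
      simp only [key, heven, Prod.mk.injEq, true_and]
      by_cases hl : l.val < m
      · rw [if_pos hl, if_pos hl]
        rw [gInKey, gInKey, if_pos hl, if_pos hl] at h
        have hpp : p = p' := Fin.ext (by
          rw [← inNumber_div s l p j, ← inNumber_div s' l p' j', h])
        subst hpp
        rw [inNumber, inNumber, ← hI.1 l hl] at h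
        rw [← hI.1 l hl]
        have hhalf : (upPartner j' (half t)).val / 2 = t.val / 2 :=
          congrArg Fin.val (upPartner_spec j' (half t)).2
        by_cases hp : p = s l
        · -- in the correct pair, `β_j` and `β_j'` have the same in-vertex iff the parities agree
          rw [if_pos hp, if_pos hp] at h ⊢
          have hj : j.val % 2 = j'.val % 2 := by omega
          have : ∀ j j' t : Fin 4, j.val % 2 = j'.val % 2 → (j, t) ∈ cfiEdges →
              (if t.val < 2 then 0 else t.val) = if (upPartner j' (half t)).val < 2 then 0 else
                (upPartner j' (half t)).val := by decide
          exact this j j' t hj ht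
        · rw [if_neg hp, if_neg hp]
          split_ifs <;> omega
      · rw [if_neg hl, if_neg hl]
  · rw [adj_innerB] at hu hu'
    rcases hu with rfl | ⟨t, rfl, ht⟩ <;> rcases hu' with rfl | ⟨t', rfl, ht'⟩
    · simp
    · simp
    · simp
    · simp only [innerC.injEq, heq_eq_eq, true_and]
      intro htt
      have := congrArg half htt
      rw [(upPartner_spec _ _).2, (upPartner_spec _ _).2] at this
      rw [← upPartner_eq _ _ ht, ← upPartner_eq _ _ ht', this]

lemma degIn_le_uOut (hI : Indistinct m D s s') (hC : Saturated (key m D s) C)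
    {l : Fin (k - 1)} {p p' : Fin (2 ^ l.val)} {j j' : Fin 2}
    (h : gInKey m D l (2 * p) = gInKey m D l (2 * p')) (hj : l.val < m → j = j') :
    degIn (concealerGraph s) C (uOut l p j) ≤ degIn (concealerGraph s') C (uOut l p' j') := by
  refine degIn_le_of_key_map hI hC (fun u => match u with
    | gOut _ _ => gOut l j'
    | innerC _ _ t => innerC l p' ⟨2 * j'.val + t.val % 2, by omega⟩
    | u => u) (fun u hu => ?_) (fun u u' hu hu' => ?_)
  · rw [adj_uOut] at hu ⊢
    rcases hu with ⟨t, rfl, ht⟩ | rfl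
    · refine ⟨.inl ⟨_, rfl, by simp only; omega⟩, ?_⟩
      simp only [key, h, Prod.mk.injEq, true_and]
      by_cases hl : l.val < m
      · rw [gInKey, gInKey, if_pos hl, if_pos hl] at h
        have hpp : p = p' := Fin.ext (by omega)
        subst hpp
        have h1 : 2 * j'.val + t.val % 2 = t.val := by rw [← hj hl]; omega
        rw [h1, hI.1 l hl]
      · rw [if_neg hl, if_neg hl]
    · refine ⟨.inr rfl, ?_⟩
      by_cases hl : l.val < m
      · rw [hj hl, key_congr hI]
      · simp only [key, if_neg hl]
  · rw [adj_uOut] at hu hu'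
    rcases hu with ⟨t, rfl, ht⟩ | rfl <;> rcases hu' with ⟨t', rfl, ht'⟩ | rfl
    · simp only [innerC.injEq, heq_eq_eq, true_and, Fin.mk.injEq]
      intro h
      exact Fin.ext (by omega)
    · simp
    · simp
    · simp

lemma degIn_le_gOut (hI : Indistinct m D s s') (hC : Saturated (key m D s) C)
    {l : Fin (k - 1)} {j j' : Fin 2} (hj : l.val < m → j = j') :
    degIn (concealerGraph s) C (gOut l j) ≤ degIn (concealerGraph s') C (gOut l j') := by
  set e := k - (l.val + 2) with he
  have hpos : 0 < 2 ^ e := by positivity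
  -- the index that is obtained from `i` by replacing the bit number `e` by `j'`
  have hlt : ∀ i : Fin (2 ^ k),
      i.val % 2 ^ e + (2 * (i.val / 2 ^ e / 2) + j'.val) * 2 ^ e < 2 ^ k := by
    intro i
    have h1 : 2 ^ (l.val + 2) * 2 ^ e = 2 ^ k := by
      rw [← pow_add, he, Nat.add_sub_cancel' (by omega)]
    refine (Nat.block_translate_lt hpos ?_).trans_eq h1
    have h2 : i.val / 2 ^ e < 2 ^ (l.val + 2) := Nat.div_two_pow_lt i.isLt (by omega)
    have h3 := j'.isLt
    rw [pow_succ] at h2 ⊢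
    omega
  refine degIn_le_of_key_map hI hC (fun u => match u with
    | uOut l p _ => uOut l p j'
    | x i => x ⟨_, hlt i⟩
    | u => u) (fun u hu => ?_) (fun u u' hu hu' => ?_)
  · rw [adj_gOut] at hu ⊢
    rcases hu with ⟨p, rfl⟩ | ⟨i, rfl, hi⟩
    · refine ⟨.inl ⟨p, rfl⟩, ?_⟩
      by_cases hl : l.val < m
      · rw [hj hl, key_congr hI]
      · simp only [key, if_neg hl]
    · refine ⟨.inr ⟨_, rfl, ?_⟩, ?_⟩
      · simp only [← he]
        rw [Nat.block_translate_div hpos]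
        omega
      · simp only [key, Prod.mk.injEq, true_and, and_true]
        by_cases hl : l.val < m
        · rw [← he] at hi
          have h1 : 2 * (i.val / 2 ^ e / 2) + j'.val = i.val / 2 ^ e := by rw [← hj hl]; omega
          rw [h1, Nat.mod_add_div']
        · rw [Nat.div_two_pow_of_le (a := e + 1) (b := k - (m + 1)) (by omega),
            Nat.div_two_pow_of_le (i := _ + _) (a := e + 1) (b := k - (m + 1)) (by omega)]
          congr 1
          rw [pow_succ, ← Nat.div_div_eq_div_mul, ← Nat.div_div_eq_div_mul,
            Nat.block_translate_div hpos]
          omega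
  · rw [adj_gOut] at hu hu'
    rcases hu with ⟨p, rfl⟩ | ⟨i, rfl, hi⟩ <;> rcases hu' with ⟨p', rfl⟩ | ⟨i', rfl, hi'⟩
    · simp
    · simp
    · simp
    · simp only [x.injEq, Fin.mk.injEq]
      intro h
      rw [← he] at hi hi'
      have h1 := congrArg (· / 2 ^ e) h
      have h2 := congrArg (· % 2 ^ e) h
      simp only [Nat.block_translate_div hpos, Nat.add_mul_mod_self_right, Nat.mod_mod] at h1 h2
      refine Fin.ext ?_
      rw [← Nat.mod_add_div' i.val (2 ^ e), ← Nat.mod_add_div' i'.val (2 ^ e), h2]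
      congr 2
      omega

lemma degIn_le_innerC (hI : Indistinct m D s s') (hC : Saturated (key m D s) C)
    {l : Fin (k - 1)} {p p' : Fin (2 ^ l.val)} {t t' : Fin 4}
    (h : key m D s (innerC l p t) = key m D s' (innerC l p' t')) :
    degIn (concealerGraph s) C (innerC l p t) ≤ degIn (concealerGraph s') C (innerC l p' t') := by
  simp only [key, Prod.mk.injEq, true_and] at h
  obtain ⟨h, ht⟩ := h
  -- in a correct pair that has been passed, `c_0` and `c_1` have the same class, and their
  -- neighbors have to be matched according to the parities; otherwise according to the halves
  set sw : Prop := l.val < m ∧ p = s l ∧ t ≠ t'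
  classical
  refine degIn_le_of_key_map hI hC (fun u => match u with
    | uOut _ _ _ => uOut l p' (half t')
    | innerB _ _ j => innerB l p' (if sw then j + 2 else downPartner t' (half j))
    | u => u) (fun u hu => ?_) (fun u u' hu hu' => ?_)
  · rw [adj_innerC] at hu ⊢
    rcases hu with ⟨j, rfl, hj⟩ | ⟨j, rfl, hj⟩
    · by_cases hl : l.val < m
      · rw [gInKey, gInKey, if_pos hl, if_pos hl] at h
        have hpp : p = p' := Fin.ext (by omega)
        subst hpp
        rw [if_pos hl, if_pos hl, ← hI.1 l hl] at ht
        by_cases hp : p = s l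
        · rw [if_pos hp, if_pos hp] at ht
          by_cases htt : t = t'
          · subst htt
            have h1 : ¬ sw := fun h => h.2.2 rfl
            simp only [if_neg h1, downPartner_eq _ _ hj]
            exact ⟨.inl ⟨_, rfl, hj⟩, by rw [key_congr hI]⟩
          · have h1 : sw := ⟨hl, hp, htt⟩
            simp only [if_pos h1]
            have h2 : ∀ t t' j : Fin 4, (if t.val < 2 then 0 else t.val) =
                (if t'.val < 2 then 0 else t'.val) → t ≠ t' → (j, t) ∈ cfiEdges →
                (j + 2, t') ∈ cfiEdges := by decide
            refine ⟨.inl ⟨_, rfl, h2 t t' j ht htt hj⟩, ?_⟩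
            have h3 : ∀ j : Fin 4, (j + 2).val % 2 = j.val % 2 := by decide
            simp only [key, inNumber, if_pos hp, ← hI.1 l hl, h3]
        · have h1 : ¬ sw := fun h => hp h.2.1
          simp only [if_neg h1]
          refine ⟨.inl ⟨_, rfl, (downPartner_spec _ _).1⟩, ?_⟩
          have h2 : (downPartner t' (half j)).val / 2 = j.val / 2 :=
            congrArg Fin.val (downPartner_spec t' (half j)).2
          simp only [key, inNumber, ← hI.1 l hl, if_neg hp, h2]
      · have h1 : ¬ sw := fun h => hl h.1
        simp only [if_neg h1]
        refine ⟨.inl ⟨_, rfl, (downPartner_spec _ _).1⟩, ?_⟩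
        simp only [key, Prod.mk.injEq, true_and, and_true]
        rw [gInKey_inNumber_congr hI]
        rcases eq_or_ne l.val m with hlm | hlm
        · obtain ⟨hs1, hs2⟩ := hI.2 l hlm
          rw [← hlm, gInKey_self, gInKey_self] at h
          have hpp : p = p' := Fin.ext (by have := blockKey_div_two h; omega)
          subst hpp
          by_cases hp : p.val ∈ D
          · have h3 : p ≠ s' l := fun e => hs2 (e ▸ hp)
            have h2 : (downPartner t' (half j)).val / 2 = j.val / 2 :=
              congrArg Fin.val (downPartner_spec t' (half j)).2
            rw [inNumber, inNumber, if_neg h3, if_neg h3, h2]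
          · rw [← hlm, gInKey_self, gInKey_self]
            refine blockKey_eq (by rw [inNumber_div, inNumber_div]) ?_
            rwa [inNumber_div]
        · have hlm' : m < l.val := by omega
          rw [gInKey_eq_of_lt hlm' (q' := 2 * p.val) (by rw [inNumber_div]; omega), h]
          exact gInKey_eq_of_lt hlm' (by rw [inNumber_div]; omega)
    · refine ⟨.inr ⟨_, rfl, rfl⟩, ?_⟩
      simp only [key, h, Prod.mk.injEq, true_and]
      split_ifs at ht ⊢ with hl <;> simp only [half] <;> omega
  · rw [adj_innerC] at hu hu'
    rcases hu with ⟨j, rfl, hj⟩ | ⟨j, rfl, hj⟩ <;> rcases hu' with ⟨j', rfl, hj'⟩ | ⟨j', rfl, hj'⟩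
    · simp only [innerB.injEq, heq_eq_eq, true_and]
      split_ifs
      · exact fun h => add_right_cancel h
      · intro h
        have := congrArg half h
        rw [(downPartner_spec _ _).2, (downPartner_spec _ _).2] at this
        rw [← downPartner_eq _ _ hj, ← downPartner_eq _ _ hj', this]
    · simp
    · simp
    · intro _
      exact congrArg _ (Fin.ext (hj.symm.trans hj'))

lemma degIn_le_of_key (hm : m + 1 ≤ k) (hI : Indistinct m D s s') (hC : Saturated (key m D s) C)
    {v w : ConcealerVertex k} (h : key m D s v = key m D s' w)
    (hxx : ∀ i j i' j', v = yy i j → w = yy i' j' → ∀ t, xx i t ∈ C → xx i' t ∈ C) :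
    degIn (concealerGraph s) C v ≤ degIn (concealerGraph s') C w := by
  cases v <;> cases w <;> try (simp [key] at h; done)
  · simp only [key, Prod.mk.injEq, true_and, and_true] at h
    rw [Fin.ext h]
    exact degIn_le_start hI hC _
  · simp only [key, Prod.mk.injEq, true_and, and_true] at h
    exact degIn_le_x hm hI hC h
  · simp only [key, Prod.mk.injEq, true_and, and_true] at h
    exact degIn_le_xx hI hC h _ _
  · simp only [key, Prod.mk.injEq, true_and, and_true] at h
    exact degIn_le_yy hC h _ _ (hxx _ _ _ _ rfl rfl)
  · simp only [key, Prod.mk.injEq, true_and, and_true] at h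
    exact degIn_le_y hm hI hC h
  · simp only [key, Prod.mk.injEq, true_and, and_true] at h
    obtain ⟨h1, h⟩ := h
    obtain rfl := Fin.ext h1
    exact degIn_le_gIn hI hC h
  · simp only [key, Prod.mk.injEq, true_and, and_true] at h
    obtain ⟨h1, h⟩ := h
    obtain rfl := Fin.ext h1
    exact degIn_le_innerB hI hC h
  · obtain rfl := Fin.ext (congrArg (fun a => a.2.1) h)
    exact degIn_le_innerC hI hC h
  · simp only [key, Prod.mk.injEq, true_and] at h
    obtain ⟨h1, h, h2⟩ := h
    obtain rfl := Fin.ext h1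
    refine degIn_le_uOut hI hC h fun hl => Fin.ext ?_
    rwa [if_pos hl, if_pos hl] at h2
  · simp only [key, Prod.mk.injEq, true_and, and_true] at h
    obtain ⟨h1, h2⟩ := h
    obtain rfl := Fin.ext h1
    refine degIn_le_gOut hI hC fun hl => Fin.ext ?_
    rwa [if_pos hl, if_pos hl] at h2

/-- Vertices with the same label have the same number of neighbors in every saturated set, also
with respect to different choices of the correct pairs that cannot be told apart, with the possible
exception of the neighbors of the vertices `yy i j` in the layer of the vertices `xx i t`. -/
lemma degIn_eq_of_key (hm : m + 1 ≤ k) (hI : Indistinct m D s s') (hC : Saturated (key m D s) C)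
    {v w : ConcealerVertex k} (h : key m D s v = key m D s w)
    (hxx : ∀ i j i' j', v = yy i j → w = yy i' j' → ∀ t, xx i t ∈ C ↔ xx i' t ∈ C) :
    degIn (concealerGraph s) C v = degIn (concealerGraph s') C w := by
  apply le_antisymm
  · exact degIn_le_of_key hm hI hC (by rw [h, key_congr hI])
      fun i j i' j' hv hw t => (hxx i j i' j' hv hw t).1
  · rw [key_congr hI] at hC
    exact degIn_le_of_key hm hI.symm hC (by rw [← key_congr hI, h])
      fun i j i' j' hw hv t => (hxx i' j' i j hv hw t).2

end Compatible

/-! ### Progress of a refinement step and its cost -/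

section Progress

open ConcealerVertex

variable {k m : ℕ} {D D' : Finset ℕ} {s s' : CorrectPairs k}

lemma blockKey_mono (hD : D ⊆ D') {b b' : ℕ} (h : blockKey D' b = blockKey D' b') :
    blockKey D b = blockKey D b' := by
  have h1 := blockKey_div_two h
  unfold blockKey at *
  rw [h1] at h ⊢
  split_ifs at h ⊢ with h2 h3
  · exact h
  · exact absurd (hD h2) h3
  · rfl
  · rfl

lemma key_factorsThrough {m' : ℕ} (hm : m ≤ m')
    (hx : ∀ i i' : ℕ, i / 2 ^ (k - (m' + 1)) = i' / 2 ^ (k - (m' + 1)) →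
      i / 2 ^ (k - (m + 1)) = i' / 2 ^ (k - (m + 1)))
    (hy : ∀ i i' : ℕ, yKey k m' D' i = yKey k m' D' i' → yKey k m D i = yKey k m D i')
    (hg : ∀ l q q' : ℕ, gInKey m' D' l q = gInKey m' D' l q' →
      gInKey m D l q = gInKey m D l q') :
    (key m D s).FactorsThrough (key m' D' s) := by
  have hite : ∀ l a b : ℕ, (if l < m' then a else 0) = (if l < m' then b else 0) →
      (if l < m then a else 0) = if l < m then b else 0 := by
    intro l a b h
    by_cases hl : l < m
    · rw [if_pos (hl.trans_le hm), if_pos (hl.trans_le hm)] at h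
      rw [h]
    · rw [if_neg hl, if_neg hl]
  intro v w h
  cases v <;> cases w <;> try (simp [key] at h; done)
  all_goals simp only [key, Prod.mk.injEq, and_true, true_and] at h ⊢
  · exact h
  · exact hx _ _ h
  · exact hx _ _ h
  · exact hy _ _ h
  · exact hy _ _ h
  · obtain ⟨h1, h2⟩ := h
    obtain rfl := Fin.ext h1
    exact ⟨rfl, hg _ _ _ h2⟩
  · obtain ⟨h1, h2⟩ := h
    obtain rfl := Fin.ext h1
    exact ⟨rfl, hg _ _ _ h2⟩
  · obtain ⟨h1, h2, h3⟩ := h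
    obtain rfl := Fin.ext h1
    refine ⟨rfl, hg _ _ _ h2, hite _ _ _ h3⟩
  · obtain ⟨h1, h2, h3⟩ := h
    obtain rfl := Fin.ext h1
    refine ⟨rfl, hg _ _ _ h2, hite _ _ _ h3⟩
  · obtain ⟨h1, h2⟩ := h
    obtain rfl := Fin.ext h1
    refine ⟨rfl, hite _ _ _ h2⟩

lemma key_factorsThrough_of_subset (hD : D ⊆ D') :
    (key m D s).FactorsThrough (key m D' s) := by
  refine key_factorsThrough le_rfl (fun _ _ h => h) (fun _ _ h => blockKey_mono hD h) ?_
  intro l q q' h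
  unfold gInKey at *
  split_ifs at *
  · exact h
  · exact blockKey_mono hD h

lemma key_factorsThrough_succ (hm : m + 1 < k) :
    (key m D s).FactorsThrough (key (m + 1) ∅ s) := by
  have hi : ∀ i i' : ℕ, i / 2 ^ (k - (m + 1 + 1)) / 2 = i' / 2 ^ (k - (m + 1 + 1)) / 2 →
      i / 2 ^ (k - (m + 1)) = i' / 2 ^ (k - (m + 1)) := by
    intro i i' h
    rwa [Nat.div_div_eq_div_mul, Nat.div_div_eq_div_mul, ← pow_succ,
      show k - (m + 1 + 1) + 1 = k - (m + 1) by omega] at h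
  refine key_factorsThrough (Nat.le_succ m) (fun i i' h => hi i i' (congrArg (· / 2) h))
    (fun i i' h => yKey_congr (hi i i' (blockKey_div_two h))) ?_
  intro l q q' h
  unfold gInKey at *
  by_cases h1 : l < m + 1
  · rw [if_pos h1, if_pos h1] at h
    rw [h]
  · rw [if_neg h1, if_neg h1] at h
    rw [if_neg (by omega), if_neg (by omega)]
    have h3 := blockKey_div_two h
    rw [Nat.div_div_eq_div_mul, Nat.div_div_eq_div_mul, ← pow_succ] at h3
    rw [show l - m = l - (m + 1) + 1 by omega, h3]

/-- The number of the pair of blocks of level `m + 1` that contains the index `i`. -/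
def pairOf (k m i : ℕ) : ℕ := i / 2 ^ (k - (m + 1)) / 2

lemma pairOf_lt (hm : m + 1 ≤ k) (i : Fin (2 ^ k)) : pairOf k m i < 2 ^ m := by
  have h1 := Nat.div_two_pow_lt i.isLt hm
  have h2 := pow_succ 2 m
  unfold pairOf
  omega

open Classical in
/-- The pairs of blocks of level `m + 1` that are touched when `A` is refined with respect to
`C`: vertices `yy i j` of the pair take part, and `C` distinguishes the two blocks of the pair. -/
def touched (k m : ℕ) (A C : Set (ConcealerVertex k)) : Finset ℕ :=
  (Finset.range (2 ^ m)).filter fun p => ∃ (i i' : Fin (2 ^ k)) (j t : Fin k),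
    pairOf k m i = p ∧ pairOf k m i' = p ∧ yy i j ∈ A ∧ xx i t ∈ C ∧ xx i' t ∉ C

lemma Indistinct.subset (h : Indistinct m D' s s') (hD : D ⊆ D') : Indistinct m D s s' :=
  ⟨h.1, fun l hl => ⟨fun h' => (h.2 l hl).1 (hD h'), fun h' => (h.2 l hl).2 (hD h')⟩⟩

/-- After a refinement step the coloring is still coarser than the knowledge partition with the
newly touched pairs, provided that none of the touched pairs is the correct one. -/
lemma refine_factorsThrough_of_touched (hm : m + 1 ≤ k) {π : Coloring (ConcealerVertex k)}
    (hπ : π.FactorsThrough (key m D s)) (X C : Set Color)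
    (hs : Indistinct m (D ∪ touched k m (π ⁻¹' X) (π ⁻¹' C)) s s) :
    (refine (concealerGraph s) π C X).FactorsThrough
      (key m (D ∪ touched k m (π ⁻¹' X) (π ⁻¹' C)) s) := by
  intro v w hvw
  have hD : key m D s v = key m D s w :=
    key_factorsThrough_of_subset Finset.subset_union_left hvw
  rw [refine_eq_iff]
  refine ⟨hπ hD, fun hX => ?_⟩
  have hC : Saturated (key m D s) (π ⁻¹' C) := (Saturated.preimage π C).mono hπ
  have hA : Saturated (key m D s) (π ⁻¹' X) := (Saturated.preimage π X).mono hπ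
  refine degIn_eq_of_key hm (hs.subset Finset.subset_union_left) hC hD ?_
  rintro i j i' j' rfl rfl t
  have hy : yKey k m (D ∪ touched k m (π ⁻¹' X) (π ⁻¹' C)) i =
      yKey k m (D ∪ touched k m (π ⁻¹' X) (π ⁻¹' C)) i' := congrArg (fun a => a.2.1) hvw
  have hp : pairOf k m i = pairOf k m i' := blockKey_div_two hy
  have hwX : yy i' j' ∈ π ⁻¹' X := hA _ _ hD hX
  by_cases hT : pairOf k m i ∈ D ∪ touched k m (π ⁻¹' X) (π ⁻¹' C)
  · have hb : i.val / 2 ^ (k - (m + 1)) = i'.val / 2 ^ (k - (m + 1)) := by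
      unfold yKey blockKey at hy
      unfold pairOf at hT hp
      rw [← hp, if_pos hT, if_pos hT] at hy
      omega
    exact hC.mem_iff (by simp only [key, hb])
  · have hT' : pairOf k m i ∉ touched k m (π ⁻¹' X) (π ⁻¹' C) :=
      fun h => hT (Finset.mem_union_right _ h)
    simp only [touched, Finset.mem_filter, Finset.mem_range, not_and, not_exists] at hT'
    have hlt := pairOf_lt hm i
    constructor
    · intro h
      by_contra h'
      exact hT' hlt i i' j t rfl hp.symm hX h h'
    · intro h
      by_contra h'
      exact hT' hlt i' i j' t hp.symm rfl hwX h h'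

/-- If the correct pair has been untouched before a refinement step, then this step reveals at most
the blocks of level `m + 1` of `Y` and nothing beyond the gadget. -/
lemma refine_factorsThrough_succ (hm : m + 1 < k) {π : Coloring (ConcealerVertex k)}
    (hπ : π.FactorsThrough (key m D s)) (X C : Set Color) (hs : Indistinct m D s s) :
    (refine (concealerGraph s) π C X).FactorsThrough (key (m + 1) ∅ s) := by
  intro v w hvw
  have hD : key m D s v = key m D s w := key_factorsThrough_succ hm hvw
  rw [refine_eq_iff]
  refine ⟨hπ hD, fun _ => ?_⟩
  have hC : Saturated (key m D s) (π ⁻¹' C) := (Saturated.preimage π C).mono hπ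
  refine degIn_eq_of_key hm.le hs hC hD ?_
  rintro i j i' j' rfl rfl t
  have hy : yKey k (m + 1) ∅ i = yKey k (m + 1) ∅ i' := congrArg (fun a => a.2.1) hvw
  have hb := blockKey_div_two hy
  rw [Nat.div_div_eq_div_mul, Nat.div_div_eq_div_mul, ← pow_succ,
    show k - (m + 1 + 1) + 1 = k - (m + 1) by omega] at hb
  exact hC.mem_iff (by simp only [key, hb])

lemma card_mul_le_edgesBetween (s : CorrectPairs k) {A C : Set (ConcealerVertex k)}
    (I : Finset (Fin (2 ^ k))) (hI : ∀ i ∈ I, ∀ j, yy i j ∈ A ∧ xx i j ∈ C) :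
    I.card * (k * k) ≤ edgesBetween (concealerGraph s) A C := by
  have hinj : Set.InjOn (fun a : Fin (2 ^ k) × Fin k × Fin k =>
      (s(yy a.1 a.2.1, xx a.1 a.2.2) : Sym2 (ConcealerVertex k)))
      (I ×ˢ (Finset.univ : Finset (Fin k × Fin k)) : Finset _) := by
    rintro ⟨i, j, t⟩ _ ⟨i', j', t'⟩ _ h
    simpa [and_assoc, and_left_comm] using h
  calc I.card * (k * k) = (I ×ˢ (Finset.univ : Finset (Fin k × Fin k))).card := by
        simp [Finset.card_product]
    _ ≤ edgesBetween (concealerGraph s) A C := by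
        rw [← Set.ncard_coe_finset, ← hinj.ncard_image]
        refine Set.ncard_le_ncard ?_ (Set.toFinite _)
        rintro _ ⟨⟨i, j, t⟩, hi, rfl⟩
        simp only [Finset.coe_product, Set.mem_prod, Finset.mem_coe] at hi
        refine ⟨?_, _, _, (hI i hi.1 j).1, (hI i hi.1 t).2, rfl⟩
        exact (adj_yy s).2 (.inr ⟨t, rfl⟩)

/-- For every pair that is newly touched, all the edges of one of its blocks are counted. -/
lemma touched_le_edgesBetween (hm : m + 1 ≤ k) {A C : Set (ConcealerVertex k)}
    (hA : Saturated (key m D s) A) (hC : Saturated (key m D s) C) :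
    (touched k m A C \ D).card * (k * k * 2 ^ (k - (m + 1))) ≤
      edgesBetween (concealerGraph s) A C := by
  classical
  set e := k - (m + 1) with he
  have hpos : 0 < 2 ^ e := by positivity
  set I : Finset (Fin (2 ^ k)) := Finset.univ.filter fun i => ∀ j, yy i j ∈ A ∧ xx i j ∈ C with hI
  have hcard : (touched k m A C \ D).card * 2 ^ e ≤ I.card := by
    have hw : ∀ p ∈ touched k m A C \ D, ∃ b : ℕ, b / 2 = p ∧ b < 2 ^ (m + 1) ∧
        ∀ i : Fin (2 ^ k), i.val / 2 ^ e = b → i ∈ I := by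
      intro p hp
      simp only [touched, Finset.mem_sdiff, Finset.mem_filter] at hp
      obtain ⟨⟨_, i, i', j, t, hi, hi', hj, ht, _⟩, hpD⟩ := hp
      refine ⟨i.val / 2 ^ e, hi, Nat.div_two_pow_lt i.isLt hm, fun a ha => ?_⟩
      simp only [hI, Finset.mem_filter, Finset.mem_univ, true_and]
      refine fun j' => ⟨hA _ _ ?_ hj, hC _ _ ?_ ht⟩
      · simp only [key, yKey, ← he, ha]
      · simp only [key, ← he, ha]
    choose! b hb1 hb2 hb3 using hw
    have hk : 2 ^ (m + 1) * 2 ^ e = 2 ^ k := by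
      rw [← pow_add, he, Nat.add_sub_cancel' hm]
    rw [← Finset.card_range (2 ^ e), ← Finset.card_product]
    have hlt : ∀ a ∈ (touched k m A C \ D) ×ˢ Finset.range (2 ^ e),
        a.2 % 2 ^ e + b a.1 * 2 ^ e < 2 ^ k := fun a ha =>
      (Nat.block_translate_lt hpos (hb2 _ (Finset.mem_product.1 ha).1)).trans_eq hk
    refine Finset.card_le_card_of_injOn
      (fun a => if h : a.2 % 2 ^ e + b a.1 * 2 ^ e < 2 ^ k then ⟨_, h⟩ else ⟨0, by positivity⟩)
      ?_ ?_
    · intro a ha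
      simp only [dif_pos (hlt a ha)]
      exact hb3 _ (Finset.mem_product.1 ha).1 _ (Nat.block_translate_div hpos)
    · intro a ha a' ha' h
      simp only [dif_pos (hlt a ha), dif_pos (hlt a' ha'), Fin.mk.injEq] at h
      have h1 := congrArg (· / 2 ^ e) h
      have h2 := congrArg (· % 2 ^ e) h
      simp only [Nat.block_translate_div hpos, Nat.add_mul_mod_self_right, Nat.mod_mod] at h1 h2
      obtain ⟨ha1, ha2⟩ := Finset.mem_product.1 ha
      obtain ⟨ha1', ha2'⟩ := Finset.mem_product.1 ha'
      rw [Nat.mod_eq_of_lt (Finset.mem_range.1 ha2),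
        Nat.mod_eq_of_lt (Finset.mem_range.1 ha2')] at h2
      refine Prod.ext ?_ h2
      rw [← hb1 _ ha1, ← hb1 _ ha1', h1]
  calc (touched k m A C \ D).card * (k * k * 2 ^ e)
      = (touched k m A C \ D).card * 2 ^ e * (k * k) := by ring
    _ ≤ I.card * (k * k) := Nat.mul_le_mul_right _ hcard
    _ ≤ _ := card_mul_le_edgesBetween s I fun i hi j => by
        simp only [hI, Finset.mem_filter, Finset.mem_univ, true_and] at hi
        exact hi j

end Progress

/-! ### The adversary -/

section Adversary

open ConcealerVertex

variable {k : ℕ}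

/-- After `n` steps the execution of `W` is the same for all choices of the correct pairs that
agree with `s₀` up to the level `m` and whose correct pair of the level `m + 1` is not in `D`; it
has not found an equitable coloring, the coloring is coarser than `key m D`, and the cost so far
is at least `c`. -/
def Confined (W : Strategy) (s₀ : CorrectPairs k) (m : ℕ) (D : Finset ℕ) (n c : ℕ) : Prop :=
  ∃ S π, ∀ s : CorrectPairs k, Indistinct m ∅ s₀ s → Indistinct m D s s →
    W.run (concealerGraph s) n = (S, π) ∧ π.FactorsThrough (key m D s) ∧
    (∀ t < n, ¬ Equitable (concealerGraph s) (W.run (concealerGraph s) t).2) ∧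
    c ≤ ∑ t ∈ Finset.range n, W.stepCost (concealerGraph s) t

variable {m : ℕ} {D : Finset ℕ} {s s' s₀ : CorrectPairs k}

lemma Indistinct.of_left (h : Indistinct m ∅ s₀ s) (h' : Indistinct m ∅ s₀ s')
    (hs : Indistinct m D s s) (hs' : Indistinct m D s' s') : Indistinct m D s s' :=
  ⟨fun l hl => (h.1 l hl).symm.trans (h'.1 l hl), fun l hl => ⟨(hs.2 l hl).1, (hs'.2 l hl).1⟩⟩

lemma Indistinct.self (hm : m < k - 1) (h : (s ⟨m, hm⟩).val ∉ D) : Indistinct m D s s := by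
  refine ⟨fun _ _ => rfl, ?_⟩
  rintro ⟨l, hl⟩ rfl
  exact ⟨h, h⟩

lemma exists_extension (hm : m < k - 1) (s₀ : CorrectPairs k) {p : ℕ} (hp : p < 2 ^ m) :
    ∃ s : CorrectPairs k, Indistinct m ∅ s₀ s ∧ (s ⟨m, hm⟩).val = p := by
  refine ⟨Function.update s₀ ⟨m, hm⟩ ⟨p, hp⟩, ⟨fun l hl => ?_, fun l _ => by simp⟩, by simp⟩
  rw [Function.update_of_ne]
  rintro rfl
  exact lt_irrefl _ hl

lemma degIn_congr (hm : m + 1 ≤ k) (hI : Indistinct m D s s')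
    {π : Coloring (ConcealerVertex k)} (hπ : π.FactorsThrough (key m D s)) :
    ∀ A, Saturated π A → ∀ v, degIn (concealerGraph s) A v = degIn (concealerGraph s') A v := by
  intro A hA v
  refine degIn_eq_of_key hm hI (hA.mono hπ) rfl ?_
  rintro i j i' j' rfl h t
  cases h
  rfl

lemma not_equitable_of_factorsThrough (hm : m + 1 < k)
    (hsep : ∃ c π, Reach (concealerGraph s) c π ∧ ∀ i i', π (x i) = π (x i') → i = i')
    {π : Coloring (ConcealerVertex k)} (hπ : π.FactorsThrough (key m D s)) :
    ¬ Equitable (concealerGraph s) π := by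
  intro he
  obtain ⟨c, ρ, hr, hinj⟩ := hsep
  have h1 : 1 < 2 ^ (k - (m + 1)) := Nat.one_lt_two_pow (by omega)
  have h2 : 2 ^ (k - (m + 1)) ≤ 2 ^ k := Nat.pow_le_pow_right two_pos (by omega)
  have h3 := hr.factorsThrough (fun v w h A hA => he.degIn_eq h hA)
    (hπ (a := x ⟨0, by omega⟩) (b := x ⟨1, by omega⟩)
      (by simp only [key, Nat.zero_div, Nat.div_eq_of_lt h1]))
  simpa using hinj _ _ h3

lemma run_succ_congr {V : Type} {W : Strategy} {G G' : SimpleGraph V} {n : ℕ}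
    (h : W.run G n = W.run G' n)
    (h1 : ∀ A, Saturated (W.run G n).2 A → ∀ v, degIn G A v = degIn G' A v)
    (h2 : ∀ A, Saturated (W.run G (n + 1)).2 A → ∀ v, degIn G A v = degIn G' A v) :
    W.run G (n + 1) = W.run G' (n + 1) := by
  have h3 : (W.run G (n + 1)).2 = (W.run G' (n + 1)).2 := by
    change refine G (W.run G n).2 _ _ = refine G' (W.run G' n).2 _ _
    rw [← h]
    exact refine_congr h1 _ _
  refine Prod.ext ?_ h3
  have h4 := partialQuotient_congr h2
  change (W.run G n).1 ++ [partialQuotient G (W.run G (n + 1)).2] =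
    (W.run G' n).1 ++ [partialQuotient G' (W.run G' (n + 1)).2]
  rw [h4, ← h3, h]

/-- As long as some pair of the current level remains untouched, the adversary may let the correct
pair be one of these. When the last pairs are touched, he chooses one of those as the correct
one. -/
lemma Confined.step (hm : m + 1 < k) {W : Strategy} {n c : ℕ}
    (hsep : ∀ s : CorrectPairs k, ∃ c π, Reach (concealerGraph s) c π ∧
      ∀ i i', π (x i) = π (x i') → i = i')
    (h : Confined W s₀ m D n (c + D.card * (k * k * 2 ^ (k - (m + 1)))))
    (hD : D ⊂ Finset.range (2 ^ m)) :
    (∃ D' ⊂ Finset.range (2 ^ m),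
      Confined W s₀ m D' (n + 1) (c + D'.card * (k * k * 2 ^ (k - (m + 1))))) ∨
    ∃ s₁ : CorrectPairs k,
      Confined W s₁ (m + 1) ∅ (n + 1) (c + 2 ^ m * (k * k * 2 ^ (k - (m + 1)))) := by
  classical
  obtain ⟨S, π, hR⟩ := h
  set b := k * k * 2 ^ (k - (m + 1))
  set T := touched k m (π ⁻¹' (W S).2) (π ⁻¹' (W S).1)
  have hsucc : ∀ s : CorrectPairs k, W.run (concealerGraph s) n = (S, π) →
      (W.run (concealerGraph s) (n + 1)).2 = refine (concealerGraph s) π (W S).1 (W S).2 := by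
    intro s hs
    change refine (concealerGraph s) (W.run (concealerGraph s) n).2 _ _ = _
    rw [hs]
  have hTsub : D ∪ T ⊆ Finset.range (2 ^ m) :=
    Finset.union_subset hD.subset (Finset.filter_subset _ _)
  have hcu : (D ∪ T).card = D.card + (T \ D).card := by
    rw [← Finset.union_sdiff_self_eq_union, Finset.card_union_of_disjoint Finset.disjoint_sdiff]
  -- the cost and the absence of an equitable coloring up to the new step
  have hnext : ∀ s : CorrectPairs k, Indistinct m ∅ s₀ s → Indistinct m D s s →
      (∀ t < n + 1, ¬ Equitable (concealerGraph s) (W.run (concealerGraph s) t).2) ∧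
      c + (D ∪ T).card * b ≤ ∑ t ∈ Finset.range (n + 1), W.stepCost (concealerGraph s) t := by
    intro s h0 hs
    obtain ⟨h1, h2, h3, h4⟩ := hR s h0 hs
    constructor
    · intro t ht
      rcases Nat.lt_succ_iff_lt_or_eq.1 ht with ht | rfl
      · exact h3 t ht
      · rw [h1]
        exact not_equitable_of_factorsThrough hm (hsep s) h2
    · rw [Finset.sum_range_succ, hcu, add_mul, ← add_assoc]
      refine Nat.add_le_add h4 ?_
      rw [Strategy.stepCost, h1, refineCost_eq]
      exact touched_le_edgesBetween hm.le ((Saturated.preimage π _).mono h2)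
        ((Saturated.preimage π _).mono h2)
  by_cases hfull : D ∪ T = Finset.range (2 ^ m)
  · right
    obtain ⟨p, hp, hpD⟩ := Finset.exists_of_ssubset hD
    obtain ⟨s₁, hs₁, hp₁⟩ :=
      exists_extension (by omega) s₀ (Finset.mem_range.1 hp)
    have hmain : ∀ s : CorrectPairs k, Indistinct (m + 1) ∅ s₁ s →
        Indistinct m ∅ s₀ s ∧ Indistinct m D s s := by
      intro s hs
      constructor
      · exact ⟨fun l hl => (hs₁.1 l hl).trans (hs.1 l (by omega)), fun l _ => by simp⟩
      · exact .self (by omega) (by rw [← hs.1 _ (by simp), hp₁]; exact hpD)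
    refine ⟨s₁, (W.run (concealerGraph s₁) (n + 1)).1, (W.run (concealerGraph s₁) (n + 1)).2, ?_⟩
    obtain ⟨h0₁, hD₁⟩ := hmain s₁ ⟨fun _ _ => rfl, fun _ _ => by simp⟩
    obtain ⟨hr₁, hf₁, -⟩ := hR s₁ h0₁ hD₁
    have hf₁' : (W.run (concealerGraph s₁) (n + 1)).2.FactorsThrough (key (m + 1) ∅ s₁) := by
      rw [hsucc s₁ hr₁]
      exact refine_factorsThrough_succ hm hf₁ _ _ hD₁
    intro s hs _
    obtain ⟨h0, hDs⟩ := hmain s hs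
    obtain ⟨hr, hf, -⟩ := hR s h0 hDs
    obtain ⟨hn1, hn2⟩ := hnext s h0 hDs
    refine ⟨?_, ?_, hn1, ?_⟩
    · refine (run_succ_congr (hr₁.trans hr.symm) ?_ ?_).symm
      · rw [hr₁]
        exact degIn_congr hm.le (h0₁.of_left h0 hD₁ hDs) hf₁
      · exact degIn_congr hm hs hf₁'
    · rwa [← key_congr hs]
    · rwa [hfull, Finset.card_range] at hn2
  · left
    have hss := Finset.ssubset_iff_subset_ne.2 ⟨hTsub, hfull⟩
    refine ⟨D ∪ T, hss, ?_⟩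
    obtain ⟨p, hp, hpD⟩ := Finset.exists_of_ssubset hss
    obtain ⟨s₁, h0₁, hp₁⟩ :=
      exists_extension (by omega) s₀ (Finset.mem_range.1 hp)
    have hE₁ : Indistinct m (D ∪ T) s₁ s₁ := .self (by omega) (hp₁ ▸ hpD)
    have hD₁ := hE₁.subset (Finset.subset_union_left (s₂ := T))
    obtain ⟨hr₁, hf₁, -⟩ := hR s₁ h0₁ hD₁
    have hf₁' : (W.run (concealerGraph s₁) (n + 1)).2.FactorsThrough (key m (D ∪ T) s₁) := by
      rw [hsucc s₁ hr₁]
      exact refine_factorsThrough_of_touched hm.le hf₁ _ _ hE₁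
    refine ⟨(W.run (concealerGraph s₁) (n + 1)).1, (W.run (concealerGraph s₁) (n + 1)).2, ?_⟩
    intro s h0 hE
    have hDs := hE.subset (Finset.subset_union_left (s₂ := T))
    obtain ⟨hr, hf, -⟩ := hR s h0 hDs
    obtain ⟨hn1, hn2⟩ := hnext s h0 hDs
    refine ⟨?_, ?_, hn1, hn2⟩
    · refine (run_succ_congr (hr₁.trans hr.symm) ?_ ?_).symm
      · rw [hr₁]
        exact degIn_congr hm.le (h0₁.of_left h0 hD₁ hDs) hf₁
      · exact degIn_congr hm.le (h0₁.of_left h0 hE₁ hE) hf₁'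
    · rwa [← key_congr (h0₁.of_left h0 hE₁ hE)]

/-- A strategy that always terminates passes every level, and pays for all its pairs. -/
lemma Confined.succ_level (hm : m + 1 < k) {W : Strategy} {n c : ℕ}
    (hsep : ∀ s : CorrectPairs k, ∃ c π, Reach (concealerGraph s) c π ∧
      ∀ i i', π (x i) = π (x i') → i = i')
    (hW : ∀ s : CorrectPairs k, W.Terminates (concealerGraph s))
    (h : Confined W s₀ m ∅ n c) :
    ∃ (s₁ : CorrectPairs k) (n' : ℕ), Confined W s₁ (m + 1) ∅ n' (c + k * k * 2 ^ (k - 1)) := by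
  classical
  have hpow : 2 ^ m * (k * k * 2 ^ (k - (m + 1))) = k * k * 2 ^ (k - 1) := by
    have : k - 1 = m + (k - (m + 1)) := by omega
    rw [this, pow_add]
    ring
  by_contra hcon
  push Not at hcon
  have hall : ∀ d, ∃ D ⊂ Finset.range (2 ^ m),
      Confined W s₀ m D (n + d) (c + D.card * (k * k * 2 ^ (k - (m + 1)))) := by
    intro d
    induction d with
    | zero =>
      refine ⟨∅, ?_, by simpa using h⟩
      rw [Finset.empty_ssubset]
      exact ⟨0, by simp⟩
    | succ d ih =>
      obtain ⟨D, hD, hc⟩ := ih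
      rcases hc.step hm hsep hD with h | ⟨s₁, h⟩
      · exact h
      · exact absurd (hpow ▸ h) (hcon s₁ _)
  choose N hN using hW
  obtain ⟨D, hD, S, π, hR⟩ := hall (Finset.univ.sup N + 1)
  obtain ⟨p, hp, hpD⟩ := Finset.exists_of_ssubset hD
  obtain ⟨s, hs, hps⟩ := exists_extension (by omega) s₀ (Finset.mem_range.1 hp)
  refine (hR s hs (.self (by omega) (hps ▸ hpD))).2.2.1 (N s) ?_ (hN s)
  have := Finset.le_sup (f := N) (Finset.mem_univ s)
  omega

lemma confined_zero (W : Strategy) (hk : 0 < k) (s₀ : CorrectPairs k) :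
    Confined W s₀ 0 ∅ 0 0 := by
  refine ⟨(W.run (concealerGraph s₀) 0).1, (W.run (concealerGraph s₀) 0).2, fun s hs _ => ?_⟩
  refine ⟨?_, fun _ _ _ => rfl, by simp, Nat.zero_le _⟩
  refine Prod.ext ?_ rfl
  change [partialQuotient _ _] = [partialQuotient _ _]
  rw [partialQuotient_congr
    (degIn_congr (m := 0) hk hs (π := monochromatic _) fun _ _ _ => rfl)]

/-- Every strategy pays on some concealer graph at each of the levels. -/
theorem exists_le_cost (W : Strategy)
    (hsep : ∀ s : CorrectPairs k, ∃ c π, Reach (concealerGraph s) c π ∧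
      ∀ i i', π (x i) = π (x i') → i = i') :
    ∃ s : CorrectPairs k,
      (((k - 1) * (k * k * 2 ^ (k - 1)) : ℕ) : ℕ∞) ≤ W.cost (concealerGraph s) := by
  classical
  rcases Nat.eq_zero_or_pos k with rfl | hk
  · exact ⟨fun l => l.elim0, by simp⟩
  by_cases hW : ∀ s : CorrectPairs k, W.Terminates (concealerGraph s)
  · have hlevel : ∀ m, m + 1 ≤ k → ∃ s₁ n,
        Confined W (k := k) s₁ m ∅ n (m * (k * k * 2 ^ (k - 1))) := by
      intro m
      induction m with
      | zero => exact fun _ => ⟨fun l => ⟨0, by positivity⟩, 0, by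
          simpa using confined_zero W hk _⟩
      | succ m ih =>
        intro hm
        obtain ⟨s₁, n, h⟩ := ih (by omega)
        rw [Nat.succ_mul]
        exact h.succ_level hm hsep hW
    obtain ⟨s₁, n, S, π, hR⟩ := hlevel (k - 1) (by omega)
    obtain ⟨-, -, h3, h4⟩ := hR s₁ ⟨fun _ _ => rfl, by simp⟩ ⟨fun _ _ => rfl, by simp⟩
    exact ⟨s₁, (Nat.cast_le.2 h4).trans (W.le_cost _ h3)⟩
  · push Not at hW
    obtain ⟨s, hs⟩ := hW
    exact ⟨s, by rw [Strategy.cost, dif_neg hs]; exact le_top⟩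

/-- At the first level there is only one pair. Hence there every strategy that always terminates
pays on every concealer graph. -/
theorem le_cost_of_terminates (W : Strategy) (hk : 2 ≤ k)
    (hsep : ∀ s : CorrectPairs k, ∃ c π, Reach (concealerGraph s) c π ∧
      ∀ i i', π (x i) = π (x i') → i = i')
    (hW : ∀ s : CorrectPairs k, W.Terminates (concealerGraph s)) (s : CorrectPairs k) :
    ((k * k * 2 ^ (k - 1) : ℕ) : ℕ∞) ≤ W.cost (concealerGraph s) := by
  obtain ⟨s₁, n, S, π, hR⟩ :=
    (confined_zero W (by omega) s).succ_level (by omega) hsep hW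
  have heq : ∀ l : Fin (k - 1), l.val < 1 → s₁ l = s l := by
    rintro ⟨l, hl'⟩ hl
    obtain rfl : l = 0 := Nat.lt_one_iff.1 hl
    exact Subsingleton.elim (α := Fin 1) _ _
  obtain ⟨-, -, h3, h4⟩ := hR s ⟨heq, by simp⟩ ⟨fun _ _ => rfl, by simp⟩
  rw [zero_add] at h4
  exact (Nat.cast_le.2 h4).trans (W.le_cost _ h3)

end Adversary

/-! ### Saturated sets after a round of color refinement -/

section Rounds

variable {V : Type} {G : SimpleGraph V} {π π' : Coloring V} {A B : Set V}

/-- The vertices with a neighbor in `A`. -/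
def nbrs (G : SimpleGraph V) (A : Set V) : Set V := {v | ∃ u ∈ A, G.Adj u v}

/-- The vertices with exactly one neighbor in `A`. -/
def uniqueNbrs (G : SimpleGraph V) (A : Set V) : Set V := {v | ∃! u, u ∈ A ∧ G.Adj u v}

lemma mem_nbrs_iff [Finite V] {v : V} : v ∈ nbrs G A ↔ degIn G A v ≠ 0 := by
  rw [degIn, Ne, Set.ncard_eq_zero, ← Ne, ← Set.nonempty_iff_ne_empty]
  exact ⟨fun ⟨u, hu, h⟩ => ⟨u, hu, h.symm⟩, fun ⟨u, hu, h⟩ => ⟨u, hu, h.symm⟩⟩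

lemma mem_uniqueNbrs_iff {v : V} : v ∈ uniqueNbrs G A ↔ degIn G A v = 1 := by
  rw [degIn, Set.ncard_eq_one]
  constructor
  · rintro ⟨u, ⟨hu, h⟩, huni⟩
    refine ⟨u, Set.ext fun u' => ⟨fun h' => huni u' ⟨h'.1, h'.2.symm⟩, ?_⟩⟩
    rintro rfl
    exact ⟨hu, h.symm⟩
  · rintro ⟨u, h⟩
    have hu : u ∈ {u | u ∈ A ∧ G.Adj v u} := by rw [h]; rfl
    refine ⟨u, ⟨hu.1, hu.2.symm⟩, fun u' h' => ?_⟩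
    have : u' ∈ {u | u ∈ A ∧ G.Adj v u} := ⟨h'.1, h'.2.symm⟩
    rwa [h] at this

lemma notMem_uniqueNbrs {v u u' : V} (hu : u ∈ A) (hu' : u' ∈ A) (h : G.Adj u v)
    (h' : G.Adj u' v) (hne : u ≠ u') : v ∉ uniqueNbrs G A :=
  fun hv => hne (hv.unique ⟨hu, h⟩ ⟨hu', h'⟩)

lemma Saturated.of_eq {α : Type} {ρ : V → α} (h : Saturated ρ A) (e : A = B) : Saturated ρ B :=
  e ▸ h

/-- The coloring `π'` is at least as fine as the result of a full round of color refinement,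
starting with `π`. -/
structure Round (G : SimpleGraph V) (π π' : Coloring V) : Prop where
  factors : π.FactorsThrough π'
  degIn_eq : ∀ v w, π' v = π' w → ∀ A, Saturated π A → degIn G A v = degIn G A w

namespace Round

lemma mono (h : Round G π π') (hA : Saturated π A) : Saturated π' A := hA.mono h.factors

lemma nbrs [Finite V] (h : Round G π π') (hA : Saturated π A) : Saturated π' (nbrs G A) := by
  intro v w hvw
  rw [mem_nbrs_iff, mem_nbrs_iff, h.degIn_eq v w hvw A hA]
  exact id

lemma uniqueNbrs (h : Round G π π') (hA : Saturated π A) : Saturated π' (uniqueNbrs G A) := by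
  intro v w hvw
  rw [mem_uniqueNbrs_iff, mem_uniqueNbrs_iff, h.degIn_eq v w hvw A hA]
  exact id

lemma degIn (h : Round G π π') (hA : Saturated π A) (n : ℕ) :
    Saturated π' {v | degIn G A v = n} := by
  intro v w hvw hv
  exact (h.degIn_eq v w hvw A hA).symm.trans hv

end Round

lemma Reach.exists_round [Finite V] {c : ℕ} (h : Reach G c π) :
    ∃ π', Reach G (c + (dartsBetween G Set.univ Set.univ).ncard) π' ∧ Round G π π' := by
  obtain ⟨π', h1, h2, h3⟩ := h.round le_rfl
  exact ⟨π', h1, h2, h3⟩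

lemma Reach.split_nbrs [Finite V] {c : ℕ} (h : Reach G c π) (hA : Saturated π A)
    (hB : Saturated π B) {d : ℕ} (hd : edgesBetween G A B ≤ d) :
    ∃ π', Reach G (c + d) π' ∧ π.FactorsThrough π' ∧ Saturated π' (A ∩ nbrs G B) := by
  obtain ⟨π', h1, h2, h3⟩ := h.split hA hB (Nat.add_le_add_left hd c)
  refine ⟨π', h1, h2, fun v w hvw hv => ⟨hA _ _ (h2 hvw) hv.1, ?_⟩⟩
  rw [mem_nbrs_iff, ← h3 v w hvw hv.1, ← mem_nbrs_iff]
  exact hv.2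

lemma Reach.split_uniqueNbrs [Finite V] {c : ℕ} (h : Reach G c π) (hA : Saturated π A)
    (hB : Saturated π B) {d : ℕ} (hd : edgesBetween G A B ≤ d) :
    ∃ π', Reach G (c + d) π' ∧ π.FactorsThrough π' ∧ Saturated π' (A ∩ uniqueNbrs G B) := by
  obtain ⟨π', h1, h2, h3⟩ := h.split hA hB (Nat.add_le_add_left hd c)
  refine ⟨π', h1, h2, fun v w hvw hv => ⟨hA _ _ (h2 hvw) hv.1, ?_⟩⟩
  rw [mem_uniqueNbrs_iff, ← h3 v w hvw hv.1, ← mem_uniqueNbrs_iff]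
  exact hv.2

end Rounds

/-! ### Distinguishing the types of the vertices -/

section Types

open ConcealerVertex

variable {k : ℕ}

/-- The number of the type of a vertex. -/
def tag : ConcealerVertex k → ℕ
  | start _ => 0
  | x _ => 1
  | xx _ _ => 2
  | yy _ _ => 3
  | y _ => 4
  | gIn _ _ => 5
  | innerB _ _ _ => 6
  | innerC _ _ _ => 7
  | uOut _ _ _ => 8
  | gOut _ _ => 9

/-- The vertices of the type number `n`. -/
def layer (k n : ℕ) : Set (ConcealerVertex k) := {v | tag v = n}

/-- The vertices `x i` with `i` in the block number `b` of level `m + 1`. -/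
def xBlock (k m b : ℕ) : Set (ConcealerVertex k) :=
  {v | ∃ i : Fin (2 ^ k), v = x i ∧ i.val / 2 ^ (k - (m + 1)) = b}

/-- The in-vertices of the gadget with index `l`. -/
def gInLevel (k l : ℕ) : Set (ConcealerVertex k) :=
  {v | ∃ (l' : Fin (k - 1)) (q : Fin (2 ^ (l'.val + 1))), v = gIn l' q ∧ l'.val = l}

/-- The coloring distinguishes the types of the vertices, and the levels of the in-vertices. -/
structure Typed (π : Coloring (ConcealerVertex k)) : Prop where
  start : ∀ a, Saturated π {start a}
  layer : ∀ n, 1 ≤ n → n ≤ 9 → Saturated π (layer k n)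
  gIn : ∀ l, Saturated π (gInLevel k l)

lemma Typed.mono {π π' : Coloring (ConcealerVertex k)} (h : Typed π) (hf : π.FactorsThrough π') :
    Typed π' :=
  ⟨fun a => (h.start a).mono hf, fun n h1 h2 => (h.layer n h1 h2).mono hf,
    fun l => (h.gIn l).mono hf⟩

lemma card_block {e b : ℕ} (he : e ≤ k) (hb : b < 2 ^ (k - e)) :
    {i : Fin (2 ^ k) | i.val / 2 ^ e = b}.ncard = 2 ^ e := by
  have hpos : 0 < 2 ^ e := by positivity
  have hk : 2 ^ (k - e) * 2 ^ e = 2 ^ k := by rw [← pow_add, Nat.sub_add_cancel he]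
  have : {i : Fin (2 ^ k) | i.val / 2 ^ e = b} = Set.range fun r : Fin (2 ^ e) =>
      (⟨r.val % 2 ^ e + b * 2 ^ e, (Nat.block_translate_lt hpos hb).trans_eq hk⟩ :
        Fin (2 ^ k)) := by
    ext i
    constructor
    · intro hi
      refine ⟨⟨i.val % 2 ^ e, Nat.mod_lt _ hpos⟩, Fin.ext ?_⟩
      change i.val % 2 ^ e % 2 ^ e + b * 2 ^ e = i.val
      have hi' : i.val / 2 ^ e = b := hi
      rw [Nat.mod_mod, ← hi', Nat.mod_add_div']
    · rintro ⟨r, rfl⟩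
      exact Nat.block_translate_div hpos
  rw [this, ← Set.image_univ, Set.ncard_image_of_injective, Set.ncard_univ, Nat.card_fin]
  intro r r' h
  simp only [Fin.mk.injEq, Nat.add_right_cancel_iff] at h
  rw [Nat.mod_eq_of_lt r.isLt, Nat.mod_eq_of_lt r'.isLt] at h
  exact Fin.ext h

variable (s : CorrectPairs k)

lemma exists_inNumber (l : Fin (k - 1)) (q : Fin (2 ^ (l.val + 1))) :
    ∃ p j, inNumber s l p j = q.val := by
  have h1 := q.isLt
  have h2 := pow_succ 2 l.val
  refine ⟨⟨q.val / 2, by omega⟩, inPartner (⟨q.val / 2, by omega⟩ = s l)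
    ⟨q.val % 2, Nat.mod_lt _ two_pos⟩ 0, ?_⟩
  unfold inNumber inPartner
  split_ifs <;> simp <;> omega

/-- An out-vertex of a gadget has two neighbors in the left half of `X`. -/
lemma exists_two_adj_gOut (hk : 3 ≤ k) (l : Fin (k - 1)) (j : Fin 2) :
    ∃ i i' : Fin (2 ^ k), i ≠ i' ∧ i.val / 2 ^ (k - 1) = 0 ∧ i'.val / 2 ^ (k - 1) = 0 ∧
      (concealerGraph s).Adj (gOut l j) (x i) ∧ (concealerGraph s).Adj (gOut l j) (x i') := by
  obtain ⟨e, he⟩ : ∃ e, e = k - (l.val + 2) := ⟨_, rfl⟩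
  have hpos : 0 < 2 ^ e := by positivity
  have hj := j.isLt
  have hkk : 2 ^ k = 2 * 2 ^ (k - 1) := by rw [← pow_succ', Nat.sub_add_cancel (by omega)]
  have hmain : ∃ i i' : ℕ, i ≠ i' ∧ i < 2 ^ (k - 1) ∧ i' < 2 ^ (k - 1) ∧
      i / 2 ^ e % 2 = j.val ∧ i' / 2 ^ e % 2 = j.val := by
    have hk2 : 2 ^ (k - 1) = 2 ^ (k - 2) * 2 := by
      rw [← pow_succ]; congr 1; omega
    rcases Nat.eq_zero_or_pos e with rfl | he'
    · have h3 : 2 ≤ 2 ^ (k - 2) := by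
        calc 2 = 2 ^ 1 := rfl
          _ ≤ 2 ^ (k - 2) := Nat.pow_le_pow_right two_pos (by omega)
      exact ⟨j, j + 2, by omega, by omega, by omega, by simp; omega, by simp; omega⟩
    · have h1 : 1 < 2 ^ e := Nat.one_lt_two_pow (by omega)
      have h2 : 2 ^ e ≤ 2 ^ (k - 2) := Nat.pow_le_pow_right two_pos (by omega)
      have h3 : j.val * 2 ^ e ≤ 2 ^ e := by nlinarith
      refine ⟨j * 2 ^ e, 1 % 2 ^ e + j * 2 ^ e, ?_, by omega, ?_, ?_, ?_⟩
      · rw [Nat.mod_eq_of_lt h1]; omega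
      · rw [Nat.mod_eq_of_lt h1]; omega
      · rw [Nat.mul_div_cancel _ hpos]; omega
      · rw [Nat.block_translate_div hpos]; omega
  obtain ⟨i, i', hne, hi, hi', hb, hb'⟩ := hmain
  refine ⟨⟨i, by omega⟩, ⟨i', by omega⟩, by simpa using hne, Nat.div_eq_of_lt hi,
    Nat.div_eq_of_lt hi', ?_, ?_⟩
  · exact (adj_gOut s).2 (.inr ⟨_, rfl, by rw [← he]; exact hb⟩)
  · exact (adj_gOut s).2 (.inr ⟨_, rfl, by rw [← he]; exact hb'⟩)

/-- The second and the third start vertex have two neighbors in their half of `X`. -/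
lemma exists_two_half (hk : 2 ≤ k) {a : ℕ} (ha : a < 2) :
    ∃ i i' : Fin (2 ^ k), i ≠ i' ∧ i.val / 2 ^ (k - 1) = a ∧ i'.val / 2 ^ (k - 1) = a := by
  have h1 : 1 < 2 ^ (k - 1) := Nat.one_lt_two_pow (by omega)
  have hkk : 2 ^ k = 2 * 2 ^ (k - 1) := by rw [← pow_succ', Nat.sub_add_cancel (by omega)]
  have hlt : ∀ i, i % 2 ^ (k - 1) + a * 2 ^ (k - 1) < 2 ^ k := fun i =>
    (Nat.block_translate_lt (by omega) ha).trans_eq hkk.symm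
  refine ⟨⟨_, hlt 0⟩, ⟨_, hlt 1⟩, ?_, Nat.block_translate_div (by omega),
    Nat.block_translate_div (by omega)⟩
  simp [Nat.mod_eq_of_lt h1]

lemma uniqueNbrs_univ (hk : 3 ≤ k) :
    uniqueNbrs (concealerGraph s) Set.univ = {start 0} := by
  have two : ∀ {v u u' : ConcealerVertex k}, (concealerGraph s).Adj v u →
      (concealerGraph s).Adj v u' → u ≠ u' → v ∉ uniqueNbrs (concealerGraph s) Set.univ :=
    fun h h' hne => notMem_uniqueNbrs trivial trivial h.symm h'.symm hne
  ext v
  constructor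
  · intro hv
    by_contra hne
    revert hv
    cases v with
    | start a =>
      obtain ⟨i, i', hne', hi, hi'⟩ := exists_two_half (k := k) (by omega) zero_lt_two
      obtain ⟨i₁, i₁', hne₁, hi₁, hi₁'⟩ := exists_two_half (k := k) (by omega) one_lt_two
      fin_cases a
      · exact absurd rfl hne
      · exact two ((adj_start s).2 (.inr (.inr (.inl ⟨rfl, i, rfl, hi⟩))))
          ((adj_start s).2 (.inr (.inr (.inl ⟨rfl, i', rfl, hi'⟩)))) (by simpa using hne')
      · exact two ((adj_start s).2 (.inr (.inr (.inr ⟨rfl, i₁, rfl, hi₁⟩))))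
          ((adj_start s).2 (.inr (.inr (.inr ⟨rfl, i₁', rfl, hi₁'⟩)))) (by simpa using hne₁)
    | x i =>
      exact two ((adj_x s).2 (.inr (.inr (.inl ⟨⟨0, by omega⟩, rfl⟩))))
          ((adj_x s).2 (.inr (.inr (.inl ⟨⟨1, by omega⟩, rfl⟩)))) (by simp)
    | xx i j =>
      exact two ((adj_xx s).2 (.inl rfl)) ((adj_xx s).2 (.inr ⟨j, rfl⟩)) (by simp)
    | yy i j =>
      exact two ((adj_yy s).2 (.inl rfl)) ((adj_yy s).2 (.inr ⟨j, rfl⟩)) (by simp)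
    | y i =>
      exact two ((adj_y s).2 (.inl ⟨⟨0, by omega⟩, rfl⟩))
          ((adj_y s).2 (.inl ⟨⟨1, by omega⟩, rfl⟩)) (by simp)
    | gIn l q =>
      obtain ⟨p, j, h⟩ := exists_inNumber s l q
      have hlt : q.val * 2 ^ (k - (l.val + 1)) < 2 ^ k := by
        calc q.val * 2 ^ (k - (l.val + 1)) < 2 ^ (l.val + 1) * 2 ^ (k - (l.val + 1)) :=
              Nat.mul_lt_mul_of_pos_right q.isLt (by positivity)
          _ = 2 ^ k := by rw [← pow_add, Nat.add_sub_cancel' (by omega)]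
      exact two ((adj_gIn s).2 (.inl ⟨⟨_, hlt⟩, rfl, Nat.mul_div_cancel _ (by positivity)⟩))
          ((adj_gIn s).2 (.inr ⟨p, j, rfl, h⟩)) (by simp)
    | innerB l p j =>
      exact two ((adj_innerB s).2 (.inl rfl))
        ((adj_innerB s).2 (.inr ⟨_, rfl, (upPartner_spec j 0).1⟩)) (by simp)
    | innerC l p t =>
      exact two ((adj_innerC s).2 (.inl ⟨_, rfl, (downPartner_spec t 0).1⟩))
        ((adj_innerC s).2 (.inr ⟨half t, rfl, rfl⟩)) (by simp)
    | uOut l p j =>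
      exact two ((adj_uOut s).2 (.inr rfl))
        ((adj_uOut s).2 (.inl ⟨⟨2 * j.val, by omega⟩, rfl, by simp⟩)) (by simp)
    | gOut l j =>
      obtain ⟨i, i', hne', -, -, h, h'⟩ := exists_two_adj_gOut s hk l j
      exact two h h' (by simpa using hne')
  · rintro rfl
    refine ⟨start 1, ⟨trivial, ((adj_start s).2 (.inl ⟨rfl, rfl⟩)).symm⟩, ?_⟩
    rintro u ⟨-, h⟩
    simpa using (adj_start s).1 h.symm

lemma nbrs_start_zero : nbrs (concealerGraph s) {start 0} = {start 1} := by
  ext v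
  constructor
  · rintro ⟨u, rfl, h⟩
    simpa using (adj_start s).1 h
  · rintro rfl
    exact ⟨_, rfl, (adj_start s).2 (.inl ⟨rfl, rfl⟩)⟩

lemma nbrs_start_one_diff :
    nbrs (concealerGraph s) {start 1} \ {start 0} = xBlock k 0 0 := by
  ext v
  constructor
  · rintro ⟨⟨u, rfl, h⟩, hv⟩
    rcases (adj_start s).1 h with h | h | ⟨-, i, rfl, hi⟩ | h
    · simp at h
    · exact absurd h.2 hv
    · exact ⟨i, rfl, hi⟩
    · simp at h
  · rintro ⟨i, rfl, hi⟩
    exact ⟨⟨_, rfl, (adj_start s).2 (.inr (.inr (.inl ⟨rfl, i, rfl, hi⟩)))⟩, by simp⟩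

lemma gOut_eq (hk : 3 ≤ k) :
    (nbrs (concealerGraph s) (xBlock k 0 0) \ {start 1}) \
      uniqueNbrs (concealerGraph s) (xBlock k 0 0) = layer k 9 := by
  ext v
  constructor
  · rintro ⟨⟨⟨_, ⟨i, rfl, hi⟩, h⟩, hv⟩, hv'⟩
    rcases (adj_x s).1 h with ⟨rfl, -⟩ | ⟨rfl, h⟩ | ⟨j, rfl⟩ | ⟨l, j, rfl, -⟩
    · exact absurd rfl hv
    · rw [zero_add] at hi
      omega
    · refine absurd ⟨x i, ⟨⟨i, rfl, hi⟩, h⟩, ?_⟩ hv'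
      rintro u ⟨⟨i', rfl, hi'⟩, h'⟩
      simpa using (adj_xx s).1 h'.symm
    · rfl
  · intro hv
    cases v <;> simp [layer, tag] at hv
    rename_i l j
    obtain ⟨i, i', hne, hi, hi', h, h'⟩ := exists_two_adj_gOut s hk l j
    exact ⟨⟨⟨x i, ⟨i, rfl, hi⟩, h.symm⟩, by simp⟩,
      notMem_uniqueNbrs ⟨i, rfl, hi⟩ ⟨i', rfl, hi'⟩ h.symm h'.symm (by simpa using hne)⟩

lemma adj_x_gOut (i : Fin (2 ^ k)) (l : Fin (k - 1)) : (concealerGraph s).Adj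
    (gOut l ⟨i.val / 2 ^ (k - (l.val + 2)) % 2, Nat.mod_lt _ two_pos⟩) (x i) :=
  ((adj_x s).2 (.inr (.inr (.inr ⟨l, _, rfl, rfl⟩)))).symm

lemma uOut_eq (hk : 3 ≤ k) :
    uniqueNbrs (concealerGraph s) (layer k 9) = layer k 8 := by
  ext v
  constructor
  · intro hv
    obtain ⟨u, ⟨hu, h⟩, -⟩ := id hv
    cases u <;> simp [layer, tag] at hu
    rcases (adj_gOut s).1 h with ⟨p, rfl⟩ | ⟨i, rfl, -⟩
    · rfl
    · refine absurd hv (notMem_uniqueNbrs ?_ ?_ (adj_x_gOut s i ⟨0, by omega⟩)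
        (adj_x_gOut s i ⟨1, by omega⟩) ?_)
      · rfl
      · rfl
      · simp
  · intro hv
    cases v <;> simp [layer, tag] at hv
    rename_i l p j
    refine ⟨gOut l j, ⟨rfl, ((adj_uOut s).2 (.inr rfl)).symm⟩, ?_⟩
    rintro u ⟨hu, h⟩
    rcases (adj_uOut s).1 h.symm with ⟨t, rfl, -⟩ | rfl
    · simp [layer, tag] at hu
    · rfl

lemma x_eq (hk : 3 ≤ k) :
    nbrs (concealerGraph s) (layer k 9) \ layer k 8 = layer k 1 := by
  ext v
  constructor
  · rintro ⟨⟨u, hu, h⟩, hv⟩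
    cases u <;> simp [layer, tag] at hu
    rcases (adj_gOut s).1 h with ⟨p, rfl⟩ | ⟨i, rfl, -⟩
    · exact absurd rfl hv
    · rfl
  · intro hv
    cases v <;> simp [layer, tag] at hv
    rename_i i
    exact ⟨⟨_, rfl, adj_x_gOut s i ⟨0, by omega⟩⟩, by simp [layer, tag]⟩

lemma xx_eq (hk : 3 ≤ k) :
    uniqueNbrs (concealerGraph s) (layer k 1) = layer k 2 := by
  ext v
  constructor
  · intro hv
    obtain ⟨u, ⟨hu, h⟩, -⟩ := id hv
    cases u <;> simp [layer, tag] at hu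
    rename_i i₀
    rcases (adj_x s).1 h with ⟨rfl, -⟩ | ⟨rfl, h⟩ | ⟨j, rfl⟩ | ⟨l, j, rfl, -⟩
    · obtain ⟨i, i', hne, hi, hi'⟩ := exists_two_half (k := k) (by omega) zero_lt_two
      exact absurd hv (notMem_uniqueNbrs (u := x i) (u' := x i') rfl rfl
        ((adj_start s).2 (.inr (.inr (.inl ⟨rfl, i, rfl, hi⟩)))).symm
        ((adj_start s).2 (.inr (.inr (.inl ⟨rfl, i', rfl, hi'⟩)))).symm (by simpa using hne))
    · obtain ⟨i, i', hne, hi, hi'⟩ := exists_two_half (k := k) (by omega) one_lt_two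
      exact absurd hv (notMem_uniqueNbrs (u := x i) (u' := x i') rfl rfl
        ((adj_start s).2 (.inr (.inr (.inr ⟨rfl, i, rfl, hi⟩)))).symm
        ((adj_start s).2 (.inr (.inr (.inr ⟨rfl, i', rfl, hi'⟩)))).symm (by simpa using hne))
    · rfl
    · obtain ⟨i, i', hne, -, -, h, h'⟩ := exists_two_adj_gOut s hk l j
      exact absurd hv (notMem_uniqueNbrs (u := x i) (u' := x i') rfl rfl h.symm h'.symm
        (by simpa using hne))
  · intro hv
    cases v <;> simp [layer, tag] at hv
    rename_i i j
    refine ⟨x i, ⟨rfl, ((adj_xx s).2 (.inl rfl)).symm⟩, ?_⟩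
    rintro u ⟨hu, h⟩
    rcases (adj_xx s).1 h.symm with rfl | ⟨t, rfl⟩
    · rfl
    · simp [layer, tag] at hu

lemma start_two_eq (hk : 3 ≤ k) :
    ((nbrs (concealerGraph s) (layer k 1) \ {start 1}) \ layer k 9) \ layer k 2 = {start 2} := by
  ext v
  constructor
  · rintro ⟨⟨⟨⟨u, hu, h⟩, h1⟩, h2⟩, h3⟩
    cases u <;> simp [layer, tag] at hu
    rcases (adj_x s).1 h with ⟨rfl, -⟩ | ⟨rfl, h⟩ | ⟨j, rfl⟩ | ⟨l, j, rfl, -⟩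
    · exact absurd rfl h1
    · rfl
    · exact absurd rfl h3
    · exact absurd rfl h2
  · rintro rfl
    obtain ⟨i, i', hne, hi, hi'⟩ := exists_two_half (k := k) (by omega) one_lt_two
    exact ⟨⟨⟨⟨x i, rfl, ((adj_start s).2 (.inr (.inr (.inr ⟨rfl, i, rfl, hi⟩)))).symm⟩, by simp⟩,
      by simp [layer, tag]⟩, by simp [layer, tag]⟩

lemma innerC_eq : nbrs (concealerGraph s) (layer k 8) \ layer k 9 = layer k 7 := by
  ext v
  constructor
  · rintro ⟨⟨u, hu, h⟩, h1⟩
    cases u <;> simp [layer, tag] at hu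
    rcases (adj_uOut s).1 h with ⟨t, rfl, -⟩ | rfl
    · rfl
    · exact absurd rfl h1
  · intro hv
    cases v <;> simp [layer, tag] at hv
    exact ⟨⟨_, rfl, ((adj_innerC s).2 (.inr ⟨half _, rfl, rfl⟩)).symm⟩, by simp [layer, tag]⟩

lemma yy_eq : nbrs (concealerGraph s) (layer k 2) \ layer k 1 = layer k 3 := by
  ext v
  constructor
  · rintro ⟨⟨u, hu, h⟩, h1⟩
    cases u <;> simp [layer, tag] at hu
    rcases (adj_xx s).1 h with rfl | ⟨t, rfl⟩
    · exact absurd rfl h1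
    · rfl
  · intro hv
    cases v <;> simp [layer, tag] at hv
    rename_i i j
    exact ⟨⟨xx i j, rfl, ((adj_yy s).2 (.inr ⟨j, rfl⟩)).symm⟩, by simp [layer, tag]⟩

lemma innerB_eq : nbrs (concealerGraph s) (layer k 7) \ layer k 8 = layer k 6 := by
  ext v
  constructor
  · rintro ⟨⟨u, hu, h⟩, h1⟩
    cases u <;> simp [layer, tag] at hu
    rcases (adj_innerC s).1 h with ⟨t, rfl, -⟩ | ⟨j, rfl, -⟩
    · rfl
    · exact absurd rfl h1
  · intro hv
    cases v <;> simp [layer, tag] at hv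
    exact ⟨⟨_, rfl, ((adj_innerB s).2 (.inr ⟨_, rfl, (upPartner_spec _ 0).1⟩)).symm⟩,
      by simp [layer, tag]⟩

lemma y_eq (hk : 3 ≤ k) : nbrs (concealerGraph s) (layer k 3) \ layer k 2 = layer k 4 := by
  ext v
  constructor
  · rintro ⟨⟨u, hu, h⟩, h1⟩
    cases u <;> simp [layer, tag] at hu
    rcases (adj_yy s).1 h with rfl | ⟨t, rfl⟩
    · rfl
    · exact absurd rfl h1
  · intro hv
    cases v <;> simp [layer, tag] at hv
    exact ⟨⟨_, rfl, ((adj_y s).2 (.inl ⟨⟨0, by omega⟩, rfl⟩)).symm⟩, by simp [layer, tag]⟩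

lemma gIn_eq : nbrs (concealerGraph s) (layer k 6) \ layer k 7 = layer k 5 := by
  ext v
  constructor
  · rintro ⟨⟨u, hu, h⟩, h1⟩
    cases u <;> simp [layer, tag] at hu
    rcases (adj_innerB s).1 h with rfl | ⟨t, rfl, -⟩
    · rfl
    · exact absurd rfl h1
  · intro hv
    cases v <;> simp [layer, tag] at hv
    rename_i l q
    obtain ⟨p, j, h⟩ := exists_inNumber s l q
    exact ⟨⟨_, rfl, ((adj_gIn s).2 (.inr ⟨p, j, rfl, h⟩)).symm⟩, by simp [layer, tag]⟩

lemma degIn_gIn (l : Fin (k - 1)) (q : Fin (2 ^ (l.val + 1))) :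
    degIn (concealerGraph s) (layer k 4) (gIn l q) = 2 ^ (k - (l.val + 1)) := by
  have : {u | u ∈ layer k 4 ∧ (concealerGraph s).Adj (gIn l q) u} =
      y '' {i : Fin (2 ^ k) | i.val / 2 ^ (k - (l.val + 1)) = q.val} := by
    ext u
    constructor
    · rintro ⟨hu, h⟩
      rcases (adj_gIn s).1 h with ⟨i, rfl, hi⟩ | ⟨p, j, rfl, -⟩
      · exact ⟨i, hi, rfl⟩
      · simp [layer, tag] at hu
    · rintro ⟨i, hi, rfl⟩
      exact ⟨rfl, (adj_gIn s).2 (.inl ⟨i, rfl, hi⟩)⟩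
  rw [degIn, this, Set.ncard_image_of_injective _ (fun i i' h => by simpa using h)]
  refine card_block (by omega) ?_
  rw [show k - (k - (l.val + 1)) = l.val + 1 by omega]
  exact q.isLt

lemma gInLevel_eq (l : ℕ) (hl : l < k - 1) :
    layer k 5 ∩ {v | degIn (concealerGraph s) (layer k 4) v = 2 ^ (k - (l + 1))} =
      gInLevel k l := by
  ext v
  constructor
  · rintro ⟨hv, hd⟩
    cases v <;> simp [layer, tag] at hv
    rename_i l' q
    have hd' : degIn (concealerGraph s) (layer k 4) (gIn l' q) = 2 ^ (k - (l + 1)) := hd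
    rw [degIn_gIn] at hd'
    have := Nat.pow_right_injective le_rfl hd'
    exact ⟨l', q, rfl, by omega⟩
  · rintro ⟨l', q, rfl, rfl⟩
    exact ⟨rfl, degIn_gIn s l' q⟩

/-- The number of the ordered pairs of adjacent vertices. -/
def dartCount : ℕ := (dartsBetween (concealerGraph s) Set.univ Set.univ).ncard

/-- A constant number of rounds suffices to distinguish the types of the vertices: starting with
the only vertex of degree one, one type after the other is found as the neighborhood of those
found before. -/
lemma exists_typed (hk : 3 ≤ k) :
    ∃ π, Reach (concealerGraph s) (9 * dartCount s) π ∧ Typed π ∧ Saturated π (xBlock k 0 0) := by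
  obtain ⟨π₁, r₁, d₁⟩ := (Reach.init (G := concealerGraph s)).exists_round
  have s0 := (d₁.uniqueNbrs Saturated.univ).of_eq (uniqueNbrs_univ s hk)
  obtain ⟨π₂, r₂, d₂⟩ := r₁.exists_round
  have s1 := (d₂.nbrs s0).of_eq (nbrs_start_zero s)
  replace s0 := d₂.mono s0
  obtain ⟨π₃, r₃, d₃⟩ := r₂.exists_round
  have xl := ((d₃.nbrs s1).diff (d₃.mono s0)).of_eq (nbrs_start_one_diff s)
  replace s0 := d₃.mono s0
  replace s1 := d₃.mono s1
  obtain ⟨π₄, r₄, d₄⟩ := r₃.exists_round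
  have l9 := (((d₄.nbrs xl).diff (d₄.mono s1)).diff (d₄.uniqueNbrs xl)).of_eq (gOut_eq s hk)
  replace s0 := d₄.mono s0
  replace s1 := d₄.mono s1
  replace xl := d₄.mono xl
  obtain ⟨π₅, r₅, d₅⟩ := r₄.exists_round
  have l8 := (d₅.uniqueNbrs l9).of_eq (uOut_eq s hk)
  have l1 := ((d₅.nbrs l9).diff l8).of_eq (x_eq s hk)
  replace s0 := d₅.mono s0
  replace s1 := d₅.mono s1
  replace xl := d₅.mono xl
  replace l9 := d₅.mono l9
  obtain ⟨π₆, r₆, d₆⟩ := r₅.exists_round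
  have l2 := (d₆.uniqueNbrs l1).of_eq (xx_eq s hk)
  have s2 := ((((d₆.nbrs l1).diff (d₆.mono s1)).diff (d₆.mono l9)).diff l2).of_eq
    (start_two_eq s hk)
  have l7 := ((d₆.nbrs l8).diff (d₆.mono l9)).of_eq (innerC_eq s)
  obtain ⟨π₇, r₇, d₇⟩ := r₆.exists_round
  have l3 := ((d₇.nbrs l2).diff (d₇.mono (d₆.mono l1))).of_eq (yy_eq s)
  have l6 := ((d₇.nbrs l7).diff (d₇.mono (d₆.mono l8))).of_eq (innerB_eq s)
  obtain ⟨π₈, r₈, d₈⟩ := r₇.exists_round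
  have l4 := ((d₈.nbrs l3).diff (d₈.mono (d₇.mono l2))).of_eq (y_eq s hk)
  have l5 := ((d₈.nbrs l6).diff (d₈.mono (d₇.mono l7))).of_eq (gIn_eq s)
  obtain ⟨π₉, r₉, d₉⟩ := r₈.exists_round
  have m6 : ∀ {A}, Saturated π₆ A → Saturated π₉ A := fun h => d₉.mono (d₈.mono (d₇.mono h))
  refine ⟨π₉, ?_, ⟨?_, ?_, ?_⟩, m6 (d₆.mono xl)⟩
  · convert r₉ using 1
    unfold dartCount
    ring
  · intro a
    fin_cases a
    · exact m6 (d₆.mono s0)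
    · exact m6 (d₆.mono s1)
    · exact m6 s2
  · intro n h1 h9
    interval_cases n
    · exact m6 (d₆.mono l1)
    · exact m6 l2
    · exact d₉.mono (d₈.mono l3)
    · exact d₉.mono l4
    · exact d₉.mono l5
    · exact d₉.mono (d₈.mono l6)
    · exact m6 l7
    · exact m6 (d₆.mono l8)
    · exact m6 (d₆.mono l9)
  · intro l
    by_cases hl : l < k - 1
    · exact ((d₉.mono l5).inter (d₉.degIn l4 _)).of_eq (gInLevel_eq s l hl)
    · have : gInLevel k l = ∅ := by
        ext v
        simp only [Set.mem_empty_iff_false, iff_false]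
        rintro ⟨l', q, rfl, rfl⟩
        exact hl l'.isLt
      rw [this]
      exact fun _ _ _ h => h

end Types

/-! ### Passing one level -/

section Levels

open ConcealerVertex

variable {k : ℕ} (s : CorrectPairs k)

/-- The edges of a step that only involves, for the indices `i` of one block of level `m + 1`, at
most `k * k` edges each. -/
lemma edgesBetween_le_block {m b : ℕ} (hm : m + 1 ≤ k) (hb : b < 2 ^ (m + 1))
    {A B : Set (ConcealerVertex k)}
    (f : Fin (2 ^ k) → Fin k → Fin k → ConcealerVertex k × ConcealerVertex k)
    (h : ∀ v w, v ∈ A → w ∈ B → (concealerGraph s).Adj v w →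
      ∃ i j t, i.val / 2 ^ (k - (m + 1)) = b ∧ f i j t = (v, w)) :
    edgesBetween (concealerGraph s) A B ≤ k * k * 2 ^ (k - (m + 1)) := by
  refine (edgesBetween_le_darts _ _ _).trans ?_
  have hsub : dartsBetween (concealerGraph s) A B ⊆
      (fun a : Fin (2 ^ k) × Fin k × Fin k => f a.1 a.2.1 a.2.2) ''
        ({i : Fin (2 ^ k) | i.val / 2 ^ (k - (m + 1)) = b} ×ˢ
          (Set.univ : Set (Fin k × Fin k))) := by
    rintro ⟨v, w⟩ ⟨hv, hw, hvw⟩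
    obtain ⟨i, j, t, hi, hf⟩ := h v w hv hw hvw
    exact ⟨(i, j, t), ⟨hi, trivial⟩, hf⟩
  refine (Set.ncard_le_ncard hsub (Set.toFinite _)).trans
    ((Set.ncard_image_le (Set.toFinite _)).trans ?_)
  rw [Set.ncard_prod, card_block (by omega), Set.ncard_univ, Nat.card_prod, Nat.card_fin, mul_comm]
  rwa [show k - (k - (m + 1)) = m + 1 by omega]

lemma edgesBetween_le_card_mul {V : Type} [Finite V] (G : SimpleGraph V) (A : Set V) {B : Set V}
    {n : ℕ} (hB : B.ncard ≤ n) : edgesBetween G A B ≤ Nat.card V * n := by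
  refine (edgesBetween_le_mul G A B).trans (Nat.mul_le_mul ?_ hB)
  rw [← Set.ncard_univ]
  exact Set.ncard_le_ncard (Set.subset_univ _) (Set.toFinite _)

lemma ncard_le_four {V : Type} {B : Set V} (f : Fin 4 → V) (h : ∀ v ∈ B, ∃ j, f j = v) :
    B.ncard ≤ 4 := by
  calc B.ncard ≤ (f '' Set.univ).ncard :=
        Set.ncard_le_ncard (fun v hv => by simpa using h v hv) (Set.toFinite _)
    _ ≤ 4 := (Set.ncard_image_le (Set.toFinite _)).trans (by simp)

/-- An optimal way to split the blocks of level `m + 1` of `X`: only the first block of the correct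
pair of the gadget of level `m + 1` is propagated, through the gadget back to `X`. -/
lemma exists_level_step {m : ℕ} (hm : m + 1 < k) {c : ℕ} {π : Coloring (ConcealerVertex k)}
    (hr : Reach (concealerGraph s) c π) (ht : Typed π) (hb : ∀ b, Saturated π (xBlock k m b)) :
    ∃ π', Reach (concealerGraph s)
        (c + 4 * (k * k * 2 ^ (k - (m + 1))) + 11 * Nat.card (ConcealerVertex k)) π' ∧
      π.FactorsThrough π' ∧ (∀ b, Saturated π' (xBlock k (m + 1) b)) ∧
      ∀ h : m < k - 1, Saturated π' {gOut ⟨m, h⟩ 0} := by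
  have hml : m < k - 1 := by omega
  obtain ⟨L, hL⟩ : ∃ L : Fin (k - 1), L.val = m := ⟨⟨m, hml⟩, rfl⟩
  obtain ⟨p, hp⟩ : ∃ p, p = s L := ⟨_, rfl⟩
  have hq : 2 * p.val < 2 ^ (L.val + 1) := by
    have := p.isLt
    rw [pow_succ]
    omega
  subst hL
  set e := k - (L.val + 1) with he
  set N := Nat.card (ConcealerVertex k)
  have k0 : 0 < k := by omega
  -- the neighbors of the block in the layers between `X` and the gadget
  obtain ⟨π₁, r₁, f₁, h₁⟩ := hr.split_nbrs (ht.layer 2 (by simp) (by simp)) (hb (2 * p.val))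
    (edgesBetween_le_block s hm.le hq (fun i j _ => (xx i j, x i)) (by
      rintro v _ hv ⟨i, rfl, hi⟩ h
      cases v <;> simp [layer, tag] at hv
      rename_i i' j
      rcases (adj_xx s).1 h with h | ⟨t, h⟩ <;> simp at h
      subst h
      exact ⟨i, j, j, hi, rfl⟩))
  replace h₁ : Saturated π₁ {v | ∃ i j, v = xx i j ∧ i.val / 2 ^ e = 2 * p.val} := h₁.of_eq (by
    ext v
    constructor
    · rintro ⟨hv, _, ⟨i, rfl, hi⟩, h⟩
      cases v <;> simp [layer, tag] at hv
      rename_i i' j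
      rcases (adj_xx s).1 h.symm with h | ⟨t, h⟩ <;> simp at h
      subst h
      exact ⟨i, j, rfl, hi⟩
    · rintro ⟨i, j, rfl, hi⟩
      exact ⟨rfl, x i, ⟨i, rfl, hi⟩, ((adj_xx s).2 (.inl rfl)).symm⟩)
  have ht₁ := ht.mono f₁
  obtain ⟨π₂, r₂, f₂, h₂⟩ := r₁.split_nbrs (ht₁.layer 3 (by simp) (by simp)) h₁
    (edgesBetween_le_block s hm.le hq (fun i j t => (yy i j, xx i t)) (by
      rintro v _ hv ⟨i, t, rfl, hi⟩ h
      cases v <;> simp [layer, tag] at hv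
      rename_i i' j
      rcases (adj_yy s).1 h with h | ⟨t', h⟩ <;> simp at h
      obtain ⟨rfl, rfl⟩ := h
      exact ⟨i, j, t, hi, rfl⟩))
  replace h₂ : Saturated π₂ {v | ∃ i j, v = yy i j ∧ i.val / 2 ^ e = 2 * p.val} := h₂.of_eq (by
    ext v
    constructor
    · rintro ⟨hv, _, ⟨i, t, rfl, hi⟩, h⟩
      cases v <;> simp [layer, tag] at hv
      rename_i i' j
      rcases (adj_yy s).1 h.symm with h | ⟨t', h⟩ <;> simp at h
      obtain ⟨rfl, rfl⟩ := h
      exact ⟨i, j, rfl, hi⟩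
    · rintro ⟨i, j, rfl, hi⟩
      exact ⟨rfl, xx i j, ⟨i, j, rfl, hi⟩, ((adj_yy s).2 (.inr ⟨j, rfl⟩)).symm⟩)
  have ht₂ := ht₁.mono f₂
  obtain ⟨π₃, r₃, f₃, h₃⟩ := r₂.split_nbrs (ht₂.layer 4 (by simp) (by simp)) h₂
    (edgesBetween_le_block s hm.le hq (fun i j _ => (y i, yy i j)) (by
      rintro v _ hv ⟨i, t, rfl, hi⟩ h
      cases v <;> simp [layer, tag] at hv
      rename_i i'
      rcases (adj_y s).1 h with ⟨t', h⟩ | ⟨l, q, h, -⟩ <;> simp at h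
      obtain ⟨rfl, rfl⟩ := h
      exact ⟨i, t, t, hi, rfl⟩))
  replace h₃ : Saturated π₃ {v | ∃ i, v = y i ∧ i.val / 2 ^ e = 2 * p.val} := h₃.of_eq (by
    ext v
    constructor
    · rintro ⟨hv, _, ⟨i, t, rfl, hi⟩, h⟩
      cases v <;> simp [layer, tag] at hv
      rename_i i'
      rcases (adj_y s).1 h.symm with ⟨t', h⟩ | ⟨l, q, h, -⟩ <;> simp at h
      obtain ⟨rfl, rfl⟩ := h
      exact ⟨i, rfl, hi⟩
    · rintro ⟨i, rfl, hi⟩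
      exact ⟨rfl, yy i ⟨0, k0⟩, ⟨i, _, rfl, hi⟩, ((adj_y s).2 (.inl ⟨_, rfl⟩)).symm⟩)
  have ht₃ := ht₂.mono f₃
  obtain ⟨π₄, r₄, f₄, h₄⟩ := r₃.split_nbrs (ht₃.gIn L.val) h₃
    (edgesBetween_le_block s hm.le hq
      (fun i _ _ =>
        (gIn L ⟨i.val / 2 ^ (k - (L.val + 1)), Nat.div_two_pow_lt i.isLt hm.le⟩, y i)) (by
      rintro _ _ ⟨l, q, rfl, hl⟩ ⟨i, rfl, hi⟩ h
      obtain rfl := Fin.ext hl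
      rcases (adj_gIn s).1 h with ⟨i', h, hi'⟩ | ⟨p, j, h, -⟩ <;> simp at h
      subst h
      exact ⟨i, ⟨0, k0⟩, ⟨0, k0⟩, hi, by simp [hi']⟩))
  replace h₄ : Saturated π₄ {gIn L ⟨2 * p.val, hq⟩} := h₄.of_eq (by
    ext v
    constructor
    · rintro ⟨⟨l, q, rfl, hl⟩, _, ⟨i, rfl, hi⟩, h⟩
      obtain rfl := Fin.ext hl
      rcases (adj_gIn s).1 h.symm with ⟨i', h, hi'⟩ | ⟨p, j, h, -⟩ <;> simp at h
      subst h
      rw [Set.mem_singleton_iff]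
      congr
      exact Fin.ext (hi'.symm.trans hi)
    · rintro rfl
      have hlt : 2 * p.val * 2 ^ e < 2 ^ k := by
        calc 2 * p.val * 2 ^ e < 2 ^ (L.val + 1) * 2 ^ e :=
              Nat.mul_lt_mul_of_pos_right hq (by positivity)
          _ = 2 ^ k := by rw [← pow_add, he, Nat.add_sub_cancel' (by omega)]
      have hdiv : 2 * p.val * 2 ^ e / 2 ^ e = 2 * p.val := Nat.mul_div_cancel _ (by positivity)
      exact ⟨⟨L, _, rfl, rfl⟩, y ⟨_, hlt⟩, ⟨_, rfl, hdiv⟩,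
        ((adj_gIn s).2 (.inl ⟨_, rfl, hdiv⟩)).symm⟩)
  have ht₄ := ht₃.mono f₄
  -- through the correct gadget
  have hin : ∀ j : Fin 4, inNumber s L p j = 2 * p.val + j.val % 2 := by
    intro j
    rw [inNumber, if_pos hp]
  obtain ⟨π₅, r₅, f₅, h₅⟩ := r₄.split_nbrs (ht₄.layer 6 (by simp) (by simp)) h₄
    (edgesBetween_le_card_mul _ _ (n := 1) (by simp))
  replace h₅ : Saturated π₅ {v | ∃ j, v = innerB L p j ∧ j.val % 2 = 0} := h₅.of_eq (by
    ext v
    constructor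
    · rintro ⟨hv, _, rfl, h⟩
      cases v <;> simp [layer, tag] at hv
      rcases (adj_gIn s).1 h with ⟨i', h, hi'⟩ | ⟨p', j, h, hj⟩
      · simp at h
      · rw [h]
        have hj' : inNumber s L p' j = 2 * p.val := hj
        have hpp : p' = p := Fin.ext (by rw [← inNumber_div s L p' j, hj']; omega)
        subst hpp
        rw [hin] at hj'
        exact ⟨j, rfl, by omega⟩
    · rintro ⟨j, rfl, hj⟩
      exact ⟨rfl, _, rfl, (adj_gIn s).2 (.inr ⟨p, j, rfl, by rw [hin, hj, add_zero]⟩)⟩)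
  have ht₅ := ht₄.mono f₅
  obtain ⟨π₆, r₆, f₆, h₆⟩ := r₅.split_uniqueNbrs (ht₅.layer 7 (by simp) (by simp)) h₅
    (edgesBetween_le_card_mul _ _ (ncard_le_four (innerB L p) (by
      rintro _ ⟨j, rfl, -⟩
      exact ⟨j, rfl⟩)))
  replace h₆ : Saturated π₆ {v | ∃ t, v = innerC L p t ∧ t.val / 2 = 0} := h₆.of_eq (by
    ext v
    constructor
    · rintro ⟨hv, u, ⟨⟨j, rfl, hj⟩, h⟩, huni⟩
      rcases (adj_innerB s).1 h with rfl | ⟨t, rfl, ht⟩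
      · simp [layer, tag] at hv
      · refine ⟨t, rfl, ?_⟩
        by_contra htne
        -- `c_2` is adjacent to both `β_0` and `β_2`, and `c_3` to none of them
        have h2 : ∀ j t : Fin 4, (j, t) ∈ cfiEdges → j.val % 2 = 0 → ¬ t.val / 2 = 0 →
            (j + 2, t) ∈ cfiEdges ∧ (j + 2).val % 2 = 0 ∧ j + 2 ≠ j := by decide
        obtain ⟨h3, h4, h5⟩ := h2 j t ht hj htne
        have := huni _ ⟨⟨j + 2, rfl, h4⟩, (adj_innerB s).2 (.inr ⟨t, rfl, h3⟩)⟩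
        simp only [innerB.injEq, heq_eq_eq, true_and] at this
        exact h5 this
    · rintro ⟨t, rfl, ht⟩
      have h2 : ∀ t : Fin 4, t.val / 2 = 0 → ∃ j : Fin 4, (j, t) ∈ cfiEdges ∧ j.val % 2 = 0 ∧
          ∀ j' : Fin 4, (j', t) ∈ cfiEdges → j'.val % 2 = 0 → j' = j := by decide
      obtain ⟨j, h3, h4, h5⟩ := h2 t ht
      refine ⟨rfl, innerB L p j, ⟨⟨j, rfl, h4⟩, (adj_innerB s).2 (.inr ⟨t, rfl, h3⟩)⟩, ?_⟩
      rintro _ ⟨⟨j', rfl, hj'⟩, h⟩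
      rcases (adj_innerB s).1 h with h | ⟨t', h, ht'⟩
      · simp at h
      · simp only [innerC.injEq, heq_eq_eq, true_and] at h
        subst h
        rw [h5 j' ht' hj'])
  have ht₆ := ht₅.mono f₆
  obtain ⟨π₇, r₇, f₇, h₇⟩ := r₆.split_nbrs (ht₆.layer 8 (by simp) (by simp)) h₆
    (edgesBetween_le_card_mul _ _ (ncard_le_four (innerC L p) (by
      rintro _ ⟨j, rfl, -⟩
      exact ⟨j, rfl⟩)))
  replace h₇ : Saturated π₇ {uOut L p 0} := h₇.of_eq (by
    ext v
    constructor
    · rintro ⟨hv, _, ⟨t, rfl, ht⟩, h⟩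
      rcases (adj_innerC s).1 h with ⟨j, rfl, -⟩ | ⟨j, rfl, hj⟩
      · simp [layer, tag] at hv
      · rw [Set.mem_singleton_iff]
        congr
        exact Fin.ext (hj.symm.trans ht)
    · rintro rfl
      exact ⟨rfl, innerC L p 0, ⟨0, rfl, rfl⟩, (adj_innerC s).2 (.inr ⟨0, rfl, rfl⟩)⟩)
  have ht₇ := ht₆.mono f₇
  obtain ⟨π₈, r₈, f₈, h₈⟩ := r₇.split_nbrs (ht₇.layer 9 (by simp) (by simp)) h₇
    (edgesBetween_le_card_mul _ _ (n := 1) (by simp))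
  replace h₈ : Saturated π₈ {gOut L 0} := h₈.of_eq (by
    ext v
    constructor
    · rintro ⟨hv, _, rfl, h⟩
      rcases (adj_uOut s).1 h with ⟨t, rfl, -⟩ | rfl
      · simp [layer, tag] at hv
      · rfl
    · rintro rfl
      exact ⟨rfl, _, rfl, (adj_uOut s).2 (.inr rfl)⟩)
  have ht₈ := ht₇.mono f₈
  -- back to `X`
  obtain ⟨π₉, r₉, f₉, h₉⟩ := r₈.split_nbrs (ht₈.layer 1 (by simp) (by simp)) h₈
    (edgesBetween_le_card_mul _ _ (n := 1) (by simp))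
  replace h₉ : Saturated π₉ {v | ∃ i, v = x i ∧ i.val / 2 ^ (k - (L.val + 2)) % 2 = 0} :=
    h₉.of_eq (by
    ext v
    constructor
    · rintro ⟨hv, _, rfl, h⟩
      rcases (adj_gOut s).1 h with ⟨t, rfl⟩ | ⟨i, rfl, hi⟩
      · simp [layer, tag] at hv
      · exact ⟨i, rfl, hi⟩
    · rintro ⟨i, rfl, hi⟩
      exact ⟨rfl, _, rfl, (adj_gOut s).2 (.inr ⟨i, rfl, hi⟩)⟩)
  have hf : π.FactorsThrough π₉ := fun v w h =>
    f₁ (f₂ (f₃ (f₄ (f₅ (f₆ (f₇ (f₈ (f₉ h))))))))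
  refine ⟨π₉, ?_, hf, fun b => ?_, fun _ => h₈.mono f₉⟩
  · convert r₉ using 1
    ring
  · have hdiv : ∀ i : ℕ, i / 2 ^ (k - (L.val + 1)) = i / 2 ^ (k - (L.val + 1 + 1)) / 2 := by
      intro i
      rw [Nat.div_div_eq_div_mul, ← pow_succ]
      congr 2
      omega
    have hbb := (hb (b / 2)).mono hf
    by_cases hb2 : b % 2 = 0
    · refine (hbb.inter h₉).of_eq ?_
      ext v
      constructor
      · rintro ⟨⟨i, rfl, hi⟩, i', hi', hi2⟩
        obtain rfl : i = i' := by simpa using hi'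
        refine ⟨i, rfl, ?_⟩
        rw [hdiv] at hi
        rw [show k - (L.val + 2) = k - (L.val + 1 + 1) from rfl] at hi2
        omega
      · rintro ⟨i, rfl, hi⟩
        refine ⟨⟨i, rfl, by rw [hdiv, hi]⟩, i, rfl, ?_⟩
        rw [show k - (L.val + 2) = k - (L.val + 1 + 1) from rfl, hi, hb2]
    · refine (hbb.diff h₉).of_eq ?_
      ext v
      constructor
      · rintro ⟨⟨i, rfl, hi⟩, hn⟩
        refine ⟨i, rfl, ?_⟩
        have hi2 : ¬ i.val / 2 ^ (k - (L.val + 1 + 1)) % 2 = 0 := fun h => hn ⟨i, rfl, h⟩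
        rw [hdiv] at hi
        omega
      · rintro ⟨i, rfl, hi⟩
        refine ⟨⟨i, rfl, by rw [hdiv, hi]⟩, ?_⟩
        rintro ⟨i', hi', hi2⟩
        obtain rfl : i = i' := by simpa using hi'
        rw [show k - (L.val + 2) = k - (L.val + 1 + 1) from rfl, hi] at hi2
        exact hb2 hi2

/-- The cost of the first `m` levels; the main terms `4 * (k * k * 2 ^ (k - (m' + 1)))` form a
geometric series. -/
lemma exists_levels (hk : 3 ≤ k) (m : ℕ) (hm : m + 1 ≤ k) :
    ∃ c π, Reach (concealerGraph s) c π ∧ Typed π ∧ (∀ b, Saturated π (xBlock k m b)) ∧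
      (∀ l : Fin (k - 1), l.val < m → Saturated π {gOut l 0}) ∧
      c + 4 * (k * k * 2 ^ (k - m)) ≤
        9 * dartCount s + 4 * (k * k * 2 ^ k) + m * (11 * Nat.card (ConcealerVertex k)) := by
  induction m with
  | zero =>
    obtain ⟨π, hr, ht, hx⟩ := exists_typed s hk
    refine ⟨_, π, hr, ht, fun b => ?_, by simp, by simp⟩
    have hlt : ∀ i : Fin (2 ^ k), i.val / 2 ^ (k - (0 + 1)) < 2 := fun i =>
      Nat.div_two_pow_lt i.isLt (by omega)
    rcases Nat.lt_or_ge b 2 with hb | hb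
    · interval_cases b
      · exact hx
      · refine ((ht.layer 1 le_rfl (by simp)).diff hx).of_eq ?_
        ext v
        constructor
        · rintro ⟨hv, hv'⟩
          cases v <;> simp [layer, tag] at hv
          rename_i i
          have h1 := Nat.pos_of_ne_zero fun h => hv' ⟨i, rfl, h⟩
          have h2 := hlt i
          exact ⟨i, rfl, by omega⟩
        · rintro ⟨i, rfl, hi⟩
          refine ⟨rfl, ?_⟩
          rintro ⟨i', hi', hi0⟩
          obtain rfl : i = i' := by simpa using hi'
          omega
    · rintro v w - ⟨i, rfl, hi⟩
      have := hlt i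
      omega
  | succ m ih =>
    obtain ⟨c, π, hr, ht, hb, hg, hc⟩ := ih (by omega)
    obtain ⟨π', hr', hf, hb', hg'⟩ := exists_level_step s hm hr ht hb
    refine ⟨_, π', hr', ht.mono hf, hb', ?_, ?_⟩
    · intro l hl
      rcases Nat.lt_succ_iff_lt_or_eq.1 hl with hl | rfl
      · exact (hg l hl).mono hf
      · exact hg' l.isLt
    · have hpow : k * k * 2 ^ (k - m) = 2 * (k * k * 2 ^ (k - (m + 1))) := by
        rw [show k - m = k - (m + 1) + 1 by omega, pow_succ]
        ring
      rw [hpow] at hc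
      linarith

end Levels

/-! ### The stable coloring -/

section Final

open ConcealerVertex

variable {k : ℕ} (s : CorrectPairs k)

lemma yKey_last (hk : 1 ≤ k) (i : Fin (2 ^ k)) :
    yKey k (k - 1) (Finset.range (2 ^ (k - 1))) i = i := by
  have h1 : 2 ^ k = 2 * 2 ^ (k - 1) := by rw [← pow_succ', Nat.sub_add_cancel hk]
  have h2 := i.isLt
  rw [yKey, blockKey, show k - (k - 1 + 1) = 0 by omega, pow_zero, Nat.div_one,
    if_pos (Finset.mem_range.2 (by omega))]
  omega

/-- The finest of the knowledge partitions is equitable, since all blocks of its level are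
singletons and no gadget is left to be passed. -/
lemma degIn_eq_of_key_last (hk : 1 ≤ k) (v w : ConcealerVertex k)
    (h : key (k - 1) (Finset.range (2 ^ (k - 1))) s v =
      key (k - 1) (Finset.range (2 ^ (k - 1))) s w)
    (A : Set (ConcealerVertex k)) (hA : Saturated (key (k - 1) (Finset.range (2 ^ (k - 1))) s) A) :
    degIn (concealerGraph s) A v = degIn (concealerGraph s) A w := by
  refine degIn_eq_of_key (by omega) ⟨fun _ _ => rfl, fun l hl => absurd l.isLt (by omega)⟩ hA h ?_
  rintro i j i' j' rfl rfl t
  have hy := congrArg (fun a => a.2.1) h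
  simp only [key, yKey_last hk] at hy
  rw [Fin.ext hy]

/-- A coloring that can be reached is coarser than the finest knowledge partition. If it is also
finer, then it describes the same partition. -/
lemma equitable_of_finer (hk : 1 ≤ k) {c : ℕ} {π : Coloring (ConcealerVertex k)}
    (hr : Reach (concealerGraph s) c π)
    (hπ : (key (k - 1) (Finset.range (2 ^ (k - 1))) s).FactorsThrough π) :
    Equitable (concealerGraph s) π := fun v w hvw a =>
  degIn_eq_of_key_last s hk v w (hπ hvw) _
    ((Saturated.preimage π {a}).mono (hr.factorsThrough (degIn_eq_of_key_last s hk)))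

/-- The stable coloring can be reached at a cost that is linear in the size of the graph. -/
theorem exists_reach_stable (hk : 3 ≤ k) :
    ∃ c π, Reach (concealerGraph s) c π ∧
      (key (k - 1) (Finset.range (2 ^ (k - 1))) s).FactorsThrough π ∧
      (∀ i i', π (x i) = π (x i') → i = i') ∧
      c ≤ 19 * dartCount s + 4 * (k * k * 2 ^ k) + k * (11 * Nat.card (ConcealerVertex k)) := by
  obtain ⟨c, π₀, r₀, t₀, hb, hg₀, hc⟩ := exists_levels s hk (k - 1) (by omega)
  have k0 : 0 < k := by omega
  have hx₀ : ∀ i : Fin (2 ^ k), Saturated π₀ {x i} := by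
    intro i
    refine (hb i.val).of_eq ?_
    ext v
    have h0 : k - (k - 1 + 1) = 0 := by omega
    constructor
    · rintro ⟨i', rfl, hi'⟩
      rw [h0, pow_zero, Nat.div_one] at hi'
      rw [Fin.ext hi', Set.mem_singleton_iff]
    · rintro rfl
      exact ⟨i, rfl, by rw [h0, pow_zero, Nat.div_one]⟩
  obtain ⟨π₁, r₁, d₁⟩ := r₀.exists_round
  have t₁ := t₀.mono d₁.factors
  have hxx₁ : ∀ i, Saturated π₁ {v | ∃ j, v = xx i j} := by
    intro i
    refine ((d₁.nbrs (hx₀ i)).inter (t₁.layer 2 (by simp) (by simp))).of_eq ?_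
    ext v
    constructor
    · rintro ⟨⟨_, rfl, h⟩, hv⟩
      rcases (adj_x s).1 h with ⟨rfl, -⟩ | ⟨rfl, -⟩ | ⟨j, rfl⟩ | ⟨l, j, rfl, -⟩
      · simp [layer, tag] at hv
      · simp [layer, tag] at hv
      · exact ⟨j, rfl⟩
      · simp [layer, tag] at hv
    · rintro ⟨j, rfl⟩
      exact ⟨⟨_, rfl, ((adj_xx s).2 (.inl rfl)).symm⟩, rfl⟩
  obtain ⟨π₂, r₂, d₂⟩ := r₁.exists_round
  have t₂ := t₁.mono d₂.factors
  have hyy₂ : ∀ i, Saturated π₂ {v | ∃ j, v = yy i j} := by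
    intro i
    refine ((d₂.nbrs (hxx₁ i)).inter (t₂.layer 3 (by simp) (by simp))).of_eq ?_
    ext v
    constructor
    · rintro ⟨⟨_, ⟨j, rfl⟩, h⟩, hv⟩
      rcases (adj_xx s).1 h with rfl | ⟨j, rfl⟩
      · simp [layer, tag] at hv
      · exact ⟨j, rfl⟩
    · rintro ⟨j, rfl⟩
      exact ⟨⟨xx i j, ⟨j, rfl⟩, ((adj_yy s).2 (.inr ⟨j, rfl⟩)).symm⟩, rfl⟩
  obtain ⟨π₃, r₃, d₃⟩ := r₂.exists_round
  have t₃ := t₂.mono d₃.factors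
  have hy₃ : ∀ i, Saturated π₃ {y i} := by
    intro i
    refine ((d₃.nbrs (hyy₂ i)).inter (t₃.layer 4 (by simp) (by simp))).of_eq ?_
    ext v
    constructor
    · rintro ⟨⟨_, ⟨j, rfl⟩, h⟩, hv⟩
      rcases (adj_yy s).1 h with rfl | ⟨j, rfl⟩
      · rfl
      · simp [layer, tag] at hv
    · rintro rfl
      exact ⟨⟨yy i ⟨0, k0⟩, ⟨_, rfl⟩, ((adj_y s).2 (.inl ⟨_, rfl⟩)).symm⟩, rfl⟩
  obtain ⟨π₄, r₄, d₄⟩ := r₃.exists_round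
  have t₄ := t₃.mono d₄.factors
  have hgIn₄ : ∀ (l : Fin (k - 1)) q, Saturated π₄ {gIn l q} := by
    intro l q
    have hpos : 0 < 2 ^ (k - (l.val + 1)) := by positivity
    have hlt : q.val * 2 ^ (k - (l.val + 1)) < 2 ^ k := by
      calc q.val * 2 ^ (k - (l.val + 1)) < 2 ^ (l.val + 1) * 2 ^ (k - (l.val + 1)) :=
            Nat.mul_lt_mul_of_pos_right q.isLt hpos
        _ = 2 ^ k := by rw [← pow_add, Nat.add_sub_cancel' (by omega)]
    have hdiv : q.val * 2 ^ (k - (l.val + 1)) / 2 ^ (k - (l.val + 1)) = q.val :=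
      Nat.mul_div_cancel _ hpos
    refine ((d₄.nbrs (hy₃ ⟨_, hlt⟩)).inter (t₄.gIn l.val)).of_eq ?_
    ext v
    constructor
    · rintro ⟨⟨_, rfl, h⟩, l', q', rfl, hl⟩
      obtain rfl := Fin.ext hl
      rcases (adj_y s).1 h with ⟨t', h⟩ | ⟨l, q₁, h, hq⟩
      · simp at h
      · obtain ⟨rfl, h⟩ : l' = l ∧ q' ≍ q₁ := by simpa using h
        obtain rfl := eq_of_heq h
        rw [Set.mem_singleton_iff]
        congr
        exact Fin.ext (hq.symm.trans hdiv)
    · rintro rfl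
      exact ⟨⟨_, rfl, (adj_y s).2 (.inr ⟨l, q, rfl, hdiv⟩)⟩, l, q, rfl, rfl⟩
  obtain ⟨π₅, r₅, d₅⟩ := r₄.exists_round
  have t₅ := t₄.mono d₅.factors
  have hB₅ : ∀ (l : Fin (k - 1)) (q : Fin (2 ^ (l.val + 1))),
      Saturated π₅ {v | ∃ p j, v = innerB l p j ∧ inNumber s l p j = q.val} := by
    intro l q
    refine ((d₅.nbrs (hgIn₄ l q)).inter (t₅.layer 6 (by simp) (by simp))).of_eq ?_
    ext v
    constructor
    · rintro ⟨⟨_, rfl, h⟩, hv⟩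
      rcases (adj_gIn s).1 h with ⟨i, rfl, -⟩ | h
      · simp [layer, tag] at hv
      · exact h
    · rintro ⟨p, j, rfl, h⟩
      exact ⟨⟨_, rfl, (adj_gIn s).2 (.inr ⟨p, j, rfl, h⟩)⟩, rfl⟩
  obtain ⟨π₆, r₆, d₆⟩ := r₅.exists_round
  have t₆ := t₅.mono d₆.factors
  have hq : ∀ (l : Fin (k - 1)) (p : Fin (2 ^ l.val)), 2 * p.val + 1 < 2 ^ (l.val + 1) := by
    intro l p
    have := p.isLt
    rw [pow_succ]
    omega
  have hBB₅ : ∀ (l : Fin (k - 1)) (p : Fin (2 ^ l.val)),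
      Saturated π₅ {v | ∃ j, v = innerB l p j} := by
    intro l p
    have h0 := hB₅ l ⟨2 * p.val, by have := hq l p; omega⟩
    have h1 := hB₅ l ⟨2 * p.val + 1, hq l p⟩
    refine (Saturated.iUnion (A := fun b : Bool => cond b _ _)
      (fun b => by cases b; exacts [h0, h1])).of_eq ?_
    ext v
    rw [Set.mem_iUnion]
    constructor
    · rintro ⟨b, hv⟩
      cases b
      · obtain ⟨p', j, rfl, hj⟩ := hv
        have hpp : p' = p := Fin.ext (by rw [← inNumber_div s l p' j, hj]; simp)
        exact ⟨j, by rw [hpp]⟩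
      · obtain ⟨p', j, rfl, hj⟩ := hv
        have hpp : p' = p := Fin.ext (by rw [← inNumber_div s l p' j, hj]; simp only; omega)
        exact ⟨j, by rw [hpp]⟩
    · rintro ⟨j, rfl⟩
      have hd := inNumber_div s l p j
      rcases Nat.mod_two_eq_zero_or_one (inNumber s l p j) with h | h
      · exact ⟨false, p, j, rfl, by simp only; omega⟩
      · exact ⟨true, p, j, rfl, by simp only; omega⟩
  have hC₆ : ∀ (l : Fin (k - 1)) (p : Fin (2 ^ l.val)),
      Saturated π₆ {v | ∃ t, v = innerC l p t} := by
    intro l p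
    refine ((d₆.nbrs (hBB₅ l p)).inter (t₆.layer 7 (by simp) (by simp))).of_eq ?_
    ext v
    constructor
    · rintro ⟨⟨_, ⟨j, rfl⟩, h⟩, hv⟩
      rcases (adj_innerB s).1 h with rfl | ⟨t, rfl, -⟩
      · simp [layer, tag] at hv
      · exact ⟨t, rfl⟩
    · rintro ⟨t, rfl⟩
      exact ⟨⟨_, ⟨_, rfl⟩, (adj_innerB s).2 (.inr ⟨t, rfl, (downPartner_spec t 0).1⟩)⟩, rfl⟩
  -- in the correct pair, `c_3` is the only vertex without a neighbor among `β_0` and `β_2`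
  have hC₆' : ∀ l : Fin (k - 1), Saturated π₆ {innerC l (s l) 3} := by
    intro l
    refine ((hC₆ l (s l)).diff
      (d₆.nbrs (hB₅ l ⟨2 * (s l).val, by have := hq l (s l); omega⟩))).of_eq ?_
    ext v
    constructor
    · rintro ⟨⟨t, rfl⟩, hn⟩
      have h2 : ∀ t : Fin 4, t ≠ 3 → ∃ j : Fin 4, (j, t) ∈ cfiEdges ∧ j.val % 2 = 0 := by decide
      by_contra ht
      obtain ⟨j, h3, h4⟩ := h2 t (fun e => ht (by rw [e]; rfl))
      refine hn ⟨innerB l (s l) j, ⟨_, j, rfl, ?_⟩, (adj_innerB s).2 (.inr ⟨t, rfl, h3⟩)⟩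
      rw [inNumber, if_pos rfl, h4, add_zero]
    · rintro rfl
      refine ⟨⟨3, rfl⟩, ?_⟩
      rintro ⟨_, ⟨p, j, rfl, hj⟩, h⟩
      rcases (adj_innerB s).1 h with h | ⟨t, h, ht⟩
      · simp at h
      · simp only [innerC.injEq, heq_eq_eq, true_and] at h
        obtain ⟨hp, rfl⟩ := h
        have hj' : inNumber s l p j = 2 * (s l).val := hj
        rw [inNumber, if_pos hp.symm, hp] at hj'
        have h2 : ∀ j : Fin 4, (j, 3) ∈ cfiEdges → j.val % 2 ≠ 0 := by decide
        exact h2 j ht (by omega)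
  obtain ⟨π₇, r₇, d₇⟩ := r₆.exists_round
  have t₇ := t₆.mono d₇.factors
  have hU₇ : ∀ (l : Fin (k - 1)) (p : Fin (2 ^ l.val)), Saturated π₇ {v | ∃ j, v = uOut l p j} := by
    intro l p
    refine ((d₇.nbrs (hC₆ l p)).inter (t₇.layer 8 (by simp) (by simp))).of_eq ?_
    ext v
    constructor
    · rintro ⟨⟨_, ⟨t, rfl⟩, h⟩, hv⟩
      rcases (adj_innerC s).1 h with ⟨j, rfl, -⟩ | ⟨j, rfl, -⟩
      · simp [layer, tag] at hv
      · exact ⟨j, rfl⟩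
    · rintro ⟨j, rfl⟩
      exact ⟨⟨innerC l p ⟨2 * j.val, by omega⟩, ⟨_, rfl⟩,
        (adj_innerC s).2 (.inr ⟨j, rfl, by simp⟩)⟩, rfl⟩
  obtain ⟨π₈, r₈, d₈⟩ := r₇.exists_round
  have t₈ := t₇.mono d₈.factors
  have hgOut₈ : ∀ (l : Fin (k - 1)) (j : Fin 2), Saturated π₈ {gOut l j} := by
    intro l j
    have h0 : Saturated π₈ {gOut l 0} := d₈.mono (d₇.mono (d₆.mono (d₅.mono (d₄.mono (d₃.mono
      (d₂.mono (d₁.mono (hg₀ l l.isLt))))))))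
    fin_cases j
    · exact h0
    · refine (((d₈.nbrs (hU₇ l ⟨0, by positivity⟩)).inter
        (t₈.layer 9 (by simp) (by simp))).diff h0).of_eq ?_
      ext v
      constructor
      · rintro ⟨⟨⟨_, ⟨j, rfl⟩, h⟩, hv⟩, hv'⟩
        rcases (adj_uOut s).1 h with ⟨t, rfl, -⟩ | rfl
        · simp [layer, tag] at hv
        · fin_cases j
          · exact absurd rfl hv'
          · rfl
      · rintro rfl
        exact ⟨⟨⟨_, ⟨1, rfl⟩, (adj_uOut s).2 (.inr rfl)⟩, rfl⟩, by simp⟩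
  obtain ⟨π₉, r₉, d₉⟩ := r₈.exists_round
  have t₉ := t₈.mono d₉.factors
  have huOut₉ : ∀ (l : Fin (k - 1)) (p : Fin (2 ^ l.val)) (j : Fin 2),
      Saturated π₉ {uOut l p j} := by
    intro l p j
    refine ((d₉.nbrs (hgOut₈ l j)).inter (d₉.mono (d₈.mono (hU₇ l p)))).of_eq ?_
    ext v
    constructor
    · rintro ⟨⟨_, rfl, h⟩, j', rfl⟩
      rcases (adj_gOut s).1 h with ⟨p', h⟩ | ⟨i, h, -⟩
      · simp only [uOut.injEq, heq_eq_eq, true_and] at h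
        rw [h.2, Set.mem_singleton_iff]
      · simp at h
    · rintro rfl
      exact ⟨⟨_, rfl, (adj_gOut s).2 (.inl ⟨p, rfl⟩)⟩, j, rfl⟩
  obtain ⟨π', r', d'⟩ := r₉.exists_round
  have t' := t₉.mono d'.factors
  have hCC : ∀ (l : Fin (k - 1)) (p : Fin (2 ^ l.val)) (j : Fin 2),
      Saturated π' {v | ∃ t : Fin 4, v = innerC l p t ∧ t.val / 2 = j.val} := by
    intro l p j
    refine ((d'.nbrs (huOut₉ l p j)).inter (t'.layer 7 (by simp) (by simp))).of_eq ?_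
    ext v
    constructor
    · rintro ⟨⟨_, rfl, h⟩, hv⟩
      rcases (adj_uOut s).1 h with h | rfl
      · exact h
      · simp [layer, tag] at hv
    · rintro ⟨t, rfl, ht⟩
      exact ⟨⟨_, rfl, (adj_uOut s).2 (.inl ⟨t, rfl, ht⟩)⟩, rfl⟩
  have m₆ : ∀ {A}, Saturated π₆ A → Saturated π' A := fun h =>
    d'.mono (d₉.mono (d₈.mono (d₇.mono h)))
  have m₂ : ∀ {A}, Saturated π₂ A → Saturated π' A := fun h =>
    m₆ (d₆.mono (d₅.mono (d₄.mono (d₃.mono h))))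
  have m₀ : ∀ {A}, Saturated π₀ A → Saturated π' A := fun h => m₂ (d₂.mono (d₁.mono h))
  refine ⟨_, π', r', ?_, ?_, ?_⟩
  · intro v w h
    cases v with
    | start a => rw [show w = start a from t'.start a _ _ h rfl]
    | x i => rw [show w = x i from m₀ (hx₀ i) _ _ h rfl]
    | xx i j =>
      obtain ⟨j', rfl⟩ := m₂ (d₂.mono (hxx₁ i)) _ _ h ⟨j, rfl⟩
      rfl
    | yy i j =>
      obtain ⟨j', rfl⟩ := m₂ (hyy₂ i) _ _ h ⟨j, rfl⟩
      rfl
    | y i =>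
      rw [show w = y i from m₆ (d₆.mono (d₅.mono (d₄.mono (hy₃ i)))) _ _ h rfl]
    | gIn l q => rw [show w = gIn l q from m₆ (d₆.mono (d₅.mono (hgIn₄ l q))) _ _ h rfl]
    | innerB l p j =>
      obtain ⟨p', j', rfl, hj⟩ :=
        m₆ (d₆.mono (hB₅ l ⟨_, inNumber_lt s l p j⟩)) _ _ h ⟨p, j, rfl, rfl⟩
      simp only [key, hj]
    | innerC l p t =>
      obtain ⟨t', rfl, ht⟩ := hCC l p (half t) _ _ h ⟨t, rfl, rfl⟩
      have ht' : t'.val / 2 = t.val / 2 := ht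
      have h3 : p = s l → (t = 3 ↔ t' = 3) := by
        intro hp
        have := (m₆ (hC₆' l)).mem_iff h
        simpa [hp] using this
      simp only [key, if_pos l.isLt, Prod.mk.injEq, true_and]
      have ht4 := t.isLt
      have ht4' := t'.isLt
      by_cases ht2 : t.val < 2
      · have ht2' : t'.val < 2 := by omega
        rw [if_pos ht2, if_pos ht2']
      · have ht2' : ¬ t'.val < 2 := by omega
        rw [if_neg ht2, if_neg ht2']
        by_cases hp : p = s l
        · have h33 : t.val = 3 ↔ t'.val = 3 := by
            simpa [Fin.ext_iff] using h3 hp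
          rw [if_pos hp, if_pos hp]
          omega
        · rw [if_neg hp, if_neg hp]
    | uOut l p j => rw [show w = uOut l p j from d'.mono (huOut₉ l p j) _ _ h rfl]
    | gOut l j => rw [show w = gOut l j from d'.mono (d₉.mono (hgOut₈ l j)) _ _ h rfl]
  · intro i i' h
    have : x i' = x i := m₀ (hx₀ i) _ _ h rfl
    simpa using this.symm
  · have h1 : (k - 1) * (11 * Nat.card (ConcealerVertex k)) ≤
        k * (11 * Nat.card (ConcealerVertex k)) := Nat.mul_le_mul_right _ (by omega)
    change c + dartCount s + dartCount s + dartCount s + dartCount s + dartCount s + dartCount s +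
      dartCount s + dartCount s + dartCount s + dartCount s ≤ _
    omega

end Final

/-! ### The size of concealer graphs -/

section Size

open ConcealerVertex

variable {k : ℕ} (s : CorrectPairs k)

lemma ncard_range_le {α β : Type} [Finite α] (f : α → β) : (Set.range f).ncard ≤ Nat.card α := by
  rw [← Set.image_univ, ← Set.ncard_univ]
  exact Set.ncard_image_le (Set.toFinite _)

lemma ncard_union_le_add {α : Type} {A B : Set α} {a b : ℕ} (hA : A.ncard ≤ a) (hB : B.ncard ≤ b) :
    (A ∪ B).ncard ≤ a + b :=
  (Set.ncard_union_le A B).trans (Nat.add_le_add hA hB)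

lemma card_gadgets_le (c d : ℕ) :
    Nat.card (Σ l : Fin (k - 1), Fin (2 ^ l.val) × Fin c × Fin d) ≤ k * 2 ^ k * (c * d) := by
  simp only [Nat.card_eq_fintype_card, Fintype.card_sigma, Fintype.card_prod, Fintype.card_fin]
  rw [← Finset.sum_mul]
  refine Nat.mul_le_mul_right _ ((Finset.sum_le_card_nsmul _ _ (2 ^ k) fun l _ =>
    Nat.pow_le_pow_right two_pos (by omega)).trans ?_)
  rw [Finset.card_univ, Fintype.card_fin, smul_eq_mul]
  exact Nat.mul_le_mul_right _ (by omega)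

lemma card_vertex_le (hk : 1 ≤ k) : Nat.card (ConcealerVertex k) ≤ 20 * (k * 2 ^ k) := by
  have hcover : (Set.univ : Set (ConcealerVertex k)) ⊆
      Set.range start ∪ (Set.range x ∪ (Set.range (fun a : Fin (2 ^ k) × Fin k => xx a.1 a.2) ∪
      (Set.range (fun a : Fin (2 ^ k) × Fin k => yy a.1 a.2) ∪ (Set.range y ∪
      (Set.range (fun a : Σ l : Fin (k - 1), Fin (2 ^ (l.val + 1)) => gIn a.1 a.2) ∪
      (Set.range (fun a : Σ l : Fin (k - 1), Fin (2 ^ l.val) × Fin 1 × Fin 4 =>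
        innerB a.1 a.2.1 a.2.2.2) ∪
      (Set.range (fun a : Σ l : Fin (k - 1), Fin (2 ^ l.val) × Fin 1 × Fin 4 =>
        innerC a.1 a.2.1 a.2.2.2) ∪
      (Set.range (fun a : Σ l : Fin (k - 1), Fin (2 ^ l.val) × Fin 1 × Fin 2 =>
        uOut a.1 a.2.1 a.2.2.2) ∪
      Set.range (fun a : Fin (k - 1) × Fin 2 => gOut a.1 a.2))))))))) := by
    rintro v -
    cases v with
    | start a => exact .inl ⟨a, rfl⟩
    | x i => exact .inr (.inl ⟨i, rfl⟩)
    | xx i j => exact .inr (.inr (.inl ⟨(i, j), rfl⟩))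
    | yy i j => exact .inr (.inr (.inr (.inl ⟨(i, j), rfl⟩)))
    | y i => exact .inr (.inr (.inr (.inr (.inl ⟨i, rfl⟩))))
    | gIn l q => exact .inr (.inr (.inr (.inr (.inr (.inl ⟨⟨l, q⟩, rfl⟩)))))
    | innerB l p j => exact .inr (.inr (.inr (.inr (.inr (.inr (.inl ⟨⟨l, p, 0, j⟩, rfl⟩))))))
    | innerC l p j =>
      exact .inr (.inr (.inr (.inr (.inr (.inr (.inr (.inl ⟨⟨l, p, 0, j⟩, rfl⟩)))))))
    | uOut l p j =>
      exact .inr (.inr (.inr (.inr (.inr (.inr (.inr (.inr (.inl ⟨⟨l, p, 0, j⟩, rfl⟩))))))))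
    | gOut l j =>
      exact .inr (.inr (.inr (.inr (.inr (.inr (.inr (.inr (.inr ⟨(l, j), rfl⟩))))))))
  have hgIn : Nat.card (Σ l : Fin (k - 1), Fin (2 ^ (l.val + 1))) ≤ k * 2 ^ k := by
    simp only [Nat.card_eq_fintype_card, Fintype.card_sigma, Fintype.card_fin]
    refine (Finset.sum_le_card_nsmul _ _ (2 ^ k) fun l _ =>
      Nat.pow_le_pow_right two_pos (by omega)).trans ?_
    rw [Finset.card_univ, Fintype.card_fin, smul_eq_mul]
    exact Nat.mul_le_mul_right _ (by omega)
  have h := (Set.ncard_le_ncard hcover (Set.toFinite _)).trans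
    (ncard_union_le_add (ncard_range_le _) (ncard_union_le_add (ncard_range_le _)
    (ncard_union_le_add (ncard_range_le _) (ncard_union_le_add (ncard_range_le _)
    (ncard_union_le_add (ncard_range_le _) (ncard_union_le_add ((ncard_range_le _).trans hgIn)
    (ncard_union_le_add ((ncard_range_le _).trans (card_gadgets_le 1 4))
    (ncard_union_le_add ((ncard_range_le _).trans (card_gadgets_le 1 4))
    (ncard_union_le_add ((ncard_range_le _).trans (card_gadgets_le 1 2))
    (ncard_range_le _))))))))))
  simp only [Set.ncard_univ, Nat.card_prod, Nat.card_fin] at h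
  have h1 : 2 ^ k ≤ k * 2 ^ k := Nat.le_mul_of_pos_left _ hk
  have h2 : k * 1 ≤ k * 2 ^ k := Nat.mul_le_mul_left _ Nat.one_le_two_pow
  have h3 : 2 ^ k * k = k * 2 ^ k := mul_comm _ _
  have h4 : 1 ≤ k * 2 ^ k := Nat.mul_pos hk (by positivity)
  omega

lemma dartCount_le (hk : 1 ≤ k) : dartCount s ≤ 80 * (k * k * 2 ^ k) := by
  set E : Set (ConcealerVertex k × ConcealerVertex k) := {e | ConcealerEdge s e.1 e.2}
  have hcover : E ⊆
      Set.range (fun _ : Fin 1 => (start 0, start 1)) ∪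
      (Set.range (fun a : Fin 3 × Fin (2 ^ k) => (start a.1, x a.2)) ∪
      (Set.range (fun a : Fin (2 ^ k) × Fin k => (x a.1, xx a.1 a.2)) ∪
      (Set.range (fun a : Fin (2 ^ k) × Fin k × Fin k => (xx a.1 a.2.1, yy a.1 a.2.2)) ∪
      (Set.range (fun a : Fin (2 ^ k) × Fin k => (yy a.1 a.2, y a.1)) ∪
      (Set.range (fun a : Fin (2 ^ k) × Fin (k - 1) => (y a.1, gIn a.2
        ⟨a.1.val / 2 ^ (k - (a.2.val + 1)), Nat.div_two_pow_lt a.1.isLt (by omega)⟩)) ∪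
      (Set.range (fun a : Σ l : Fin (k - 1), Fin (2 ^ l.val) × Fin 1 × Fin 4 =>
        (gIn a.1 ⟨inNumber s a.1 a.2.1 a.2.2.2, inNumber_lt s _ _ _⟩,
          innerB a.1 a.2.1 a.2.2.2)) ∪
      (Set.range (fun a : Σ l : Fin (k - 1), Fin (2 ^ l.val) × Fin 4 × Fin 4 =>
        (innerB a.1 a.2.1 a.2.2.1, innerC a.1 a.2.1 a.2.2.2)) ∪
      (Set.range (fun a : Σ l : Fin (k - 1), Fin (2 ^ l.val) × Fin 4 × Fin 2 =>
        (innerC a.1 a.2.1 a.2.2.1, uOut a.1 a.2.1 a.2.2.2)) ∪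
      (Set.range (fun a : Σ l : Fin (k - 1), Fin (2 ^ l.val) × Fin 1 × Fin 2 =>
        (uOut a.1 a.2.1 a.2.2.2, gOut a.1 a.2.2.2)) ∪
      Set.range (fun a : Fin (2 ^ k) × Fin (k - 1) => (gOut a.2
        ⟨a.1.val / 2 ^ (k - (a.2.val + 2)) % 2, Nat.mod_lt _ two_pos⟩, x a.1))))))))))) := by
    rintro ⟨u, v⟩ h
    have h' : ConcealerEdge s u v := h
    cases h' with
    | start => exact .inl ⟨0, rfl⟩
    | startLeft i _ => exact .inr (.inl ⟨(1, i), rfl⟩)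
    | startRight i _ => exact .inr (.inl ⟨(2, i), rfl⟩)
    | x_xx i j => exact .inr (.inr (.inl ⟨(i, j), rfl⟩))
    | xx_yy i j t => exact .inr (.inr (.inr (.inl ⟨(i, j, t), rfl⟩)))
    | yy_y i j => exact .inr (.inr (.inr (.inr (.inl ⟨(i, j), rfl⟩))))
    | y_gIn i l q hq =>
      refine .inr (.inr (.inr (.inr (.inr (.inl ⟨(i, l), ?_⟩)))))
      simp [hq]
    | gIn_correct l q p j hp hq =>
      refine .inr (.inr (.inr (.inr (.inr (.inr (.inl ⟨⟨l, p, 0, j⟩, ?_⟩))))))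
      have : inNumber s l p j = q.val := by rw [inNumber, if_pos hp, hq]
      simp [this]
    | gIn_deadEnd l q p j hp hq =>
      refine .inr (.inr (.inr (.inr (.inr (.inr (.inl ⟨⟨l, p, 0, j⟩, ?_⟩))))))
      have : inNumber s l p j = q.val := by rw [inNumber, if_neg hp, hq]
      simp [this]
    | innerB_innerC l p j t _ =>
      exact .inr (.inr (.inr (.inr (.inr (.inr (.inr (.inl ⟨⟨l, p, j, t⟩, rfl⟩)))))))
    | innerC_uOut l p j t _ =>
      exact .inr (.inr (.inr (.inr (.inr (.inr (.inr (.inr (.inl ⟨⟨l, p, j, t⟩, rfl⟩))))))))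
    | uOut_gOut l p j =>
      exact .inr (.inr (.inr (.inr (.inr (.inr (.inr (.inr (.inr
        (.inl ⟨⟨l, p, 0, j⟩, rfl⟩)))))))))
    | gOut_x l j i hj =>
      refine .inr (.inr (.inr (.inr (.inr (.inr (.inr (.inr (.inr (.inr ⟨(i, l), ?_⟩)))))))))
      simp [hj]
  have h := (Set.ncard_le_ncard hcover (Set.toFinite _)).trans
    (ncard_union_le_add (ncard_range_le _) (ncard_union_le_add (ncard_range_le _)
    (ncard_union_le_add (ncard_range_le _) (ncard_union_le_add (ncard_range_le _)
    (ncard_union_le_add (ncard_range_le _) (ncard_union_le_add (ncard_range_le _)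
    (ncard_union_le_add ((ncard_range_le _).trans (card_gadgets_le 1 4))
    (ncard_union_le_add ((ncard_range_le _).trans (card_gadgets_le 4 4))
    (ncard_union_le_add ((ncard_range_le _).trans (card_gadgets_le 4 2))
    (ncard_union_le_add ((ncard_range_le _).trans (card_gadgets_le 1 2))
    (ncard_range_le _)))))))))))
  simp only [Nat.card_prod, Nat.card_fin] at h
  have hdarts : dartsBetween (concealerGraph s) Set.univ Set.univ ⊆ E ∪ Prod.swap '' E := by
    rintro ⟨u, v⟩ ⟨-, -, h⟩
    rcases (concealer_adj_iff s).1 h with h | h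
    · exact .inl h
    · exact .inr ⟨(v, u), h, rfl⟩
  have h' := (Set.ncard_le_ncard hdarts (Set.toFinite _)).trans
    (ncard_union_le_add le_rfl (Set.ncard_image_le (Set.toFinite _)))
  have h1 : k * 2 ^ k ≤ k * k * 2 ^ k := by
    rw [mul_assoc]
    exact Nat.le_mul_of_pos_left _ hk
  have h2 : 2 ^ k ≤ k * 2 ^ k := Nat.le_mul_of_pos_left _ hk
  have h3 : 1 ≤ 2 ^ k := Nat.one_le_two_pow
  have h4 : 2 ^ k * (k - 1) ≤ k * 2 ^ k := by
    rw [mul_comm]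
    exact Nat.mul_le_mul_right _ (by omega)
  have h5 : 2 ^ k * k = k * 2 ^ k := mul_comm _ _
  have h6 : 2 ^ k * (k * k) = k * k * 2 ^ k := mul_comm _ _
  unfold dartCount
  omega

lemma graphSize_le (hk : 1 ≤ k) : graphSize (concealerGraph s) ≤ 100 * (k * k * 2 ^ k) := by
  have h1 := card_vertex_le hk
  have h2 := (edgesBetween_le_darts (concealerGraph s) Set.univ Set.univ).trans (dartCount_le s hk)
  have h3 : (concealerGraph s).edgeSet.ncard ≤
      edgesBetween (concealerGraph s) Set.univ Set.univ := by
    refine Set.ncard_le_ncard (fun e he => ⟨he, ?_⟩) (Set.toFinite _)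
    induction e with
    | _ u v => exact ⟨u, v, trivial, trivial, rfl⟩
  have h4 : k * 2 ^ k ≤ k * k * 2 ^ k := by
    rw [mul_assoc]
    exact Nat.le_mul_of_pos_left _ hk
  unfold graphSize
  omega

lemma le_graphSize : k * k * 2 ^ k ≤ graphSize (concealerGraph s) := by
  have h1 := card_mul_le_edgesBetween s (A := Set.univ) (C := Set.univ) Finset.univ (by simp)
  rw [Finset.card_univ, Fintype.card_fin, mul_comm] at h1
  have h2 : edgesBetween (concealerGraph s) Set.univ Set.univ ≤
      (concealerGraph s).edgeSet.ncard :=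
    Set.ncard_le_ncard (fun e he => he.1) (Set.toFinite _)
  unfold graphSize
  omega

lemma IsOpt.le_concealer (hk : 3 ≤ k) {n : ℕ} (h : IsOpt (concealerGraph s) n) :
    n ≤ 1744 * (k * k * 2 ^ k) := by
  obtain ⟨c, π, hr, hf, -, hc⟩ := exists_reach_stable s hk
  have h1 := h.le_of_reach hr (equitable_of_finer s (by omega) hr hf)
  have h2 := dartCount_le s (by omega)
  have h3 : k * (11 * Nat.card (ConcealerVertex k)) ≤ 220 * (k * k * 2 ^ k) := by
    calc k * (11 * Nat.card (ConcealerVertex k)) ≤ k * (11 * (20 * (k * 2 ^ k))) :=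
          Nat.mul_le_mul_left _ (Nat.mul_le_mul_left _ (card_vertex_le (by omega)))
      _ = 220 * (k * k * 2 ^ k) := by ring
  omega

/-- Already the first level costs `k * k * 2 ^ (k - 1)`, whatever the strategy. -/
lemma IsOpt.concealer_le (hk : 3 ≤ k) {n : ℕ} (h : IsOpt (concealerGraph s) n) :
    k * k * 2 ^ k ≤ 2 * n := by
  obtain ⟨W, hW, hn⟩ := h.1
  have h1 := le_cost_of_terminates W (k := k) (by omega)
    (fun s => by
      obtain ⟨c, π, hr, -, hx, -⟩ := exists_reach_stable s hk
      exact ⟨c, π, hr, hx⟩)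
    (fun s => hW _ _) s
  rw [← hn, Nat.cast_le] at h1
  have h2 : k * k * 2 ^ k = 2 * (k * k * 2 ^ (k - 1)) := by
    conv_lhs => rw [show k = k - 1 + 1 by omega, pow_succ]
    rw [Nat.sub_add_cancel (by omega)]
    ring
  omega

lemma log_le_of_le {n : ℕ} (hk : 3 ≤ k) (h : n ≤ 1744 * (k * k * 2 ^ k)) :
    Real.log n ≤ 14 * ((k - 1 : ℕ) : ℝ) := by
  rcases Nat.eq_zero_or_pos n with rfl | hn
  · simp
  have h1 : n ≤ 2 ^ (11 + 3 * k) := by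
    calc n ≤ 1744 * (k * k * 2 ^ k) := h
      _ ≤ 2 ^ 11 * (2 ^ k * 2 ^ k * 2 ^ k) := by
          have := Nat.lt_two_pow_self (n := k)
          gcongr
          norm_num
      _ = 2 ^ (11 + 3 * k) := by ring
  have h2 : Real.log n ≤ Real.log ((2 : ℝ) ^ (11 + 3 * k)) :=
    Real.log_le_log (by exact_mod_cast hn) (by exact_mod_cast h1)
  rw [Real.log_pow] at h2
  have h3 : Real.log 2 ≤ 1 := by
    have := Real.log_le_sub_one_of_pos (two_pos (α := ℝ))
    linarith
  have h4 : ((11 + 3 * k : ℕ) : ℝ) ≤ ((14 * (k - 1) : ℕ) : ℝ) := by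
    refine Nat.cast_le.2 ?_
    omega
  have h5 : ((11 + 3 * k : ℕ) : ℝ) * Real.log 2 ≤ ((11 + 3 * k : ℕ) : ℝ) * 1 :=
    mul_le_mul_of_nonneg_left h3 (Nat.cast_nonneg _)
  push_cast at h2 h4 h5 ⊢
  linarith

end Size

end

theorem theorem1 (W : Strategy) :
    ∃ (s : (k : ℕ) → CorrectPairs k) (opt : ℕ → ℕ),
      (∀ k, IsOpt (concealerGraph (s k)) (opt k)) ∧
      (fun k => (opt k : ℝ)) =Θ[atTop] (fun k => (graphSize (concealerGraph (s k)) : ℝ)) ∧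
      ∃ c : ℝ, 0 < c ∧ ∀ᶠ k in atTop,
        ENNReal.ofReal (c * ((opt k : ℝ) * Real.log (opt k))) ≤
          ((W.cost (concealerGraph (s k)) : ℕ∞) : ENNReal) := by
  have hex : ∀ k, ∃ s : CorrectPairs k, 3 ≤ k →
      (((k - 1) * (k * k * 2 ^ (k - 1)) : ℕ) : ℕ∞) ≤ W.cost (concealerGraph s) := by
    intro k
    by_cases hk : 3 ≤ k
    · obtain ⟨s, hs⟩ := exists_le_cost (k := k) W fun s => by
        obtain ⟨c, π, hr, -, hx, -⟩ := exists_reach_stable s hk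
        exact ⟨c, π, hr, hx⟩
      exact ⟨s, fun _ => hs⟩
    · exact ⟨fun l => ⟨0, by positivity⟩, fun h => absurd h hk⟩
  choose s hs using hex
  choose opt hopt using fun k => exists_isOpt (concealerGraph (s k))
  have hupper : ∀ k, 3 ≤ k → opt k ≤ 1744 * (k * k * 2 ^ k) :=
    fun k hk => (hopt k).le_concealer (s k) hk
  refine ⟨s, opt, hopt, ⟨?_, ?_⟩, 1 / (2 * 1744 * 14), by norm_num, ?_⟩
  · refine IsBigO.of_bound 1744 (eventually_atTop.2 ⟨3, fun k hk => ?_⟩)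
    rw [Real.norm_natCast, Real.norm_natCast]
    have := (hupper k hk).trans (Nat.mul_le_mul_left 1744 (le_graphSize (s k)))
    exact_mod_cast this
  · refine IsBigO.of_bound 200 (eventually_atTop.2 ⟨3, fun k hk => ?_⟩)
    rw [Real.norm_natCast, Real.norm_natCast]
    have h1 := graphSize_le (s k) (by omega)
    have h2 := (hopt k).concealer_le (s k) hk
    have : graphSize (concealerGraph (s k)) ≤ 200 * opt k := by omega
    exact_mod_cast this
  · refine eventually_atTop.2 ⟨3, fun k hk => ?_⟩
    refine le_trans ?_ (ENat.toENNReal_le.2 (hs k hk))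
    rw [ENat.toENNReal_coe, ← ENNReal.ofReal_natCast]
    refine ENNReal.ofReal_le_ofReal ?_
    have h1 : (opt k : ℝ) ≤ 1744 * (2 * (k * k * 2 ^ (k - 1) : ℕ)) := by
      have h2 : k * k * 2 ^ k = 2 * (k * k * 2 ^ (k - 1)) := by
        conv_lhs => rw [show k = k - 1 + 1 by omega, pow_succ]
        rw [Nat.sub_add_cancel (by omega)]
        ring
      have := h2 ▸ hupper k hk
      exact_mod_cast this
    have h2 := mul_le_mul h1 (log_le_of_le hk (hupper k hk)) (Real.log_natCast_nonneg _)
      (by positivity)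
    rw [Nat.cast_mul]
    calc 1 / (2 * 1744 * 14) * ((opt k : ℝ) * Real.log (opt k))
        ≤ 1 / (2 * 1744 * 14) * (1744 * (2 * ((k * k * 2 ^ (k - 1) : ℕ) : ℝ)) *
            (14 * ((k - 1 : ℕ) : ℝ))) := mul_le_mul_of_nonneg_left h2 (by norm_num)
      _ = ((k - 1 : ℕ) : ℝ) * ((k * k * 2 ^ (k - 1) : ℕ) : ℝ) := by ring
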